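/- Let $\mathcal{F}^\omega[\mathbb{P}]$ be the following classical system. It is weakly extensional Peano arithmetic $\mathsf{WE}\mbox{-}\mathsf{PA}^\omega$ (many-sorted classical logic with equality at type $0$ as the only relation symbol; zero, successor, induction; the combinators $\Pi,\Sigma$ and simultaneous primitive recursors in all types; the quantifier-free extensionality rule, which from $\varphi_0\to s=_\rho t$ with $\varphi_0$ quantifier-free derives $\varphi_0\to r[s]=_\tau r[t]$) over all finite types built from the ground types $0$, $\Omega$ (sample points) and $S$ (events), where $\tau(\sigma)$ is the type of functionals from $\sigma$ to $\tau$ and $1:=0(0)$. It also has quantifier-free choice $\mathsf{QF}\mbox{-}\mathsf{AC}$ and dependent choice $\mathsf{DC}$ for tuples of variables of all types; constants for equality on $\Omega$, $\in$, $\cup$, $(\cdot)^c$, $\emptyset$, an element of $\Omega$, and $\mathbb{P}$ of type $1(S)$; and axioms saying that equality on $\Omega$ is an equivalence relation, that $\in$ obeys the set-theoretic laws for $\cup$, $(\cdot)^c$, $\emptyset$, and that $\mathbb{P}$ is a probability content: $0\le\mathbb{P}(A)\le 1$, $\mathbb{P}(\emptyset)=0$, $\mathbb{P}(\emptyset^c)=1$,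 $A\subseteq B\to\mathbb{P}(A)\le\mathbb{P}(B)$ and $\mathbb{P}(A\cup B)=\mathbb{P}(A)+\mathbb{P}(B)-\mathbb{P}(A\cap B)$. Real numbers are represented by objects of type $1$, as sequences of coded rationals with Cauchy modulus $2^{-n}$. Equality of events $A=_SB$ means $\forall\varpi^\Omega(\varpi\in A\leftrightarrow\varpi\in B)$, and equality at function types is pointwise. Let $\mathsf{UB}^\Omega_0$ be the uniform boundedness principle, i.e. the schema $$\forall y^{\alpha(0)}\Big(\forall k^0,x^\alpha,\underline z^{\underline\beta}\,\exists w^0\,\varphi_\exists(y,k,\min\nolimits_\alpha(x,yk),\underline z,w)\to\exists\chi^{1}\,\forall k^0,x^\alpha,\underline z^{\underline\beta}\,\exists w\le_0\chi k\;\varphi_\exists(y,k,\min\nolimits_\alpha(x,yk),\underline z,w)\Big),$$ where $\alpha=0(\sigma_k)\dots(\sigma_1)$, each type in $\underline\beta$ has the form $\Omega(\tau_m)\dots(\tau_1)$, $\min_\alpha$ is the pointwise minimum, and $\varphi_\exists$ (possibly with parameters) is a block of existential quantifiers of admissible types in front of a quantifier-free formula. A type is small if it is $\rho(0)\dots(0)$,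 and admissible if it is $\rho(\sigma_j)\dots(\sigma_1)$ with all $\sigma_i$ small, where $\rho\in\{0,\Omega,S\}$. For a formula $\varphi(\varpi^\Omega)$ and a real $\lambda$, write $\mathbb{P}[\varphi]\ge\lambda$ for the formula $\forall A^S(\mathbb{P}(A)<\lambda\to\exists\varpi^\Omega(\varpi\in A^c\wedge\varphi(\varpi)))$, and $\mathbb{P}[\varphi]\le\lambda$ for $\mathbb{P}[\overline\varphi]\ge 1-\lambda$, where $\overline\varphi$ is the De Morgan dual of $\varphi$. For $A^{S(0)}$ let $(A{\uparrow})_0:=A_0$ and $(A{\uparrow})_{n+1}:=A_{n+1}\cap\big(\bigcup_{i=0}^nA_i\big)^c$. **Proposition.** The system $\mathcal{F}^\omega[\mathbb{P}]+\mathsf{UB}^\Omega_0$ proves ($\sigma$-additivity), i.e. the conjunction of $$\forall A^{S(0)}\,\forall l^0\Big(\mathbb{P}[\exists n^0(\varpi\in A_n)]\ge\sum_{n=0}^l\mathbb{P}((A{\uparrow})_n)\Big)$$ and $$\forall A^{S(0)}\,\forall k^0\,\exists l^0\Big(\mathbb{P}[\exists n^0(\varpi\in A_n)]\le\sum_{n=0}^l\mathbb{P}((A{\uparrow})_n)+2^{-k}\Big).$$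 -/

import Mathlib

/-! The classical system of finite type arithmetic for probability contents: its types, terms,
formulas and derivations, the coding of real numbers in it, the outer content of a formula, the
uniform boundedness principle, and the statement of sigma-additivity. -/

namespace ProbContent

/-! ### Types -/

/-- Finite types over the ground types `0` (`nat`), `Ω` (`sample`) and `S` (`event`). The type
`τ(σ)` of functionals mapping type `σ` to type `τ` is `arr σ τ`, written `σ ⇒ₜ τ`. -/
inductive Ty : Type
  | nat : Ty
  | sample : Ty
  | event : Ty
  | arr : Ty → Ty → Ty

infixr:60 " ⇒ₜ " => Ty.arr

namespace Ty

/-- The type `1 = 0(0)`, whose objects represent real numbers. -/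
abbrev real : Ty := nat ⇒ₜ nat

/-- `arrows [σ₁, …, σₖ] τ` is `τ(σₖ)…(σ₁)`: arguments of types `σ₁, …, σₖ`, in this order. -/
def arrows : List Ty → Ty → Ty
  | [], τ => τ
  | σ :: σs, τ => σ ⇒ₜ arrows σs τ

/-- Small types: `ρ(0)…(0)` with `ρ` a ground type. -/
def Small : Ty → Prop
  | nat => True
  | sample => True
  | event => True
  | arr σ τ => σ = nat ∧ Small τ

/-- Admissible types: `ρ(σₖ)…(σ₁)` with `ρ` a ground type and all `σᵢ` small. -/
def Admissible : Ty → Prop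
  | nat => True
  | sample => True
  | event => True
  | arr σ τ => Small σ ∧ Admissible τ

/-- Types of the form `Ω(τₘ)…(τ₁)`. -/
def EndsInSample : Ty → Prop
  | nat => False
  | sample => True
  | event => False
  | arr _ τ => EndsInSample τ

/-- The type of the step functional for the component of type `ρ` in a simultaneous recursion
with component types `ρs`: it takes the tuple of previous values and the recursion index. -/
abbrev step (ρs : List Ty) (ρ : Ty) : Ty := arrows ρs (nat ⇒ₜ ρ)

end Ty

open Ty

/-! ### Variables and terms -/

/-- A context: the list of the types of the free variables, the most recently bound first. -/
abbrev Ctx : Type := List Ty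

/-- The variables of type `τ` in a context (de Bruijn indices, typed). -/
inductive Var : Ctx → Ty → Type
  | zero {Γ : Ctx} {τ : Ty} : Var (τ :: Γ) τ
  | succ {Γ : Ctx} {σ τ : Ty} (v : Var Γ τ) : Var (σ :: Γ) τ

namespace Var

/-- A variable of the first part of a concatenated context. -/
def inl {Δ Γ : Ctx} {τ : Ty} : Var Δ τ → Var (Δ ++ Γ) τ
  | zero => zero
  | succ v => succ (inl v)

/-- A variable of the second part of a concatenated context. -/
def inr {Γ : Ctx} {τ : Ty} : (Δ : Ctx) → Var Γ τ → Var (Δ ++ Γ) τ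
  | [], v => v
  | _ :: Δ, v => succ (inr Δ v)

/-- The corresponding entry of a list of types to which an operation has been applied. -/
def map (f : Ty → Ty) {Γ : Ctx} {τ : Ty} : Var Γ τ → Var (Γ.map f) (f τ)
  | zero => zero
  | succ v => succ (map f v)

end Var

/-- The constants of the language. -/
inductive Const : Ty → Type
  | zero : Const nat
  | succ : Const (nat ⇒ₜ nat)
  /-- The combinator `Π`. -/
  | combK (ρ τ : Ty) : Const (ρ ⇒ₜ τ ⇒ₜ ρ)
  /-- The combinator `Σ`. -/
  | combS (δ ρ τ : Ty) : Const ((δ ⇒ₜ ρ ⇒ₜ τ) ⇒ₜ (δ ⇒ₜ ρ) ⇒ₜ δ ⇒ₜ τ)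
  /-- The component `i` of the simultaneous recursor for the tuple of types `ρs`; arguments are
  the recursion index, the tuple of initial values and the tuple of step functionals. -/
  | recur (ρs : List Ty) (ρ : Ty) (i : Var ρs ρ) :
      Const (nat ⇒ₜ arrows ρs (arrows (ρs.map (step ρs)) ρ))
  /-- Equality on `Ω`. -/
  | eqΩ : Const (sample ⇒ₜ sample ⇒ₜ nat)
  /-- The element relation. -/
  | mem : Const (sample ⇒ₜ event ⇒ₜ nat)
  | union : Const (event ⇒ₜ event ⇒ₜ event)
  | compl : Const (event ⇒ₜ event)
  | empty : Const event
  /-- The probability content. -/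
  | prob : Const (event ⇒ₜ real)
  /-- A witness that `Ω` is not empty. -/
  | point : Const sample

/-- Terms in a context. -/
inductive Tm (Γ : Ctx) : Ty → Type
  | var {τ : Ty} (v : Var Γ τ) : Tm Γ τ
  | const {τ : Ty} (c : Const τ) : Tm Γ τ
  | app {σ τ : Ty} (f : Tm Γ (σ ⇒ₜ τ)) (a : Tm Γ σ) : Tm Γ τ

infixl:90 " ⊙ " => Tm.app

/-- Renamings of variables. -/
abbrev Ren (Γ Δ : Ctx) : Type := (τ : Ty) → Var Γ τ → Var Δ τ

/-- Substitutions of terms for variables; equivalently, tuples of terms over `Δ` of the types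
listed in `Γ`. -/
abbrev Sub (Γ Δ : Ctx) : Type := (τ : Ty) → Var Γ τ → Tm Δ τ

/-- Extend a renaming under a binder. -/
def Ren.up {Γ Δ : Ctx} (r : Ren Γ Δ) {σ : Ty} : Ren (σ :: Γ) (σ :: Δ)
  | _, .zero => .zero
  | _, .succ v => .succ (r _ v)

/-- Extend a renaming under a block of binders. -/
def Ren.upL {Γ Δ : Ctx} (r : Ren Γ Δ) : (Θ : Ctx) → Ren (Θ ++ Γ) (Θ ++ Δ)
  | [] => r
  | _ :: Θ => (Ren.upL r Θ).up

/-- The renaming that makes room for one new variable. -/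
def Ren.wk {Γ : Ctx} {σ : Ty} : Ren Γ (σ :: Γ) := fun _ v => .succ v

/-- The renaming from the empty context. -/
def Ren.nil {Γ : Ctx} : Ren [] Γ := fun _ v => by cases v

namespace Tm

/-- Apply a renaming to a term. -/
def ren {Γ Δ : Ctx} (r : Ren Γ Δ) {τ : Ty} : Tm Γ τ → Tm Δ τ
  | var v => var (r _ v)
  | const c => const c
  | app f a => app (ren r f) (ren r a)

/-- Apply a substitution to a term. -/
def subst {Γ Δ : Ctx} (s : Sub Γ Δ) {τ : Ty} : Tm Γ τ → Tm Δ τ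
  | var v => s _ v
  | const c => const c
  | app f a => app (subst s f) (subst s a)

/-- Weakening by one variable. -/
abbrev wk {Γ : Ctx} {σ τ : Ty} (t : Tm Γ τ) : Tm (σ :: Γ) τ := t.ren Ren.wk

/-- A closed term, seen in an arbitrary context. -/
def cl {Γ : Ctx} {τ : Ty} (t : Tm [] τ) : Tm Γ τ := t.ren Ren.nil

/-- Application to a tuple of arguments. -/
def appL {Γ : Ctx} {τ : Ty} : {σs : List Ty} → Tm Γ (arrows σs τ) → Sub σs Γ → Tm Γ τ
  | [], f, _ => f
  | _ :: _, f, a => appL (app f (a _ .zero)) (fun _ v => a _ (.succ v))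

/-- Lambda abstraction of the most recent variable, defined from the combinators. -/
def lam {Γ : Ctx} {σ τ : Ty} : Tm (σ :: Γ) τ → Tm Γ (σ ⇒ₜ τ)
  | var .zero => const (.combS σ (σ ⇒ₜ σ) σ) ⊙ const (.combK σ (σ ⇒ₜ σ)) ⊙ const (.combK σ σ)
  | var (.succ v) => const (.combK _ σ) ⊙ var v
  | const c => const (.combK _ σ) ⊙ const c
  | app f a => const (.combS σ _ _) ⊙ lam f ⊙ lam a

/-- The variable bound by the innermost binder. -/
abbrev v0 {Γ : Ctx} {a : Ty} : Tm (a :: Γ) a := var .zero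
/-- The variable bound one binder further out. -/
abbrev v1 {Γ : Ctx} {a b : Ty} : Tm (b :: a :: Γ) a := var (.succ .zero)
/-- The variable bound two binders further out. -/
abbrev v2 {Γ : Ctx} {a b c : Ty} : Tm (c :: b :: a :: Γ) a := var (.succ (.succ .zero))
/-- The variable bound three binders further out. -/
abbrev v3 {Γ : Ctx} {a b c d : Ty} : Tm (d :: c :: b :: a :: Γ) a :=
  var (.succ (.succ (.succ .zero)))

end Tm

/-- Extend a substitution under a binder. -/
def Sub.up {Γ Δ : Ctx} (s : Sub Γ Δ) {σ : Ty} : Sub (σ :: Γ) (σ :: Δ)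
  | _, .zero => .var .zero
  | _, .succ v => (s _ v).wk

/-- Extend a substitution under a block of binders. -/
def Sub.upL {Γ Δ : Ctx} (s : Sub Γ Δ) : (Θ : Ctx) → Sub (Θ ++ Γ) (Θ ++ Δ)
  | [] => s
  | _ :: Θ => (Sub.upL s Θ).up

/-- The substitution that prescribes a term for the first variable. -/
def Sub.cons {Γ Δ : Ctx} {σ : Ty} (t : Tm Δ σ) (s : Sub Γ Δ) : Sub (σ :: Γ) Δ
  | _, .zero => t
  | _, .succ v => s _ v

/-- Two substitutions, put together. -/
def Sub.append {Γ Θ : Ctx} : {Δ : Ctx} → Sub Δ Θ → Sub Γ Θ → Sub (Δ ++ Γ) Θ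
  | [], _, s => s
  | _ :: _, r, s => Sub.cons (r _ .zero) (Sub.append (fun _ v => r _ (.succ v)) s)

/-- The substitution of `t` for the first variable, leaving the others. -/
def Sub.one {Γ : Ctx} {σ : Ty} (t : Tm Γ σ) : Sub (σ :: Γ) Γ := Sub.cons t (fun _ v => .var v)

/-! ### Formulas -/

/-- Formulas in a context. Equality at type `0` is the only relation symbol. -/
inductive Fm : Ctx → Type
  | eq0 {Γ : Ctx} (s t : Tm Γ nat) : Fm Γ
  | bot {Γ : Ctx} : Fm Γ
  | imp {Γ : Ctx} (φ ψ : Fm Γ) : Fm Γ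
  | and {Γ : Ctx} (φ ψ : Fm Γ) : Fm Γ
  | or {Γ : Ctx} (φ ψ : Fm Γ) : Fm Γ
  | all {Γ : Ctx} (τ : Ty) (φ : Fm (τ :: Γ)) : Fm Γ
  | ex {Γ : Ctx} (τ : Ty) (φ : Fm (τ :: Γ)) : Fm Γ

infix:50 " ≐ " => Fm.eq0
infixr:25 " ⟹' " => Fm.imp
infixr:35 " ⋏' " => Fm.and
infixr:30 " ⋎' " => Fm.or

namespace Fm

/-- Negation. -/
abbrev not {Γ : Ctx} (φ : Fm Γ) : Fm Γ := φ ⟹' bot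

/-- Equivalence. -/
abbrev iff {Γ : Ctx} (φ ψ : Fm Γ) : Fm Γ := (φ ⟹' ψ) ⋏' (ψ ⟹' φ)

/-- Apply a renaming to a formula. -/
def ren {Γ Δ : Ctx} (r : Ren Γ Δ) : Fm Γ → Fm Δ
  | eq0 s t => s.ren r ≐ t.ren r
  | bot => bot
  | imp φ ψ => imp (φ.ren r) (ψ.ren r)
  | and φ ψ => and (φ.ren r) (ψ.ren r)
  | or φ ψ => or (φ.ren r) (ψ.ren r)
  | all τ φ => all τ (φ.ren r.up)
  | ex τ φ => ex τ (φ.ren r.up)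

/-- Apply a substitution to a formula. -/
def subst {Γ Δ : Ctx} (s : Sub Γ Δ) : Fm Γ → Fm Δ
  | eq0 t u => t.subst s ≐ u.subst s
  | bot => bot
  | imp φ ψ => imp (φ.subst s) (ψ.subst s)
  | and φ ψ => and (φ.subst s) (ψ.subst s)
  | or φ ψ => or (φ.subst s) (ψ.subst s)
  | all τ φ => all τ (φ.subst s.up)
  | ex τ φ => ex τ (φ.subst s.up)

/-- Weakening by one variable. -/
abbrev wk {Γ : Ctx} {σ : Ty} (φ : Fm Γ) : Fm (σ :: Γ) := φ.ren Ren.wk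

/-- Universal quantification over a block of variables. -/
def allL {Γ : Ctx} : (Δ : Ctx) → Fm (Δ ++ Γ) → Fm Γ
  | [], φ => φ
  | τ :: Δ, φ => allL Δ (all τ φ)

/-- Existential quantification over a block of variables. -/
def exL {Γ : Ctx} : (Δ : Ctx) → Fm (Δ ++ Γ) → Fm Γ
  | [], φ => φ
  | τ :: Δ, φ => exL Δ (ex τ φ)

/-- Quantifier-free formulas. -/
def QF {Γ : Ctx} : Fm Γ → Prop
  | eq0 _ _ => True
  | bot => True
  | imp φ ψ => φ.QF ∧ ψ.QF
  | and φ ψ => φ.QF ∧ ψ.QF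
  | or φ ψ => φ.QF ∧ ψ.QF
  | all _ _ => False
  | ex _ _ => False

/-- Existential formulas (a block of existential quantifiers in front of a quantifier-free
formula) all of whose quantifiers have admissible types. -/
inductive ExAdmissible : {Γ : Ctx} → Fm Γ → Prop
  | qf {Γ : Ctx} {φ : Fm Γ} (h : φ.QF) : ExAdmissible φ
  | ex {Γ : Ctx} {τ : Ty} {φ : Fm (τ :: Γ)} (hτ : τ.Admissible) (h : ExAdmissible φ) :
      ExAdmissible (Fm.ex τ φ)

/-- The De Morgan dual. -/
def dual {Γ : Ctx} : Fm Γ → Fm Γ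
  | eq0 s t => not (s ≐ t)
  | bot => not bot
  | imp φ ψ => and φ ψ.dual
  | and φ ψ => or φ.dual ψ.dual
  | or φ ψ => and φ.dual ψ.dual
  | all τ φ => ex τ φ.dual
  | ex τ φ => all τ φ.dual

end Fm

open Tm Fm

/-! ### Arithmetic on natural numbers, as terms -/

/-- The numeral `0`. -/
abbrev zero {Γ : Ctx} : Tm Γ nat := const .zero

/-- Successor. -/
abbrev suc {Γ : Ctx} (t : Tm Γ nat) : Tm Γ nat := const .succ ⊙ t

/-- Recursion for a single type: `recT 0 b f = b` and `recT (n + 1) b f = f (recT n b f) n`. -/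
abbrev recT {Γ : Ctx} {ρ : Ty} (n : Tm Γ nat) (b : Tm Γ ρ) (f : Tm Γ (ρ ⇒ₜ nat ⇒ₜ ρ)) : Tm Γ ρ :=
  const (.recur [ρ] ρ .zero) ⊙ n ⊙ b ⊙ f

/-- Addition. -/
def addC : Tm [] (nat ⇒ₜ nat ⇒ₜ nat) := lam (lam (recT v0 v1 (lam (lam (suc v1)))))
/-- Addition of terms. -/
abbrev add {Γ : Ctx} (s t : Tm Γ nat) : Tm Γ nat := cl addC ⊙ s ⊙ t

/-- Predecessor. -/
def predC : Tm [] (nat ⇒ₜ nat) := lam (recT v0 zero (lam (lam v0)))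

/-- Cut-off subtraction. -/
def subC : Tm [] (nat ⇒ₜ nat ⇒ₜ nat) := lam (lam (recT v0 v1 (lam (lam (cl predC ⊙ v1)))))
/-- Cut-off subtraction of terms. -/
abbrev sub {Γ : Ctx} (s t : Tm Γ nat) : Tm Γ nat := cl subC ⊙ s ⊙ t

/-- Multiplication. -/
def mulC : Tm [] (nat ⇒ₜ nat ⇒ₜ nat) := lam (lam (recT v0 zero (lam (lam (add v1 v3)))))
/-- Multiplication of terms. -/
abbrev mul {Γ : Ctx} (s t : Tm Γ nat) : Tm Γ nat := cl mulC ⊙ s ⊙ t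

/-- Case distinction: `cond c a b` is `a` if `c = 0` and `b` otherwise. -/
abbrev cond {Γ : Ctx} (c a b : Tm Γ nat) : Tm Γ nat := recT c a (lam (lam b.wk.wk))

/-- The formula `s ≤ t` at type `0`. -/
abbrev le0 {Γ : Ctx} (s t : Tm Γ nat) : Fm Γ := sub s t ≐ zero

/-- The remainder modulo `2`. -/
def parC : Tm [] (nat ⇒ₜ nat) := lam (recT v0 zero (lam (lam (sub (suc zero) v1))))

/-- Half, rounded down. -/
def halfC : Tm [] (nat ⇒ₜ nat) := lam (recT v0 zero (lam (lam (add v1 (cl parC ⊙ v0)))))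

/-- `2 ^ k`. -/
def powC : Tm [] (nat ⇒ₜ nat) := lam (recT v0 (suc zero) (lam (lam (add v1 v1))))

/-- The triangular number `0 + 1 + … + n`. -/
def triC : Tm [] (nat ⇒ₜ nat) := lam (recT v0 zero (lam (lam (add v1 (suc v0)))))

/-- The Cantor pairing `j(x, y) = (x + y)(x + y + 1) / 2 + x`. -/
def pairC : Tm [] (nat ⇒ₜ nat ⇒ₜ nat) := lam (lam (add (cl triC ⊙ add v1 v0) v1))
/-- Pairing of terms. -/
abbrev pair {Γ : Ctx} (s t : Tm Γ nat) : Tm Γ nat := cl pairC ⊙ s ⊙ t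

/-- The largest `s` whose triangular number is at most `z`. -/
def rootC : Tm [] (nat ⇒ₜ nat) :=
  lam (recT v0 zero (lam (lam (cond (sub (cl triC ⊙ suc v1) (suc v0)) (suc v1) v1))))

/-- The first projection of the Cantor pairing. -/
def fstC : Tm [] (nat ⇒ₜ nat) := lam (sub v0 (cl triC ⊙ (cl rootC ⊙ v0)))
/-- The second projection of the Cantor pairing. -/
def sndC : Tm [] (nat ⇒ₜ nat) := lam (sub (cl rootC ⊙ v0) (cl fstC ⊙ v0))

/-! ### Rational numbers

The natural number `j(n, m)` codes the rational `(n / 2) / (m + 1)` if `n` is even and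
`-((n + 1) / 2) / (m + 1)` if `n` is odd. -/

/-- The numerator, if it is positive, and `0` otherwise. -/
def posC : Tm [] (nat ⇒ₜ nat) :=
  lam (mul (cl halfC ⊙ (cl fstC ⊙ v0)) (sub (suc zero) (cl parC ⊙ (cl fstC ⊙ v0))))
/-- The absolute value of the numerator, if the latter is negative, and `0` otherwise. -/
def negC : Tm [] (nat ⇒ₜ nat) :=
  lam (mul (cl halfC ⊙ suc (cl fstC ⊙ v0)) (cl parC ⊙ (cl fstC ⊙ v0)))
/-- The denominator. -/
def denC : Tm [] (nat ⇒ₜ nat) := lam (suc (cl sndC ⊙ v0))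

/-- Positive part of the numerator of a coded rational. -/
abbrev qpos {Γ : Ctx} (a : Tm Γ nat) : Tm Γ nat := cl posC ⊙ a
/-- Negative part of the numerator of a coded rational. -/
abbrev qneg {Γ : Ctx} (a : Tm Γ nat) : Tm Γ nat := cl negC ⊙ a
/-- Denominator of a coded rational. -/
abbrev qden {Γ : Ctx} (a : Tm Γ nat) : Tm Γ nat := cl denC ⊙ a

/-- The code of `(p - m) / d`, for arguments `p`, `m` and `d > 0`. -/
def mkQC : Tm [] (nat ⇒ₜ nat ⇒ₜ nat ⇒ₜ nat) :=
  lam (lam (lam (pair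
    (add (mul (suc (suc zero)) (sub v2 v1)) (cl predC ⊙ mul (suc (suc zero)) (sub v1 v2)))
    (cl predC ⊙ v0))))
/-- The code of `(p - m) / d`. -/
abbrev mkQ {Γ : Ctx} (p m d : Tm Γ nat) : Tm Γ nat := cl mkQC ⊙ p ⊙ m ⊙ d

/-- Addition of rationals. -/
def qaddC : Tm [] (nat ⇒ₜ nat ⇒ₜ nat) :=
  lam (lam (mkQ
    (add (mul (qpos v1) (qden v0)) (mul (qpos v0) (qden v1)))
    (add (mul (qneg v1) (qden v0)) (mul (qneg v0) (qden v1)))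
    (mul (qden v1) (qden v0))))
/-- Addition of rationals. -/
abbrev qadd {Γ : Ctx} (a b : Tm Γ nat) : Tm Γ nat := cl qaddC ⊙ a ⊙ b

/-- Subtraction of rationals. -/
def qsubC : Tm [] (nat ⇒ₜ nat ⇒ₜ nat) :=
  lam (lam (qadd v1 (mkQ (qneg v0) (qpos v0) (qden v0))))
/-- Subtraction of rationals. -/
abbrev qsub {Γ : Ctx} (a b : Tm Γ nat) : Tm Γ nat := cl qsubC ⊙ a ⊙ b

/-- Absolute value of rationals. -/
def qabsC : Tm [] (nat ⇒ₜ nat) := lam (mkQ (add (qpos v0) (qneg v0)) zero (qden v0))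
/-- Absolute value of rationals. -/
abbrev qabs {Γ : Ctx} (a : Tm Γ nat) : Tm Γ nat := cl qabsC ⊙ a

/-- The order of rationals: the value is `0` if and only if `a ≤ b`. -/
def qleC : Tm [] (nat ⇒ₜ nat ⇒ₜ nat) :=
  lam (lam (sub
    (add (mul (qpos v1) (qden v0)) (mul (qneg v0) (qden v1)))
    (add (mul (qpos v0) (qden v1)) (mul (qneg v1) (qden v0)))))

/-- The strict order of rationals: the value is `0` if and only if `a < b`. -/
def qltC : Tm [] (nat ⇒ₜ nat ⇒ₜ nat) := lam (lam (sub (suc zero) (cl qleC ⊙ v0 ⊙ v1)))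

/-- The formula `a ≤ b` for coded rationals. -/
abbrev leQ {Γ : Ctx} (a b : Tm Γ nat) : Fm Γ := cl qleC ⊙ a ⊙ b ≐ zero
/-- The formula `a < b` for coded rationals. -/
abbrev ltQ {Γ : Ctx} (a b : Tm Γ nat) : Fm Γ := cl qltC ⊙ a ⊙ b ≐ zero

/-- The rational `2 ^ (-k)`. -/
def qpowC : Tm [] (nat ⇒ₜ nat) := lam (mkQ (suc zero) zero (cl powC ⊙ v0))
/-- The rational `2 ^ (-k)`. -/
abbrev qpow {Γ : Ctx} (k : Tm Γ nat) : Tm Γ nat := cl qpowC ⊙ k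

/-! ### Real numbers

Real numbers are represented by sequences of coded rationals with Cauchy modulus `2 ^ (-n)`.
Every object `f` of type `1` represents a real number, through the sequence `hat f`. -/

/-- The index `n` if `|f(k) - f(k+1)| < 2 ^ (-k-1)` for all `k < n`, and the least `k < n` for
which this fails otherwise. -/
def hatIdxC : Tm [] (real ⇒ₜ nat ⇒ₜ nat) :=
  lam (lam (recT v0 zero (lam (lam
    (cond (add (sub v0 v1) (cl qltC ⊙ qabs (qsub (v3 ⊙ v0) (v3 ⊙ suc v0)) ⊙ qpow (suc v0)))
      (suc v0) v1)))))

/-- The regularization of a sequence of rationals: the sequence is frozen at the first index at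
which the condition on consecutive terms fails. -/
def hatC : Tm [] (real ⇒ₜ real) := lam (lam (v1 ⊙ (cl hatIdxC ⊙ v1 ⊙ v0)))
/-- The `n`-th rational approximation of the real represented by `f`. -/
abbrev hat {Γ : Ctx} (f : Tm Γ real) (n : Tm Γ nat) : Tm Γ nat := cl hatC ⊙ f ⊙ n

/-- `f < g` for reals: some `n` has `g(n+1) - f(n+1) ≥ 2 ^ (-n)`. -/
def ltR {Γ : Ctx} (f g : Tm Γ real) : Fm Γ :=
  ex nat (leQ (qpow v0) (qsub (hat g.wk (suc v0)) (hat f.wk (suc v0))))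
/-- `f ≤ g` for reals. -/
def leR {Γ : Ctx} (f g : Tm Γ real) : Fm Γ := not (ltR g f)
/-- `f = g` for reals: all `n` have `|f(n+1) - g(n+1)| < 2 ^ (-n)`. -/
def eqR {Γ : Ctx} (f g : Tm Γ real) : Fm Γ :=
  all nat (ltQ (qabs (qsub (hat f.wk (suc v0)) (hat g.wk (suc v0)))) (qpow v0))

/-- Addition of reals. -/
def raddC : Tm [] (real ⇒ₜ real ⇒ₜ real) :=
  lam (lam (lam (qadd (hat v2 (suc v0)) (hat v1 (suc v0)))))
/-- Addition of reals. -/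
abbrev radd {Γ : Ctx} (f g : Tm Γ real) : Tm Γ real := cl raddC ⊙ f ⊙ g

/-- Subtraction of reals. -/
def rsubC : Tm [] (real ⇒ₜ real ⇒ₜ real) :=
  lam (lam (lam (qsub (hat v2 (suc v0)) (hat v1 (suc v0)))))
/-- Subtraction of reals. -/
abbrev rsub {Γ : Ctx} (f g : Tm Γ real) : Tm Γ real := cl rsubC ⊙ f ⊙ g

/-- The real `0`. -/
def rzeroC : Tm [] real := lam (mkQ zero zero (suc zero))
/-- The real `1`. -/
def roneC : Tm [] real := lam (mkQ (suc zero) zero (suc zero))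
/-- The real `2 ^ (-k)`. -/
def rpowC : Tm [] (nat ⇒ₜ real) := lam (lam (qpow v1))

/-- The finite sum `f(0) + … + f(l)` of reals. -/
def rsumC : Tm [] ((nat ⇒ₜ real) ⇒ₜ nat ⇒ₜ real) :=
  lam (lam (recT v0 (v1 ⊙ zero) (lam (lam (radd v1 (v3 ⊙ suc v0))))))

/-! ### Events -/

/-- The formula `x ∈ A`. -/
abbrev memF {Γ : Ctx} (x : Tm Γ sample) (A : Tm Γ event) : Fm Γ := const .mem ⊙ x ⊙ A ≐ zero
/-- Union of events. -/
abbrev cup {Γ : Ctx} (A B : Tm Γ event) : Tm Γ event := const .union ⊙ A ⊙ B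
/-- Complement of an event. -/
abbrev cpl {Γ : Ctx} (A : Tm Γ event) : Tm Γ event := const .compl ⊙ A
/-- Intersection of events. -/
abbrev cap {Γ : Ctx} (A B : Tm Γ event) : Tm Γ event := cpl (cup (cpl A) (cpl B))
/-- The sure event. -/
abbrev sure {Γ : Ctx} : Tm Γ event := cpl (const .empty)
/-- The content of an event. -/
abbrev pr {Γ : Ctx} (A : Tm Γ event) : Tm Γ real := const .prob ⊙ A
/-- Inclusion of events. -/
def subS {Γ : Ctx} (A B : Tm Γ event) : Fm Γ :=
  all sample (memF v0 A.wk ⟹' memF v0 B.wk)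

/-- The finite union `A(0) ∪ … ∪ A(n)`. -/
def cupLC : Tm [] ((nat ⇒ₜ event) ⇒ₜ nat ⇒ₜ event) :=
  lam (lam (recT v0 (v1 ⊙ zero) (lam (lam (cup v1 (v3 ⊙ suc v0))))))

/-- The disjointification of a sequence of events: `A(0)` at `0`, and
`A(n+1) ∩ (A(0) ∪ … ∪ A(n))ᶜ` at `n + 1`. -/
def disjC : Tm [] ((nat ⇒ₜ event) ⇒ₜ nat ⇒ₜ event) :=
  lam (lam (recT v0 (v1 ⊙ zero) (lam (lam (cap (v3 ⊙ suc v0) (cpl (cupLC.cl ⊙ v3 ⊙ v0)))))))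

/-! ### The system -/

/-- Equality at an arbitrary type. -/
def eqF {Γ : Ctx} : (τ : Ty) → Tm Γ τ → Tm Γ τ → Fm Γ
  | .nat, s, t => s ≐ t
  | .sample, s, t => const .eqΩ ⊙ s ⊙ t ≐ zero
  | .event, s, t => all sample (iff (memF v0 s.wk) (memF v0 t.wk))
  | .arr σ τ, s, t => all σ (eqF τ (s.wk ⊙ v0) (t.wk ⊙ v0))

/-- Component `i` of the simultaneous recursion with initial values `y` and steps `z`, at `n`. -/
abbrev recL {Γ : Ctx} {ρs : List Ty} (n : Tm Γ nat) (y : Sub ρs Γ) (z : Sub (ρs.map (step ρs)) Γ) :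
    Sub ρs Γ :=
  fun ρ i => appL (appL (const (.recur ρs ρ i) ⊙ n) y) z

/-- The substitution used in the axiom of choice for tuples `xs`, `ys`: every variable `y` of the
tuple `ys` becomes `Y xs`, where `Y` is the corresponding choice functional. -/
def choiceSub (Γ xs ys : Ctx) : Sub (ys ++ (xs ++ Γ)) (xs ++ (ys.map (arrows xs) ++ Γ)) :=
  Sub.append
    (fun _ y => appL (var (.inr xs (.inl (y.map (arrows xs))))) (fun _ x => var (.inl x)))
    (Sub.append (fun _ x => var (.inl x)) (fun _ v => var (.inr xs (.inr _ v))))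

/-- The substitution used in the axiom of dependent choice for a tuple `ρs`: with `n` the number
variable and `f` the sequences, the variables of the first copy of `ρs` become `f (n + 1)`, those
of the second copy become `f n`. -/
def depSub (Γ ρs : Ctx) : Sub (ρs ++ (ρs ++ nat :: Γ)) (nat :: (ρs.map (nat ⇒ₜ ·) ++ Γ)) :=
  Sub.append (fun _ i => var (.succ (.inl (i.map (nat ⇒ₜ ·)))) ⊙ suc v0)
    (Sub.append (fun _ i => var (.succ (.inl (i.map (nat ⇒ₜ ·)))) ⊙ v0)
      (Sub.cons v0 (fun _ v => var (.succ (.inr _ v)))))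

/-- The axioms (other than those of predicate logic) of the system of classical arithmetic in all
finite types for a probability content. -/
inductive Axm : {Γ : Ctx} → Fm Γ → Prop
  -- equality at type `0` and successor
  | eq_refl {Γ : Ctx} (s : Tm Γ nat) : Axm (s ≐ s)
  | eq_symm {Γ : Ctx} (s t : Tm Γ nat) : Axm (s ≐ t ⟹' t ≐ s)
  | eq_trans {Γ : Ctx} (s t u : Tm Γ nat) : Axm (s ≐ t ⋏' t ≐ u ⟹' s ≐ u)
  | succ_congr {Γ : Ctx} (s t : Tm Γ nat) : Axm (s ≐ t ⟹' suc s ≐ suc t)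
  | succ_ne {Γ : Ctx} (s : Tm Γ nat) : Axm (not (suc s ≐ zero))
  | succ_inj {Γ : Ctx} (s t : Tm Γ nat) : Axm (suc s ≐ suc t ⟹' s ≐ t)
  -- induction
  | induction {Γ : Ctx} (φ : Fm (nat :: Γ)) :
      Axm (φ.subst (Sub.one zero) ⋏'
        all nat (φ ⟹' φ.subst (Sub.cons (suc v0) (fun _ v => var (.succ v)))) ⟹' all nat φ)
  -- combinators and recursors
  | combK {Γ : Ctx} {ρ τ : Ty} (x : Tm Γ ρ) (y : Tm Γ τ) :
      Axm (eqF ρ (const (.combK ρ τ) ⊙ x ⊙ y) x)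
  | combS {Γ : Ctx} {δ ρ τ : Ty} (x : Tm Γ (δ ⇒ₜ ρ ⇒ₜ τ)) (y : Tm Γ (δ ⇒ₜ ρ)) (z : Tm Γ δ) :
      Axm (eqF τ (const (.combS δ ρ τ) ⊙ x ⊙ y ⊙ z) (x ⊙ z ⊙ (y ⊙ z)))
  | recur_zero {Γ : Ctx} {ρs : List Ty} {ρ : Ty} (i : Var ρs ρ)
      (y : Sub ρs Γ) (z : Sub (ρs.map (step ρs)) Γ) :
      Axm (eqF ρ (recL zero y z ρ i) (y ρ i))
  | recur_succ {Γ : Ctx} {ρs : List Ty} {ρ : Ty} (i : Var ρs ρ) (n : Tm Γ nat)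
      (y : Sub ρs Γ) (z : Sub (ρs.map (step ρs)) Γ) :
      Axm (eqF ρ (recL (suc n) y z ρ i) (appL (z _ (i.map (step ρs))) (recL n y z) ⊙ n))
  -- quantifier-free choice and dependent choice, for tuples of variables
  | qfac {Γ : Ctx} (xs ys : List Ty) (φ : Fm (ys ++ (xs ++ Γ))) (h : φ.QF) :
      Axm (allL xs (exL ys φ) ⟹'
        exL (ys.map (arrows xs)) (allL xs (φ.subst (choiceSub Γ xs ys))))
  | dc {Γ : Ctx} (ρs : List Ty) (φ : Fm (ρs ++ (ρs ++ nat :: Γ))) :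
      Axm (all nat (allL ρs (exL ρs φ)) ⟹'
        exL (ρs.map (nat ⇒ₜ ·)) (all nat (φ.subst (depSub Γ ρs))))
  -- equality on the sample space is an equivalence relation
  | eqΩ_refl {Γ : Ctx} (x : Tm Γ sample) : Axm (eqF sample x x)
  | eqΩ_symm {Γ : Ctx} (x y : Tm Γ sample) : Axm (eqF sample x y ⟹' eqF sample y x)
  | eqΩ_trans {Γ : Ctx} (x y z : Tm Γ sample) :
      Axm (eqF sample x y ⋏' eqF sample y z ⟹' eqF sample x z)
  -- the events form an algebra of sets
  | mem_empty {Γ : Ctx} (x : Tm Γ sample) : Axm (not (memF x (const .empty)))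
  | mem_compl {Γ : Ctx} (x : Tm Γ sample) (A : Tm Γ event) :
      Axm (iff (memF x (cpl A)) (not (memF x A)))
  | mem_union {Γ : Ctx} (x : Tm Γ sample) (A B : Tm Γ event) :
      Axm (iff (memF x (cup A B)) (memF x A ⋎' memF x B))
  -- a probability content on this algebra
  | prob_range {Γ : Ctx} (A : Tm Γ event) : Axm (leR (cl rzeroC) (pr A) ⋏' leR (pr A) (cl roneC))
  | prob_empty {Γ : Ctx} : Axm (Γ := Γ) (eqR (pr (const .empty)) (cl rzeroC))
  | prob_sure {Γ : Ctx} : Axm (Γ := Γ) (eqR (pr sure) (cl roneC))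
  | prob_mono {Γ : Ctx} (A B : Tm Γ event) : Axm (subS A B ⟹' leR (pr A) (pr B))
  | prob_union {Γ : Ctx} (A B : Tm Γ event) :
      Axm (eqR (pr (cup A B)) (rsub (radd (pr A) (pr B)) (pr (cap A B))))

/-- Additional axioms: a set of formulas in every context. -/
abbrev Schema : Type := (Γ : Ctx) → Set (Fm Γ)

/-- Derivability of a formula from a list of hypotheses in the system extended by the axioms `T`:
natural deduction for classical many-sorted predicate logic, the axioms, and the quantifier-free
rule of extensionality. The latter has no open hypotheses in its premise. -/
inductive Prf (T : Schema) : {Γ : Ctx} → List (Fm Γ) → Fm Γ → Prop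
  | hyp {Γ : Ctx} {H : List (Fm Γ)} {φ : Fm Γ} (h : φ ∈ H) : Prf T H φ
  | ax {Γ : Ctx} {H : List (Fm Γ)} {φ : Fm Γ} (h : Axm φ) : Prf T H φ
  | extra {Γ : Ctx} {H : List (Fm Γ)} {φ : Fm Γ} (h : φ ∈ T Γ) : Prf T H φ
  | imp_intro {Γ : Ctx} {H : List (Fm Γ)} {φ ψ : Fm Γ} (h : Prf T (φ :: H) ψ) : Prf T H (φ ⟹' ψ)
  | imp_elim {Γ : Ctx} {H : List (Fm Γ)} {φ ψ : Fm Γ} (h : Prf T H (φ ⟹' ψ)) (h' : Prf T H φ) :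
      Prf T H ψ
  | and_intro {Γ : Ctx} {H : List (Fm Γ)} {φ ψ : Fm Γ} (h : Prf T H φ) (h' : Prf T H ψ) :
      Prf T H (φ ⋏' ψ)
  | and_left {Γ : Ctx} {H : List (Fm Γ)} {φ ψ : Fm Γ} (h : Prf T H (φ ⋏' ψ)) : Prf T H φ
  | and_right {Γ : Ctx} {H : List (Fm Γ)} {φ ψ : Fm Γ} (h : Prf T H (φ ⋏' ψ)) : Prf T H ψ
  | or_left {Γ : Ctx} {H : List (Fm Γ)} {φ ψ : Fm Γ} (h : Prf T H φ) : Prf T H (φ ⋎' ψ)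
  | or_right {Γ : Ctx} {H : List (Fm Γ)} {φ ψ : Fm Γ} (h : Prf T H ψ) : Prf T H (φ ⋎' ψ)
  | or_elim {Γ : Ctx} {H : List (Fm Γ)} {φ ψ χ : Fm Γ} (h : Prf T H (φ ⋎' ψ))
      (h₁ : Prf T (φ :: H) χ) (h₂ : Prf T (ψ :: H) χ) : Prf T H χ
  | by_contra {Γ : Ctx} {H : List (Fm Γ)} {φ : Fm Γ} (h : Prf T (not φ :: H) bot) : Prf T H φ
  | all_intro {Γ : Ctx} {H : List (Fm Γ)} {τ : Ty} {φ : Fm (τ :: Γ)}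
      (h : Prf T (H.map Fm.wk) φ) : Prf T H (all τ φ)
  | all_elim {Γ : Ctx} {H : List (Fm Γ)} {τ : Ty} {φ : Fm (τ :: Γ)} (h : Prf T H (all τ φ))
      (t : Tm Γ τ) : Prf T H (φ.subst (Sub.one t))
  | ex_intro {Γ : Ctx} {H : List (Fm Γ)} {τ : Ty} {φ : Fm (τ :: Γ)} (t : Tm Γ τ)
      (h : Prf T H (φ.subst (Sub.one t))) : Prf T H (ex τ φ)
  | ex_elim {Γ : Ctx} {H : List (Fm Γ)} {τ : Ty} {φ : Fm (τ :: Γ)} {χ : Fm Γ}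
      (h : Prf T H (ex τ φ)) (h' : Prf T (φ :: H.map Fm.wk) χ.wk) : Prf T H χ
  | qfer {Γ : Ctx} {H : List (Fm Γ)} {ρ τ : Ty} {φ : Fm Γ} (hφ : φ.QF) {s t : Tm Γ ρ}
      (r : Tm (ρ :: Γ) τ) (h : Prf T [] (φ ⟹' eqF ρ s t)) :
      Prf T H (φ ⟹' eqF τ (r.subst (Sub.one s)) (r.subst (Sub.one t)))

/-- The system extended by the axioms `T` proves the sentence `φ`. -/
def Proves (T : Schema) (φ : Fm []) : Prop := Prf T [] φ

/-! ### Uniform boundedness -/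

/-- The pointwise minimum `min_α`, for the type `α = 0(σₖ)…(σ₁)`. -/
def minC : (σs : List Ty) → Tm [] (arrows σs nat ⇒ₜ arrows σs nat ⇒ₜ arrows σs nat)
  | [] => lam (lam (sub (Γ := [nat, nat]) v1 (sub v1 v0)))
  | σ :: σs =>
      lam (lam (lam (Γ := [σ ⇒ₜ arrows σs nat, σ ⇒ₜ arrows σs nat])
        (cl (minC σs) ⊙ (v2 ⊙ v0) ⊙ (v1 ⊙ v0))))

/-- The substitution that replaces `x` by `min_α (x, y k)` and leaves the other variables; the
variables `x`, `k`, `y` are the first three ones. -/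
def minSub (Γ : Ctx) (σs : List Ty) :
    Sub (arrows σs nat :: nat :: (nat ⇒ₜ arrows σs nat) :: Γ)
      (arrows σs nat :: nat :: (nat ⇒ₜ arrows σs nat) :: Γ) :=
  Sub.cons (cl (minC σs) ⊙ v0 ⊙ (v2 ⊙ v1)) (fun _ v => var (.succ v))

/-- The instance of uniform boundedness for `α = 0(σₖ)…(σ₁)`, the types `βs` and the formula
`φ(y, k, x, z, w)`, which may have further parameters `Γ`:
`∀ y (∀ k, x, z ∃ w φ(y, k, min_α(x, y k), z, w) →
  ∃ χ ∀ k, x, z ∃ w ≤ χ k φ(y, k, min_α(x, y k), z, w))`. -/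
def ubFormula (Γ : Ctx) (σs βs : List Ty)
    (φ : Fm (nat :: (βs ++ arrows σs nat :: nat :: (nat ⇒ₜ arrows σs nat) :: Γ))) : Fm Γ :=
  let ψ := φ.subst ((minSub Γ σs).upL βs).up
  all (nat ⇒ₜ arrows σs nat)
    (all nat (all (arrows σs nat) (allL βs (ex nat ψ))) ⟹'
      ex (nat ⇒ₜ nat) (all nat (all (arrows σs nat) (allL βs (ex nat
        (le0 v0
            (var (.succ (.inr βs (.succ (.succ .zero)))) ⊙ var (.succ (.inr βs (.succ .zero)))) ⋏'
          ψ.ren (Ren.upL Ren.wk.up.up βs).up))))))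

/-- The uniform boundedness principle for the sample space, with bounds of type `0`. -/
inductive UBOmegaZero (Γ : Ctx) : Fm Γ → Prop
  | inst (σs βs : List Ty) (hβ : ∀ β ∈ βs, β.EndsInSample)
      (φ : Fm (nat :: (βs ++ arrows σs nat :: nat :: (nat ⇒ₜ arrows σs nat) :: Γ)))
      (hφ : φ.ExAdmissible) : UBOmegaZero Γ (ubFormula Γ σs βs φ)

/-- The axioms of uniform boundedness, as an extension of the system. -/
def UBΩ₀ : Schema := fun Γ => {φ | UBOmegaZero Γ φ}

/-! ### Probabilities of formulas and sigma-additivity -/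

/-- `ℙ[φ] ≥ t`: for all events `A` with `ℙ(A) < t` some `ϖ ∈ Aᶜ` satisfies `φ`. -/
def probGE {Γ : Ctx} (φ : Fm (sample :: Γ)) (t : Tm Γ real) : Fm Γ :=
  all event (ltR (pr v0) t.wk ⟹' ex sample (memF v0 (cpl v1) ⋏' φ.ren Ren.wk.up))

/-- `ℙ[φ] ≤ t`: the De Morgan dual of `φ` has probability at least `1 - t`. -/
def probLE {Γ : Ctx} (φ : Fm (sample :: Γ)) (t : Tm Γ real) : Fm Γ :=
  probGE φ.dual (rsub (cl roneC) t)

/-- The formula `∃ n (ϖ ∈ A n)`, with free variable `ϖ` in addition to those of `A`. -/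
def inUnion {Γ : Ctx} (A : Tm Γ (nat ⇒ₜ event)) : Fm (sample :: Γ) :=
  ex nat (memF v1 (A.wk.wk ⊙ v0))

/-- The term `∑_{n ≤ l} ℙ((A↑)_n)`. -/
def partialSum {Γ : Ctx} (A : Tm Γ (nat ⇒ₜ event)) (l : Tm Γ nat) : Tm Γ real :=
  cl rsumC ⊙ lam (pr (cl disjC ⊙ A.wk ⊙ v0)) ⊙ l

/-- Sigma-additivity: `∀ A ∀ l (ℙ[∃ n A_n] ≥ ∑_{n ≤ l} ℙ((A↑)_n))` and
`∀ A ∀ k ∃ l (ℙ[∃ n A_n] ≤ ∑_{n ≤ l} ℙ((A↑)_n) + 2 ^ (-k))`. -/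
def sigmaAdditivity : Fm [] :=
  all (nat ⇒ₜ event) (all nat (probGE (inUnion v1) (partialSum v1 v0))) ⋏'
    all (nat ⇒ₜ event) (all nat (ex nat
      (probLE (inUnion v2) (radd (partialSum v2 v0) (cl rpowC ⊙ v1)))))

end ProbContent

/-! ### Syntax: substitution calculus and derived rules of the deduction system -/

namespace ProbContent

open Ty Tm Fm

/-! ### Renaming and substitution -/

/-! Instead of writing a formal derivation, the proof shows a completeness theorem (`proves_of_sat`)
and then argues about σ-additivity inside an arbitrary model.

Completeness is a Henkin construction: a consistent list of sentences over infinitely many names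
extends to a complete theory with witnesses, and its closed terms, up to a suitable equality, form a
model. The delicate point is that the system is only weakly extensional. Terms that the theory
equates at higher type need not be interchangeable, so application would not respect that equality.
Two terms are therefore identified only if their equality is derivable from quantifier-free
sentences of the theory (`NTEq`). The quantifier-free extensionality rule makes this a congruence
(`Prf.congr_app`, `NTEq.app`), and at type `0` it agrees with the theory, because an equation is
itself quantifier-free (`Henkin.sat_iff`).

In a model the objects of type `0` form a possibly nonstandard ordered semiring with induction for
definable properties. Coded rationals take values in its ordered field of fractions, and reals
become Cauchy sequences in that field, compared by `LeF` up to every `2 ^ (-k)` of the model. Any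
argument by induction must then be phrased by a formula of the system.

The mathematics is short. By finite additivity the partial sum up to `l` equals `ℙ(A 0 ∪ … ∪ A l)`
(`approx_rsumM`). If an event `B` contained all `A n`, monotonicity would give `ℙ(A 0 ∪ … ∪ A l) ≤
ℙ(B)`; this is the first half. For the second half, the contents of the finite unions increase and
are bounded by `1`, so beyond some `l` they grow by at most `2 ^ (-k)` (`exists_prM_cupLM_bound`).
If no point outside `B` avoided all `A n`, every `ϖ` would lie in `B` or in some `A n`. Uniform
boundedness, a compactness principle for `Ω`, bounds `n` by a single `N` (`exists_uniform_bound`),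
so `B` and finitely many `A n` cover `Ω`, whence `1 ≤ ℙ(B) + ℙ(A 0 ∪ … ∪ A l) + 2 ^ (-k)`. -/

theorem Sub.up_ren {Γ Δ Θ : Ctx} (r : Ren Γ Δ) (s : Sub Δ Θ) {σ : Ty} :
    (fun τ v => s.up τ (r.up τ v)) = Sub.up (σ := σ) (fun τ v => s τ (r τ v)) := by
  funext τ v; cases v <;> rfl

theorem Tm.ren_ren {Γ Δ Θ : Ctx} (r : Ren Γ Δ) (q : Ren Δ Θ) {τ : Ty} (t : Tm Γ τ) :
    (t.ren r).ren q = t.ren (fun τ v => q τ (r τ v)) := by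
  induction t with
  | var v => rfl
  | const c => rfl
  | app f a hf ha => simp only [Tm.ren, hf, ha]

theorem Tm.subst_ren {Γ Δ Θ : Ctx} (r : Ren Γ Δ) (s : Sub Δ Θ) {τ : Ty} (t : Tm Γ τ) :
    (t.ren r).subst s = t.subst (fun τ v => s τ (r τ v)) := by
  induction t with
  | var v => rfl
  | const c => rfl
  | app f a hf ha => simp only [Tm.ren, Tm.subst, hf, ha]

theorem Tm.ren_subst {Γ Δ Θ : Ctx} (s : Sub Γ Δ) (r : Ren Δ Θ) {τ : Ty} (t : Tm Γ τ) :
    (t.subst s).ren r = t.subst (fun τ v => (s τ v).ren r) := by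
  induction t with
  | var v => rfl
  | const c => rfl
  | app f a hf ha => simp only [Tm.ren, Tm.subst, hf, ha]

theorem Tm.subst_subst {Γ Δ Θ : Ctx} (s : Sub Γ Δ) (q : Sub Δ Θ) {τ : Ty} (t : Tm Γ τ) :
    (t.subst s).subst q = t.subst (fun τ v => (s τ v).subst q) := by
  induction t with
  | var v => rfl
  | const c => rfl
  | app f a hf ha => simp only [Tm.subst, hf, ha]

theorem Tm.subst_var {Γ : Ctx} {τ : Ty} (t : Tm Γ τ) : t.subst (fun _ v => var v) = t := by
  induction t with
  | var v => rfl
  | const c => rfl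
  | app f a hf ha => simp only [Tm.subst, hf, ha]

theorem Tm.ren_eq_subst {Γ Δ : Ctx} (r : Ren Γ Δ) {τ : Ty} (t : Tm Γ τ) :
    t.ren r = t.subst (fun τ v => var (r τ v)) := by
  induction t with
  | var v => rfl
  | const c => rfl
  | app f a hf ha => simp only [Tm.ren, Tm.subst, hf, ha]

@[simp] theorem Tm.subst_one_wk {Γ : Ctx} {σ τ : Ty} (t : Tm Γ τ) (a : Tm Γ σ) :
    t.wk.subst (Sub.one a) = t := by
  rw [Tm.wk, Tm.subst_ren]; exact t.subst_var

theorem Tm.wk_subst_up {Γ Δ : Ctx} (s : Sub Γ Δ) {σ τ : Ty} (t : Tm Γ τ) :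
    t.wk.subst (s.up (σ := σ)) = (t.subst s).wk := by
  simp only [Tm.wk, Tm.subst_ren, Tm.ren_subst]; rfl

theorem Tm.wk_ren_up {Γ Δ : Ctx} (r : Ren Γ Δ) {σ τ : Ty} (t : Tm Γ τ) :
    t.wk.ren (r.up (σ := σ)) = (t.ren r).wk := by
  simp only [Tm.wk, Tm.ren_ren]; rfl

@[simp] theorem Tm.subst_cl {Γ Δ : Ctx} (s : Sub Γ Δ) {τ : Ty} (t : Tm [] τ) :
    t.cl.subst s = t.cl := by
  rw [Tm.cl, Tm.cl, Tm.subst_ren, Tm.ren_eq_subst]; congr; funext τ v; cases v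

theorem Sub.up_comp {Γ Δ Θ : Ctx} (s : Sub Γ Δ) (q : Sub Δ Θ) {σ : Ty} :
    (fun τ v => (s.up τ v).subst (q.up)) = Sub.up (σ := σ) (fun τ v => (s τ v).subst q) := by
  funext τ v
  cases v with
  | zero => rfl
  | succ v => exact Tm.wk_subst_up q (s _ v)

theorem Sub.up_comp_ren {Γ Δ Θ : Ctx} (s : Sub Γ Δ) (r : Ren Δ Θ) {σ : Ty} :
    (fun τ v => (s.up τ v).ren (r.up)) = Sub.up (σ := σ) (fun τ v => (s τ v).ren r) := by
  funext τ v
  cases v with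
  | zero => rfl
  | succ v => exact Tm.wk_ren_up r (s _ v)

theorem Sub.up_var {Γ : Ctx} {σ : Ty} :
    Sub.up (σ := σ) (fun _ (v : Var Γ _) => var v) = fun _ v => var v := by
  funext τ v; cases v <;> rfl

theorem Fm.subst_ren {Γ : Ctx} (φ : Fm Γ) :
    ∀ {Δ Θ : Ctx} (r : Ren Γ Δ) (s : Sub Δ Θ),
      (φ.ren r).subst s = φ.subst (fun τ v => s τ (r τ v)) := by
  induction φ with
  | eq0 => intros; simp only [Fm.ren, Fm.subst, Tm.subst_ren]
  | bot => intros; rfl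
  | imp _ _ h h' | and _ _ h h' | or _ _ h h' => intros; simp only [Fm.ren, Fm.subst, h, h']
  | all _ _ h | ex _ _ h => intros; simp only [Fm.ren, Fm.subst, Sub.up_ren, h]

theorem Fm.ren_subst {Γ : Ctx} (φ : Fm Γ) :
    ∀ {Δ Θ : Ctx} (s : Sub Γ Δ) (r : Ren Δ Θ),
      (φ.subst s).ren r = φ.subst (fun τ v => (s τ v).ren r) := by
  induction φ with
  | eq0 => intros; simp only [Fm.ren, Fm.subst, Tm.ren_subst]
  | bot => intros; rfl
  | imp _ _ h h' | and _ _ h h' | or _ _ h h' => intros; simp only [Fm.ren, Fm.subst, h, h']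
  | all _ _ h | ex _ _ h => intros; simp only [Fm.ren, Fm.subst, Sub.up_comp_ren, h]

theorem Fm.subst_subst {Γ : Ctx} (φ : Fm Γ) :
    ∀ {Δ Θ : Ctx} (s : Sub Γ Δ) (q : Sub Δ Θ),
      (φ.subst s).subst q = φ.subst (fun τ v => (s τ v).subst q) := by
  induction φ with
  | eq0 => intros; simp only [Fm.subst, Tm.subst_subst]
  | bot => intros; rfl
  | imp _ _ h h' | and _ _ h h' | or _ _ h h' => intros; simp only [Fm.subst, h, h']
  | all _ _ h | ex _ _ h => intros; simp only [Fm.subst, Sub.up_comp, h]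

theorem Fm.subst_var {Γ : Ctx} (φ : Fm Γ) : φ.subst (fun _ v => var v) = φ := by
  induction φ with
  | eq0 => simp only [Fm.subst, Tm.subst_var]
  | bot => rfl
  | imp _ _ h h' | and _ _ h h' | or _ _ h h' => simp only [Fm.subst, h, h']
  | all _ _ h | ex _ _ h => simp only [Fm.subst, Sub.up_var, h]

theorem Fm.subst_up_one {Γ Δ : Ctx} {σ : Ty} (φ : Fm (σ :: Γ)) (s : Sub Γ Δ) (t : Tm Δ σ) :
    (φ.subst s.up).subst (Sub.one t) = φ.subst (Sub.cons t s) := by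
  rw [Fm.subst_subst]
  congr; funext τ v
  cases v with
  | zero => rfl
  | succ v => exact Tm.subst_one_wk _ _

theorem Fm.subst_one_subst {Γ Δ : Ctx} {σ : Ty} (φ : Fm (σ :: Γ)) (s : Sub Γ Δ) (t : Tm Γ σ) :
    (φ.subst (Sub.one t)).subst s = (φ.subst s.up).subst (Sub.one (t.subst s)) := by
  rw [Fm.subst_up_one, Fm.subst_subst]
  congr; funext τ v; cases v <;> rfl

theorem Fm.QF.subst {Γ : Ctx} {φ : Fm Γ} (h : φ.QF) {Δ : Ctx} (s : Sub Γ Δ) : (φ.subst s).QF := by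
  induction φ generalizing Δ with
  | eq0 | bot => trivial
  | imp φ ψ ih ih' | and φ ψ ih ih' | or φ ψ ih ih' => exact ⟨ih h.1 s, ih' h.2 s⟩
  | all | ex => exact h.elim

/-! ### Derivations -/

namespace Prf

variable {T : Schema} {Γ : Ctx}

theorem weaken {H : List (Fm Γ)} {φ : Fm Γ} (h : Prf T H φ) :
    ∀ {H' : List (Fm Γ)}, H ⊆ H' → Prf T H' φ := by
  induction h with
  | hyp h => intro H' hs; exact .hyp (hs h)
  | ax h => intro H' hs; exact .ax h
  | extra h => intro H' hs; exact .extra h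
  | imp_intro _ ih => intro H' hs; exact .imp_intro (ih (List.cons_subset_cons _ hs))
  | imp_elim _ _ ih ih' => intro H' hs; exact .imp_elim (ih hs) (ih' hs)
  | and_intro _ _ ih ih' => intro H' hs; exact .and_intro (ih hs) (ih' hs)
  | and_left _ ih => intro H' hs; exact .and_left (ih hs)
  | and_right _ ih => intro H' hs; exact .and_right (ih hs)
  | or_left _ ih => intro H' hs; exact .or_left (ih hs)
  | or_right _ ih => intro H' hs; exact .or_right (ih hs)
  | or_elim _ _ _ ih ih₁ ih₂ =>
    intro H' hs
    exact .or_elim (ih hs) (ih₁ (List.cons_subset_cons _ hs)) (ih₂ (List.cons_subset_cons _ hs))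
  | by_contra _ ih => intro H' hs; exact .by_contra (ih (List.cons_subset_cons _ hs))
  | all_intro _ ih => intro H' hs; exact .all_intro (ih (List.map_subset _ hs))
  | all_elim _ t ih => intro H' hs; exact .all_elim (ih hs) t
  | ex_intro t _ ih => intro H' hs; exact .ex_intro t (ih hs)
  | ex_elim _ _ ih ih' =>
    intro H' hs
    exact .ex_elim (ih hs) (ih' (List.cons_subset_cons _ (List.map_subset _ hs)))
  | qfer hφ r _ ih => intro H' hs; exact .qfer hφ r (ih (List.nil_subset _))

theorem of_nil {H : List (Fm Γ)} {φ : Fm Γ} (h : Prf T [] φ) : Prf T H φ :=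
  h.weaken (List.nil_subset _)

theorem cut {H : List (Fm Γ)} {φ ψ : Fm Γ} (h : Prf T H φ) (h' : Prf T (φ :: H) ψ) : Prf T H ψ :=
  (imp_intro h').imp_elim h

theorem cut_list {H K : List (Fm Γ)} {ψ : Fm Γ} (hH : ∀ φ ∈ H, Prf T K φ) (h : Prf T H ψ) :
    Prf T K ψ := by
  induction H generalizing ψ with
  | nil => exact h.of_nil
  | cons φ H ih =>
    exact (ih (fun χ hχ => hH χ (List.mem_cons_of_mem _ hχ)) (.imp_intro h)).imp_elim
      (hH φ List.mem_cons_self)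

theorem hyp0 {H : List (Fm Γ)} {φ : Fm Γ} : Prf T (φ :: H) φ := .hyp List.mem_cons_self

theorem hyp1 {H : List (Fm Γ)} {φ ψ : Fm Γ} : Prf T (ψ :: φ :: H) φ :=
  .hyp (List.mem_cons_of_mem _ List.mem_cons_self)

theorem exfalso {H : List (Fm Γ)} {φ : Fm Γ} (h : Prf T H bot) : Prf T H φ :=
  .by_contra (h.weaken (List.subset_cons_self _ _))

theorem by_cases {H : List (Fm Γ)} (φ : Fm Γ) {ψ : Fm Γ} (h : Prf T (φ :: H) ψ)
    (h' : Prf T (not φ :: H) ψ) : Prf T H ψ := by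
  have k : Prf T (not ψ :: H) (not φ) := by
    refine .imp_intro (.imp_elim hyp1 (h.weaken ?_))
    exact List.cons_subset_cons _ (List.subset_cons_self _ _)
  refine .by_contra (.imp_elim hyp0 (k.cut (h'.weaken ?_)))
  exact List.cons_subset_cons _ (List.subset_cons_self _ _)

/-- Instantiation of a hypothesis `all τ φ` by the variable just bound. -/
theorem all_elim_wk {τ : Ty} {H : List (Fm (τ :: Γ))} {φ : Fm (τ :: Γ)}
    (h : Prf T H (all τ φ).wk) : Prf T H φ := by
  have := all_elim h v0
  rw [Fm.subst_ren] at this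
  convert this
  conv_lhs => rw [← φ.subst_var]
  congr; funext σ v; cases v <;> rfl

theorem eqF_refl {τ : Ty} (t : Tm Γ τ) {H : List (Fm Γ)} : Prf T H (eqF τ t t) := by
  induction τ generalizing Γ with
  | nat => exact .ax (.eq_refl t)
  | sample => exact .ax (.eqΩ_refl t)
  | event => exact .all_intro (.and_intro (.imp_intro hyp0) (.imp_intro hyp0))
  | arr a b _ ih => exact .all_intro (ih _)

theorem eqF_symm {τ : Ty} (s t : Tm Γ τ) {H : List (Fm Γ)} (h : Prf T H (eqF τ s t)) :
    Prf T H (eqF τ t s) := by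
  suffices k : Prf T [eqF τ s t] (eqF τ t s) from
    h.cut (k.weaken (List.cons_subset_cons _ (List.nil_subset _)))
  clear h H
  induction τ generalizing Γ with
  | nat => exact .imp_elim (.ax (.eq_symm s t)) hyp0
  | sample => exact .imp_elim (.ax (.eqΩ_symm s t)) hyp0
  | event =>
    refine .all_intro ?_
    have k := all_elim_wk (T := T) (φ := iff (memF v0 s.wk) (memF v0 t.wk))
      (H := [eqF event s t].map Fm.wk) hyp0
    exact .and_intro k.and_right k.and_left
  | arr a b _ ih =>
    refine .all_intro ?_
    have k := all_elim_wk (T := T) (φ := eqF b (s.wk ⊙ v0) (t.wk ⊙ v0))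
      (H := [eqF (a ⇒ₜ b) s t].map Fm.wk) hyp0
    exact k.cut ((ih (s.wk ⊙ v0) (t.wk ⊙ v0)).weaken (List.cons_subset_cons _ (List.nil_subset _)))

theorem eqF_trans {τ : Ty} (s t u : Tm Γ τ) {H : List (Fm Γ)} (h : Prf T H (eqF τ s t))
    (h' : Prf T H (eqF τ t u)) : Prf T H (eqF τ s u) := by
  suffices k : Prf T [eqF τ s t, eqF τ t u] (eqF τ s u) from
    cut_list (by simp [h, h']) k
  clear h h' H
  induction τ generalizing Γ with
  | nat => exact .imp_elim (.ax (.eq_trans s t u)) (.and_intro hyp0 hyp1)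
  | sample => exact .imp_elim (.ax (.eqΩ_trans s t u)) (.and_intro hyp0 hyp1)
  | event =>
    refine .all_intro ?_
    have k := all_elim_wk (T := T) (φ := iff (memF v0 s.wk) (memF v0 t.wk))
      (H := [eqF event s t, eqF event t u].map Fm.wk) hyp0
    have k' := all_elim_wk (T := T) (φ := iff (memF v0 t.wk) (memF v0 u.wk))
      (H := [eqF event s t, eqF event t u].map Fm.wk) hyp1
    refine .and_intro (.imp_intro ?_) (.imp_intro ?_)
    · exact .imp_elim (k'.and_left.weaken (List.subset_cons_self _ _))
        (.imp_elim (k.and_left.weaken (List.subset_cons_self _ _)) hyp0)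
    · exact .imp_elim (k.and_right.weaken (List.subset_cons_self _ _))
        (.imp_elim (k'.and_right.weaken (List.subset_cons_self _ _)) hyp0)
  | arr a b _ ih =>
    refine .all_intro ?_
    have k := all_elim_wk (T := T) (φ := eqF b (s.wk ⊙ v0) (t.wk ⊙ v0))
      (H := [eqF (a ⇒ₜ b) s t, eqF (a ⇒ₜ b) t u].map Fm.wk) hyp0
    have k' := all_elim_wk (T := T) (φ := eqF b (t.wk ⊙ v0) (u.wk ⊙ v0))
      (H := [eqF (a ⇒ₜ b) s t, eqF (a ⇒ₜ b) t u].map Fm.wk) hyp1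
    exact cut_list (by simpa using And.intro k k') (ih (s.wk ⊙ v0) (t.wk ⊙ v0) (u.wk ⊙ v0))

/-- The conjunction of a list of formulas. -/
def _root_.ProbContent.Fm.conj {Γ : Ctx} : List (Fm Γ) → Fm Γ
  | [] => not bot
  | φ :: H => φ ⋏' Fm.conj H

theorem _root_.ProbContent.Fm.QF.conj {Γ : Ctx} {H : List (Fm Γ)} (h : ∀ φ ∈ H, φ.QF) :
    (Fm.conj H).QF := by
  induction H with
  | nil => exact ⟨trivial, trivial⟩
  | cons φ H ih => exact ⟨h φ List.mem_cons_self, ih fun χ hχ => h χ (List.mem_cons_of_mem _ hχ)⟩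

theorem conj_intro {H K : List (Fm Γ)} (h : ∀ φ ∈ H, Prf T K φ) : Prf T K (Fm.conj H) := by
  induction H with
  | nil => exact .imp_intro hyp0
  | cons φ H ih =>
    exact .and_intro (h φ List.mem_cons_self) (ih fun χ hχ => h χ (List.mem_cons_of_mem _ hχ))

theorem conj_elim {H K : List (Fm Γ)} (h : Prf T K (Fm.conj H)) : ∀ φ ∈ H, Prf T K φ := by
  induction H with
  | nil => simp
  | cons φ H ih =>
    intro χ hχ
    rcases List.mem_cons.1 hχ with rfl | hχ
    · exact h.and_left
    · exact ih h.and_right χ hχ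

/-- The quantifier-free rule of extensionality, for quantifier-free hypotheses. -/
theorem ext_rule {H : List (Fm Γ)} (hH : ∀ φ ∈ H, φ.QF) {ρ τ : Ty} {s t : Tm Γ ρ}
    (r : Tm (ρ :: Γ) τ) (h : Prf T H (eqF ρ s t)) :
    Prf T H (eqF τ (r.subst (Sub.one s)) (r.subst (Sub.one t))) := by
  -- The rule `qfer` allows no open hypotheses, so these are packed into its single quantifier-free
  -- premise.
  have k : Prf T [] (Fm.conj H ⟹' eqF ρ s t) := .imp_intro (cut_list (conj_elim hyp0) h)
  exact .imp_elim (.qfer (Fm.QF.conj hH) r k) (conj_intro fun φ hφ => .hyp hφ)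

/-- Weak extensionality enters here: without `hH` congruence would amount to full extensionality.
The function and the argument are exchanged by one use of the rule each. -/
theorem congr_app {H : List (Fm Γ)} (hH : ∀ φ ∈ H, φ.QF) {σ τ : Ty} {f g : Tm Γ (σ ⇒ₜ τ)}
    {a b : Tm Γ σ} (h : Prf T H (eqF _ f g)) (h' : Prf T H (eqF _ a b)) :
    Prf T H (eqF τ (f ⊙ a) (g ⊙ b)) := by
  refine eqF_trans _ (g ⊙ a) _ ?_ ?_
  · simpa [Tm.subst, Sub.one, Sub.cons] using
      (by simpa only [Tm.subst, Tm.subst_one_wk] using ext_rule hH (v0 ⊙ a.wk) h :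
        Prf T H (eqF τ (Sub.one f _ .zero ⊙ a) (Sub.one g _ .zero ⊙ a)))
  · exact (by simpa only [Tm.subst, Tm.subst_one_wk] using ext_rule hH (g.wk ⊙ v0) h' :
        Prf T H (eqF τ (g ⊙ Sub.one a _ .zero) (g ⊙ Sub.one b _ .zero)))

end Prf

end ProbContent

/-! ### Completeness of the system by a Henkin construction -/

namespace ProbContent

open Ty Tm Fm

/-! ### Closed terms and sentences over infinitely many names -/

/-- Closed terms over the names `par τ i`. -/
inductive NT : Ty → Type
  | par (τ : Ty) (i : ℕ) : NT τ
  | const {τ : Ty} (c : Const τ) : NT τ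
  | app {σ τ : Ty} (f : NT (σ ⇒ₜ τ)) (a : NT σ) : NT τ

/-- Assignments of closed terms to the variables of a context. -/
abbrev NEnv (Γ : Ctx) : Type := (τ : Ty) → Var Γ τ → NT τ

/-- Interpretations of the names as terms in a context. -/
abbrev Naming (Δ : Ctx) : Type := (τ : Ty) → ℕ → Tm Δ τ

/-- Extend an assignment by a value for the most recent variable. -/
def NEnv.cons {Γ : Ctx} {σ : Ty} (a : NT σ) (e : NEnv Γ) : NEnv (σ :: Γ)
  | _, .zero => a
  | _, .succ v => e _ v

/-- The term obtained by interpreting the names. -/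
def NT.inst {Δ : Ctx} (g : Naming Δ) {τ : Ty} : NT τ → Tm Δ τ
  | par τ i => g τ i
  | const c => .const c
  | app f a => .app (f.inst g) (a.inst g)

/-- The closed term obtained by assigning closed terms to the variables. -/
def Tm.toNT {Γ : Ctx} (e : NEnv Γ) {τ : Ty} : Tm Γ τ → NT τ
  | .var v => e _ v
  | .const c => .const c
  | .app f a => .app (f.toNT e) (a.toNT e)

theorem Tm.inst_toNT {Γ Δ : Ctx} (g : Naming Δ) (e : NEnv Γ) {τ : Ty} (t : Tm Γ τ) :
    (t.toNT e).inst g = t.subst (fun τ v => (e τ v).inst g) := by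
  induction t with
  | var v => rfl
  | const c => rfl
  | app f a hf ha => simp only [Tm.toNT, NT.inst, Tm.subst, hf, ha]

/-- Sentences over the names: formulas with an assignment for their free variables. -/
structure Sen : Type where
  /-- The context of the formula. -/
  {Γ : Ctx}
  /-- The formula. -/
  φ : Fm Γ
  /-- The values of its variables. -/
  e : NEnv Γ

/-- The formula obtained by interpreting the names. -/
def Sen.inst {Δ : Ctx} (g : Naming Δ) (S : Sen) : Fm Δ :=
  S.φ.subst fun τ v => (S.e τ v).inst g

/-- The negation of a sentence. -/
def Sen.not (S : Sen) : Sen := ⟨Fm.not S.φ, S.e⟩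

/-- Falsity as a sentence. -/
def Sen.bot : Sen := ⟨(Fm.bot : Fm []), fun _ v => nomatch v⟩

theorem Sen.inst_cons {Γ Δ : Ctx} {τ : Ty} (g : Naming Δ) (φ : Fm (τ :: Γ)) (a : NT τ)
    (e : NEnv Γ) : Sen.inst g ⟨φ, .cons a e⟩ =
      (φ.subst (Sub.up fun τ v => (e τ v).inst g)).subst (Sub.one (a.inst g)) := by
  rw [Fm.subst_up_one, Sen.inst]
  congr; funext τ v; cases v <;> rfl

/-! ### Countability -/

/-- The Henkin theory comes from meeting two cofinal sets for each sentence, and this works for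
countably many sets; hence all ingredients of sentences have to be countable. -/
instance : Countable Ty := by
  let code : Ty → ℕ := fun t => t.rec 0 1 2 fun _ _ m n => Nat.pair m n + 3
  refine Function.Injective.countable (f := code) fun s => ?_
  induction s with
  | nat => intro t h; cases t <;> simp_all [code]
  | sample => intro t h; cases t <;> simp_all [code]
  | event => intro t h; cases t <;> simp_all [code]
  | arr a b iha ihb =>
    intro t h
    cases t with
    | arr c d =>
      have h : Nat.pair (code a) (code b) + 3 = Nat.pair (code c) (code d) + 3 := h
      have := Nat.pair_eq_pair.1 (Nat.add_right_cancel h)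
      rw [iha this.1, ihb this.2]
    | _ => simp [code] at h

/-- The de Bruijn index of a variable. -/
def Var.idx {Γ : Ctx} {τ : Ty} : Var Γ τ → ℕ
  | zero => 0
  | succ v => v.idx + 1

theorem Var.idx_inj {Γ : Ctx} {τ τ' : Ty} (v : Var Γ τ) (w : Var Γ τ') (h : v.idx = w.idx) :
    (⟨τ, v⟩ : Σ τ, Var Γ τ) = ⟨τ', w⟩ := by
  induction v with
  | zero => cases w with
    | zero => rfl
    | succ w => simp [Var.idx] at h
  | succ v ih => cases w with
    | zero => simp [Var.idx] at h
    | succ w => cases ih w (Nat.add_right_cancel h); rfl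

instance (Γ : Ctx) : Countable (Σ τ, Var Γ τ) :=
  Function.Injective.countable (f := fun v => v.2.idx) fun v w h => Var.idx_inj v.2 w.2 h

instance : Countable (Σ τ, Const τ) := by
  let f : (ℕ × Ty × Ty × Ty) ⊕ (Σ ρs : List Ty, Σ ρ, Var ρs ρ) → Σ τ, Const τ
    | .inl (0, _, _, _) => ⟨_, .zero⟩
    | .inl (1, _, _, _) => ⟨_, .succ⟩
    | .inl (2, a, b, _) => ⟨_, .combK a b⟩
    | .inl (3, a, b, c) => ⟨_, .combS a b c⟩
    | .inl (4, _, _, _) => ⟨_, .eqΩ⟩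
    | .inl (5, _, _, _) => ⟨_, .mem⟩
    | .inl (6, _, _, _) => ⟨_, .union⟩
    | .inl (7, _, _, _) => ⟨_, .compl⟩
    | .inl (8, _, _, _) => ⟨_, .empty⟩
    | .inl (9, _, _, _) => ⟨_, .prob⟩
    | .inl (_, _, _, _) => ⟨_, .point⟩
    | .inr ⟨ρs, ρ, i⟩ => ⟨_, .recur ρs ρ i⟩
  refine Function.Surjective.countable (f := f) fun ⟨τ, c⟩ => ?_
  cases c with
  | zero => exact ⟨.inl (0, nat, nat, nat), rfl⟩
  | succ => exact ⟨.inl (1, nat, nat, nat), rfl⟩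
  | combK a b => exact ⟨.inl (2, a, b, nat), rfl⟩
  | combS a b c => exact ⟨.inl (3, a, b, c), rfl⟩
  | recur ρs ρ i => exact ⟨.inr ⟨ρs, ρ, i⟩, rfl⟩
  | eqΩ => exact ⟨.inl (4, nat, nat, nat), rfl⟩
  | mem => exact ⟨.inl (5, nat, nat, nat), rfl⟩
  | union => exact ⟨.inl (6, nat, nat, nat), rfl⟩
  | compl => exact ⟨.inl (7, nat, nat, nat), rfl⟩
  | empty => exact ⟨.inl (8, nat, nat, nat), rfl⟩
  | prob => exact ⟨.inl (9, nat, nat, nat), rfl⟩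
  | point => exact ⟨.inl (10, nat, nat, nat), rfl⟩

/-- The type of the argument is hidden in an application, so injectivity of the code is proved for
terms of possibly different types, compared together with their types. -/
instance : Countable (Σ τ, NT τ) := by
  obtain ⟨ct, hct⟩ := exists_injective_nat Ty
  obtain ⟨cc, hcc⟩ := exists_injective_nat (Σ τ, Const τ)
  let code : ∀ τ, NT τ → ℕ := fun τ t =>
    t.rec (fun τ i => Nat.pair 0 (Nat.pair (ct τ) i)) (fun c => Nat.pair 1 (cc ⟨_, c⟩))
      (fun _ _ m n => Nat.pair 2 (Nat.pair m n))
  have key : ∀ {τ τ'} (t : NT τ) (t' : NT τ'), code τ t = code τ' t' →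
      (⟨τ, t⟩ : Σ τ, NT τ) = ⟨τ', t'⟩ := by
    intro τ τ' t
    induction t generalizing τ' with
    | par τ i =>
      intro t' h
      cases t' with
      | par τ' j =>
        have := Nat.pair_eq_pair.1 (Nat.pair_eq_pair.1 h).2
        cases hct this.1; cases this.2; rfl
      | const c => cases (Nat.pair_eq_pair.1 h).1
      | app f a => cases (Nat.pair_eq_pair.1 h).1
    | const c =>
      intro t' h
      cases t' with
      | par τ' j => cases (Nat.pair_eq_pair.1 h).1
      | const c' => cases hcc (Nat.pair_eq_pair.1 h).2; rfl
      | app f a => cases (Nat.pair_eq_pair.1 h).1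
    | app f a ihf iha =>
      intro t' h
      cases t' with
      | par τ' j => cases (Nat.pair_eq_pair.1 h).1
      | const c' => cases (Nat.pair_eq_pair.1 h).1
      | app f' a' =>
        have := Nat.pair_eq_pair.1 (Nat.pair_eq_pair.1 h).2
        cases ihf f' this.1; cases iha a' this.2; rfl
  exact Function.Injective.countable (f := fun t => code t.1 t.2) fun t t' h => key t.2 t'.2 h

instance (τ : Ty) : Countable (NT τ) :=
  Function.Injective.countable (f := fun v => (⟨τ, v⟩ : Σ τ, NT τ)) sigma_mk_injective

/-- Reading each variable as the name with its own de Bruijn index reduces countability of open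
terms to that of closed ones. -/
theorem Tm.toNT_inj {Γ : Ctx} {τ τ' : Ty} (s : Tm Γ τ) (t : Tm Γ τ')
    (h : (⟨τ, s.toNT fun τ v => .par τ v.idx⟩ : Σ τ, NT τ) =
      ⟨τ', t.toNT fun τ v => .par τ v.idx⟩) :
    (⟨τ, s⟩ : Σ τ, Tm Γ τ) = ⟨τ', t⟩ := by
  induction s generalizing τ' with
  | var v =>
    cases t with
    | var w =>
      simp only [Tm.toNT, Sigma.mk.injEq] at h
      obtain ⟨rfl, h⟩ := h
      cases Var.idx_inj v w (by simpa using h); rfl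
    | const c => simp only [Tm.toNT, Sigma.mk.injEq] at h; obtain ⟨rfl, h⟩ := h; cases h
    | app f a => simp only [Tm.toNT, Sigma.mk.injEq] at h; obtain ⟨rfl, h⟩ := h; cases h
  | const c =>
    cases t with
    | var w => simp only [Tm.toNT, Sigma.mk.injEq] at h; obtain ⟨rfl, h⟩ := h; cases h
    | const c => simp only [Tm.toNT, Sigma.mk.injEq] at h; obtain ⟨rfl, h⟩ := h; cases h; rfl
    | app f a => simp only [Tm.toNT, Sigma.mk.injEq] at h; obtain ⟨rfl, h⟩ := h; cases h
  | app f a ihf iha =>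
    cases t with
    | var w => simp only [Tm.toNT, Sigma.mk.injEq] at h; obtain ⟨rfl, h⟩ := h; cases h
    | const c => simp only [Tm.toNT, Sigma.mk.injEq] at h; obtain ⟨rfl, h⟩ := h; cases h
    | app f' a' =>
      simp only [Tm.toNT, Sigma.mk.injEq] at h
      obtain ⟨rfl, h⟩ := h
      simp only [heq_eq_eq, NT.app.injEq] at h
      obtain ⟨rfl, hf, ha⟩ := h
      cases ihf f' (by rw [eq_of_heq hf]); cases iha a' (by rw [eq_of_heq ha]); rfl

instance (Γ : Ctx) (τ : Ty) : Countable (Tm Γ τ) :=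
  Function.Injective.countable (f := fun t => t.toNT fun τ (v : Var Γ τ) => .par τ v.idx)
    fun s t h => by
      have h : s.toNT (fun τ v => .par τ v.idx) = t.toNT (fun τ v => .par τ v.idx) := h
      cases Tm.toNT_inj s t (by rw [h]); rfl

instance (Γ : Ctx) : Countable (Fm Γ) := by
  obtain ⟨ct, hct⟩ := exists_injective_nat Ty
  choose c hc using fun Γ : Ctx => exists_injective_nat (Tm Γ nat × Tm Γ nat)
  let code : ∀ Γ, Fm Γ → ℕ := fun Γ φ =>
    φ.rec (fun s t => Nat.pair 0 (c _ (s, t))) (Nat.pair 1 0)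
      (fun _ _ m n => Nat.pair 2 (Nat.pair m n)) (fun _ _ m n => Nat.pair 3 (Nat.pair m n))
      (fun _ _ m n => Nat.pair 4 (Nat.pair m n)) (fun τ _ m => Nat.pair 5 (Nat.pair (ct τ) m))
      (fun τ _ m => Nat.pair 6 (Nat.pair (ct τ) m))
  refine Function.Injective.countable (f := code Γ) fun φ => ?_
  induction φ with
  | eq0 s t =>
    intro ψ h
    cases ψ with
    | eq0 s' t' => cases hc _ (Nat.pair_eq_pair.1 h).2; rfl
    | _ => cases (Nat.pair_eq_pair.1 h).1
  | bot =>
    intro ψ h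
    cases ψ with
    | bot => rfl
    | _ => cases (Nat.pair_eq_pair.1 h).1
  | imp φ φ' ih ih' =>
    intro ψ h
    cases ψ with
    | imp ψ ψ' =>
      have := Nat.pair_eq_pair.1 (Nat.pair_eq_pair.1 h).2
      cases ih this.1; cases ih' this.2; rfl
    | _ => cases (Nat.pair_eq_pair.1 h).1
  | and φ φ' ih ih' =>
    intro ψ h
    cases ψ with
    | and ψ ψ' =>
      have := Nat.pair_eq_pair.1 (Nat.pair_eq_pair.1 h).2
      cases ih this.1; cases ih' this.2; rfl
    | _ => cases (Nat.pair_eq_pair.1 h).1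
  | or φ φ' ih ih' =>
    intro ψ h
    cases ψ with
    | or ψ ψ' =>
      have := Nat.pair_eq_pair.1 (Nat.pair_eq_pair.1 h).2
      cases ih this.1; cases ih' this.2; rfl
    | _ => cases (Nat.pair_eq_pair.1 h).1
  | all τ φ ih =>
    intro ψ h
    cases ψ with
    | all τ' ψ =>
      have := Nat.pair_eq_pair.1 (Nat.pair_eq_pair.1 h).2
      cases hct this.1; cases ih this.2; rfl
    | _ => cases (Nat.pair_eq_pair.1 h).1
  | ex τ φ ih =>
    intro ψ h
    cases ψ with
    | ex τ' ψ =>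
      have := Nat.pair_eq_pair.1 (Nat.pair_eq_pair.1 h).2
      cases hct this.1; cases ih this.2; rfl
    | _ => cases (Nat.pair_eq_pair.1 h).1

instance (Γ : Ctx) : Countable (NEnv Γ) := by
  induction Γ with
  | nil =>
    refine Function.Injective.countable (f := fun _ : NEnv [] => ()) fun e e' _ => ?_
    funext τ v; cases v
  | cons σ Γ ih =>
    refine Function.Injective.countable
      (f := fun e : NEnv (σ :: Γ) => (e _ .zero, (fun τ v => e τ (.succ v) : NEnv Γ)))
      fun e e' h => ?_
    obtain ⟨h, h'⟩ := Prod.mk.inj h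
    funext τ v
    cases v with
    | zero => exact h
    | succ v => exact congrFun (congrFun h' τ) v

instance : Countable Sen :=
  Function.Injective.countable
    (f := fun S : Sen => (⟨S.Γ, S.φ, S.e⟩ : Σ Γ : Ctx, Fm Γ × NEnv Γ)) fun S S' h => by
      cases S; cases S'; simp only [Sigma.mk.injEq] at h
      obtain ⟨rfl, h⟩ := h
      cases h; rfl

end ProbContent

namespace ProbContent

open Ty Tm Fm

/-! ### Entailment between sentences, and generic theories -/

/-- The sentences `L` entail `S`: for each interpretation of the names, `S` is derivable
from `L`. -/
def Entails (T : Schema) (L : List Sen) (S : Sen) : Prop :=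
  ∀ (Δ : Ctx) (g : Naming Δ), Prf T (L.map (Sen.inst g)) (S.inst g)

/-- Consistent lists of sentences. -/
def Consistent (T : Schema) (L : List Sen) : Prop := ¬ Entails T L .bot

/-- All names in the term have an index below `N`. -/
def NT.Below (N : ℕ) {τ : Ty} : NT τ → Prop
  | par _ i => i < N
  | const _ => True
  | app f a => f.Below N ∧ a.Below N

theorem NT.Below.mono {N M : ℕ} (h : N ≤ M) {τ : Ty} {t : NT τ} (ht : t.Below N) : t.Below M := by
  induction t with
  | par τ i => exact lt_of_lt_of_le ht h
  | const c => trivial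
  | app f a ihf iha => exact ⟨ihf ht.1, iha ht.2⟩

theorem NT.exists_below {τ : Ty} (t : NT τ) : ∃ N, t.Below N := by
  induction t with
  | par τ i => exact ⟨i + 1, Nat.lt_succ_self i⟩
  | const c => exact ⟨0, trivial⟩
  | app f a ihf iha =>
    obtain ⟨N, hN⟩ := ihf
    obtain ⟨M, hM⟩ := iha
    exact ⟨max N M, hN.mono (le_max_left _ _), hM.mono (le_max_right _ _)⟩

theorem NEnv.exists_below {Γ : Ctx} (e : NEnv Γ) : ∃ N, ∀ τ v, (e τ v).Below N := by
  induction Γ with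
  | nil => exact ⟨0, fun τ v => nomatch v⟩
  | cons σ Γ ih =>
    obtain ⟨N, hN⟩ := ih fun τ v => e τ (.succ v)
    obtain ⟨M, hM⟩ := (e σ .zero).exists_below
    refine ⟨max N M, fun τ v => ?_⟩
    cases v with
    | zero => exact hM.mono (le_max_right _ _)
    | succ v => exact (hN τ v).mono (le_max_left _ _)

/-- Finitely many sentences use finitely many names; this provides the fresh name in
`Consistent.witness`. -/
theorem exists_below_list (L : List Sen) : ∃ N, ∀ S ∈ L, ∀ τ v, (S.e τ v).Below N := by
  induction L with
  | nil => exact ⟨0, by simp⟩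
  | cons S L ih =>
    obtain ⟨N, hN⟩ := ih
    obtain ⟨M, hM⟩ := S.e.exists_below
    refine ⟨max N M, fun S' hS' τ v => ?_⟩
    rcases List.mem_cons.1 hS' with rfl | hS'
    · exact (hM τ v).mono (le_max_right _ _)
    · exact (hN S' hS' τ v).mono (le_max_left _ _)

open Classical in
/-- Interpret the name `par σ N` by a new variable. -/
noncomputable def Naming.bind {Δ : Ctx} (g : Naming Δ) (σ : Ty) (N : ℕ) :
    Naming (σ :: Δ) := fun τ i =>
  if h : i = N ∧ σ = τ then h.2 ▸ v0 else (g τ i).wk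

theorem Naming.bind_self {Δ : Ctx} (g : Naming Δ) (σ : Ty) (N : ℕ) : g.bind σ N σ N = v0 := by
  simp [Naming.bind]

theorem NT.Below.inst_bind {Δ : Ctx} (g : Naming Δ) (σ : Ty) {N : ℕ} {τ : Ty} {t : NT τ}
    (h : t.Below N) : t.inst (g.bind σ N) = (t.inst g).wk := by
  induction t with
  | par τ i =>
    have h : i < N := h
    simp [NT.inst, Naming.bind, h.ne]
  | const c => rfl
  | app f a ihf iha => simp only [NT.inst, ihf h.1, iha h.2, Tm.wk, Tm.ren]

theorem Sen.inst_bind {Δ : Ctx} (g : Naming Δ) (σ : Ty) {N : ℕ} {S : Sen}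
    (h : ∀ τ v, (S.e τ v).Below N) : S.inst (g.bind σ N) = (S.inst g).wk := by
  rw [Sen.inst, Sen.inst, Fm.wk, Fm.ren_subst]
  congr; funext τ v
  exact (h τ v).inst_bind g σ

variable {T : Schema}

theorem Entails.mono {L L' : List Sen} {S : Sen} (h : Entails T L S) (hL : L ⊆ L') :
    Entails T L' S := fun Δ g => (h Δ g).weaken (List.map_subset _ hL)

theorem Consistent.decide {L : List Sen} (h : Consistent T L) (S : Sen) :
    Consistent T (S :: L) ∨ Consistent T (S.not :: L) := by
  by_contra! hc
  obtain ⟨h₁, h₂⟩ := hc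
  exact h fun Δ g => .by_cases (S.inst g) (not_not.1 h₁ Δ g) (not_not.1 h₂ Δ g)

/-- A fresh name serves as an eigenvariable. Reinterpreted as a new variable by `Naming.bind`, it
leaves `L` unchanged up to weakening and turns a refutation of the instance into the premise of
`ex_elim`. Since `Entails` ranges over all contexts and interpretations, no closure of `Prf` under
substitution is needed, which would be an assumption on `T`. -/
theorem Consistent.witness {L : List Sen} (h : Consistent T L) {Γ : Ctx} {τ : Ty}
    {φ : Fm (τ :: Γ)} {e : NEnv Γ} (hφ : ⟨ex τ φ, e⟩ ∈ L) :
    ∃ c : NT τ, Consistent T (⟨φ, .cons c e⟩ :: L) := by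
  obtain ⟨N, hN⟩ := exists_below_list L
  refine ⟨.par τ N, fun hc => h fun Δ g => ?_⟩
  refine .ex_elim (φ := φ.subst (Sub.up fun τ v => (e τ v).inst g))
    (.hyp (List.mem_map_of_mem hφ)) ?_
  have k := hc _ (g.bind τ N)
  have e₁ : (L.map (Sen.inst g)).map Fm.wk = L.map (Sen.inst (g.bind τ N)) := by
    rw [List.map_map]
    exact List.map_congr_left fun S hS => (Sen.inst_bind g τ (hN S hS)).symm
  have e₂ : Sen.inst (g.bind τ N) ⟨φ, .cons (.par τ N) e⟩ =
      φ.subst (Sub.up fun τ v => (e τ v).inst g) := by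
    rw [Sen.inst]
    congr; funext σ v
    cases v with
    | zero => exact Naming.bind_self g τ N
    | succ v => exact (hN _ hφ σ v).inst_bind g τ
  rw [e₁, ← e₂]
  exact k

/-- The consistent lists of sentences, as forcing conditions. -/
def Cond (T : Schema) : Type := {L : List Sen // Consistent T L}

/-- Stronger conditions are larger, so that `Order.Cofinal` expresses density and a generic filter
becomes an ideal. -/
instance : Preorder (Cond T) where
  le L L' := L.1 ⊆ L'.1
  le_refl L := List.Subset.refl _
  le_trans L L' L'' := List.Subset.trans

/-- The conditions that decide `S`. -/
def decideSet (T : Schema) (S : Sen) : Order.Cofinal (Cond T) where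
  carrier := {L | S ∈ L.1 ∨ S.not ∈ L.1}
  isCofinal L := by
    rcases L.2.decide S with h | h
    · exact ⟨⟨_, h⟩, .inl List.mem_cons_self, List.subset_cons_self _ _⟩
    · exact ⟨⟨_, h⟩, .inr List.mem_cons_self, List.subset_cons_self _ _⟩

/-- The conditions that contain the negation of `S` or, if `S` is existential, an instance. -/
def witnessSet (T : Schema) (S : Sen) : Order.Cofinal (Cond T) where
  carrier := {L | S.not ∈ L.1 ∨ ∀ τ φ, S.φ = ex τ φ → ∃ c : NT τ, ⟨φ, .cons c S.e⟩ ∈ L.1}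
  isCofinal L := by
    rcases L.2.decide S with h | h
    · by_cases hS : ∃ τ φ, S.φ = ex τ φ
      · obtain ⟨τ, φ, hS⟩ := hS
        have h : Consistent T ((⟨ex τ φ, S.e⟩ : Sen) :: L.1) := by rw [← hS]; exact h
        obtain ⟨c, hc⟩ := h.witness List.mem_cons_self
        refine ⟨⟨_, hc⟩, .inr ?_, fun S hS =>
          List.mem_cons_of_mem _ (List.mem_cons_of_mem _ hS)⟩
        intro τ' φ' h'
        cases hS.symm.trans h'
        exact ⟨c, List.mem_cons_self⟩
      · push Not at hS
        exact ⟨L, .inr fun τ φ h => absurd h (hS τ φ), List.Subset.refl _⟩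
    · exact ⟨⟨_, h⟩, .inl List.mem_cons_self, List.subset_cons_self _ _⟩

/-- A complete consistent theory with witnesses. -/
structure Henkin (T : Schema) (Th : Set Sen) : Prop where
  consistent : ∀ L : List Sen, (∀ S ∈ L, S ∈ Th) → Consistent T L
  complete : ∀ S, S ∈ Th ∨ S.not ∈ Th
  witness : ∀ {Γ : Ctx} {τ : Ty} {φ : Fm (τ :: Γ)} {e : NEnv Γ}, ⟨ex τ φ, e⟩ ∈ Th →
    ∃ c : NT τ, ⟨φ, .cons c e⟩ ∈ Th

theorem Consistent.not_mem {L : List Sen} (h : Consistent T L) {S : Sen} (hS : S ∈ L)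
    (hS' : S.not ∈ L) : False :=
  h fun _ _ => .imp_elim (.hyp (List.mem_map_of_mem hS')) (.hyp (List.mem_map_of_mem hS))

/-- Rasiowa–Sikorski: the union of a generic ideal of conditions through `L` is complete by the sets
`decideSet` and has witnesses by the sets `witnessSet`. -/
theorem exists_henkin {L : List Sen} (hL : Consistent T L) :
    ∃ Th, Henkin T Th ∧ ∀ S ∈ L, S ∈ Th := by
  have : Encodable (Sen ⊕ Sen) := Encodable.ofCountable _
  obtain ⟨p₀, hp₀⟩ : ∃ p₀ : Cond T, p₀.1 = L := ⟨⟨L, hL⟩, rfl⟩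
  set I := Order.idealOfCofinals p₀ (Sum.elim (decideSet T) (witnessSet T))
  have hmeet := Order.cofinal_meets_idealOfCofinals p₀
    (Sum.elim (decideSet T) (witnessSet T))
  -- An ideal is directed, so finitely many sentences of the union already lie in one condition, and
  -- conditions are consistent.
  have hfin : ∀ K : List Sen, (∀ S ∈ K, ∃ p ∈ I, S ∈ p.1) → ∃ p ∈ I, K ⊆ p.1 := by
    intro K hK
    induction K with
    | nil => exact ⟨_, Order.mem_idealOfCofinals _ _, List.nil_subset _⟩
    | cons S K ih =>
      obtain ⟨p, hp, hpK⟩ := ih fun S' hS' => hK S' (List.mem_cons_of_mem _ hS')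
      obtain ⟨q, hq, hqS⟩ := hK S List.mem_cons_self
      obtain ⟨r, hr, hpr, hqr⟩ := I.directed p hp q hq
      exact ⟨r, hr, List.cons_subset.2 ⟨hqr hqS, fun S' hS' => hpr (hpK hS')⟩⟩
  have hcons : ∀ K : List Sen, (∀ S ∈ K, S ∈ {S | ∃ p ∈ I, S ∈ p.1}) → Consistent T K := by
    intro K hK hc
    obtain ⟨p, -, hp⟩ := hfin K hK
    exact p.2 (hc.mono hp)
  refine ⟨{S | ∃ p ∈ I, S ∈ p.1}, ⟨hcons, ?_, ?_⟩, ?_⟩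
  · intro S
    obtain ⟨p, hpS, hp⟩ := hmeet (.inl S)
    exact hpS.imp (fun h => ⟨p, hp, h⟩) (fun h => ⟨p, hp, h⟩)
  · intro Γ τ φ e hS
    obtain ⟨p, hpS, hp⟩ := hmeet (.inr ⟨ex τ φ, e⟩)
    rcases hpS with h | h
    · refine ((hcons [⟨ex τ φ, e⟩, Sen.not ⟨ex τ φ, e⟩] ?_).not_mem List.mem_cons_self
        (List.mem_cons_of_mem _ List.mem_cons_self)).elim
      intro S' hS'
      simp only [List.mem_cons, List.not_mem_nil, or_false] at hS'
      rcases hS' with rfl | rfl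
      · exact hS
      · exact ⟨p, hp, h⟩
    · obtain ⟨c, hc⟩ := h τ φ rfl
      exact ⟨c, p, hp, hc⟩
  · exact fun S hS => ⟨_, Order.mem_idealOfCofinals _ _, hp₀ ▸ hS⟩

namespace Henkin

variable {Th : Set Sen}

theorem mem_of_entails (hT : Henkin T Th) {L : List Sen} (hL : ∀ S ∈ L, S ∈ Th) {S : Sen}
    (h : Entails T L S) : S ∈ Th := by
  by_contra hS
  refine hT.consistent (S.not :: L) ?_ fun Δ g =>
    .imp_elim Prf.hyp0 ((h Δ g).weaken (List.subset_cons_self _ _))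
  intro S' hS'
  rcases List.mem_cons.1 hS' with rfl | hS'
  · exact (hT.complete S).resolve_left hS
  · exact hL S' hS'

theorem mem_of_entails₁ (hT : Henkin T Th) {S S' : Sen} (hS : S ∈ Th)
    (h : ∀ Δ (g : Naming Δ), Prf T [S.inst g] (S'.inst g)) : S' ∈ Th :=
  hT.mem_of_entails (L := [S]) (by simpa using hS) h

theorem mem_of_entails₂ (hT : Henkin T Th) {S₁ S₂ S' : Sen} (h₁ : S₁ ∈ Th) (h₂ : S₂ ∈ Th)
    (h : ∀ Δ (g : Naming Δ), Prf T [S₁.inst g, S₂.inst g] (S'.inst g)) : S' ∈ Th :=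
  hT.mem_of_entails (L := [S₁, S₂]) (by simpa using ⟨h₁, h₂⟩) h

theorem mem_not (hT : Henkin T Th) {S : Sen} : S.not ∈ Th ↔ S ∉ Th := by
  refine ⟨fun h h' => ?_, fun h => (hT.complete S).resolve_left h⟩
  exact (hT.consistent [S, S.not] (by simpa using ⟨h', h⟩)).not_mem List.mem_cons_self
    (List.mem_cons_of_mem _ List.mem_cons_self)

variable {Γ : Ctx} {e : NEnv Γ}

theorem mem_bot (hT : Henkin T Th) : (⟨Fm.bot, e⟩ : Sen) ∉ Th := fun h =>
  hT.consistent [⟨Fm.bot, e⟩] (by simpa using h) fun _ _ => Prf.hyp0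

theorem mem_and (hT : Henkin T Th) {φ ψ : Fm Γ} :
    (⟨φ ⋏' ψ, e⟩ : Sen) ∈ Th ↔ (⟨φ, e⟩ : Sen) ∈ Th ∧ ⟨ψ, e⟩ ∈ Th :=
  ⟨fun h => ⟨hT.mem_of_entails₁ h fun _ _ => .and_left Prf.hyp0,
    hT.mem_of_entails₁ h fun _ _ => .and_right Prf.hyp0⟩,
    fun h => hT.mem_of_entails₂ h.1 h.2 fun _ _ => .and_intro Prf.hyp0 Prf.hyp1⟩

theorem mem_or (hT : Henkin T Th) {φ ψ : Fm Γ} :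
    (⟨φ ⋎' ψ, e⟩ : Sen) ∈ Th ↔ (⟨φ, e⟩ : Sen) ∈ Th ∨ ⟨ψ, e⟩ ∈ Th := by
  refine ⟨fun h => ?_, fun h => h.elim (fun h => hT.mem_of_entails₁ h fun _ _ => .or_left Prf.hyp0)
    fun h => hT.mem_of_entails₁ h fun _ _ => .or_right Prf.hyp0⟩
  by_contra! hc
  refine hT.mem_bot (e := e) (hT.mem_of_entails (L := [⟨φ ⋎' ψ, e⟩, Sen.not ⟨φ, e⟩,
    Sen.not ⟨ψ, e⟩]) (by simpa using ⟨h, hT.mem_not.2 hc.1, hT.mem_not.2 hc.2⟩) fun Δ g => ?_)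
  refine .or_elim Prf.hyp0 (.imp_elim (.hyp ?_) Prf.hyp0) (.imp_elim (.hyp ?_) Prf.hyp0)
  · exact List.mem_cons_of_mem _ (List.mem_cons_of_mem _ List.mem_cons_self)
  · exact List.mem_cons_of_mem _ (List.mem_cons_of_mem _ (List.mem_cons_of_mem _
      List.mem_cons_self))

theorem mem_imp (hT : Henkin T Th) {φ ψ : Fm Γ} :
    (⟨φ ⟹' ψ, e⟩ : Sen) ∈ Th ↔ ((⟨φ, e⟩ : Sen) ∈ Th → (⟨ψ, e⟩ : Sen) ∈ Th) := by
  refine ⟨fun h h' => hT.mem_of_entails₂ h h' fun _ _ => .imp_elim Prf.hyp0 Prf.hyp1, fun h => ?_⟩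
  by_cases hφ : (⟨φ, e⟩ : Sen) ∈ Th
  · exact hT.mem_of_entails₁ (h hφ) fun _ _ => .imp_intro Prf.hyp1
  · exact hT.mem_of_entails₁ (hT.mem_not.2 hφ) fun _ _ =>
      .imp_intro (.exfalso (.imp_elim Prf.hyp1 Prf.hyp0))

theorem mem_ex (hT : Henkin T Th) {τ : Ty} {φ : Fm (τ :: Γ)} :
    (⟨ex τ φ, e⟩ : Sen) ∈ Th ↔ ∃ c : NT τ, (⟨φ, .cons c e⟩ : Sen) ∈ Th := by
  refine ⟨hT.witness, fun ⟨c, hc⟩ => hT.mem_of_entails₁ hc fun Δ g => ?_⟩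
  refine .ex_intro (c.inst g) ?_
  rw [Sen.inst_cons]
  exact Prf.hyp0

/-- If the universal sentence fails, then classically the theory contains the existential sentence
for the negation, and a witness of it is a counterexample among the closed terms. -/
theorem mem_all (hT : Henkin T Th) {τ : Ty} {φ : Fm (τ :: Γ)} :
    (⟨all τ φ, e⟩ : Sen) ∈ Th ↔ ∀ c : NT τ, (⟨φ, .cons c e⟩ : Sen) ∈ Th := by
  constructor
  · refine fun h c => hT.mem_of_entails₁ h fun Δ g => ?_
    rw [Sen.inst_cons]
    exact .all_elim Prf.hyp0 _
  · intro h
    by_contra hc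
    have hc' : (⟨ex τ (Fm.not φ), e⟩ : Sen) ∈ Th := by
      refine hT.mem_of_entails₁ (hT.mem_not.2 hc) fun Δ g => ?_
      refine .by_contra (.imp_elim Prf.hyp1 (.all_intro (.by_contra ?_)))
      refine .imp_elim (φ := (ex τ (Fm.not (φ.subst (Sub.up fun τ v => (e τ v).inst g)))).wk)
        Prf.hyp1 (.ex_intro v0 ?_)
      convert Prf.hyp0 using 1
      rw [Fm.subst_ren]
      refine Eq.trans ?_ (Fm.subst_var _)
      congr; funext σ v; cases v <;> rfl
    obtain ⟨c, hc⟩ := hT.witness hc'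
    exact (hT.mem_not (S := ⟨φ, .cons c e⟩)).1 hc (h c)

end Henkin

end ProbContent

namespace ProbContent

open Ty Tm Fm

/-! ### Structures and models -/

/-- Applicative structures for the language. -/
structure Str : Type 1 where
  /-- The objects of each type. -/
  C : Ty → Type
  /-- Application. -/
  app : {σ τ : Ty} → C (σ ⇒ₜ τ) → C σ → C τ
  /-- The values of the constants. -/
  cst : {τ : Ty} → Const τ → C τ

/-- Assignments of objects to the variables of a context. -/
abbrev Env (M : Str) (Γ : Ctx) : Type := (τ : Ty) → Var Γ τ → M.C τ

/-- The empty assignment. -/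
def Env.nil {M : Str} : Env M [] := fun _ v => nomatch v

/-- Extend an assignment by a value for the most recent variable. -/
def Env.cons {M : Str} {Γ : Ctx} {σ : Ty} (a : M.C σ) (e : Env M Γ) : Env M (σ :: Γ)
  | _, .zero => a
  | _, .succ v => e _ v

infixr:67 " ∷ " => Env.cons

/-- The value of a term. -/
def Tm.eval {M : Str} {Γ : Ctx} {τ : Ty} (t : Tm Γ τ) (e : Env M Γ) : M.C τ :=
  match t with
  | .var v => e _ v
  | .const c => M.cst c
  | .app f a => M.app (f.eval e) (a.eval e)

/-- Satisfaction of a formula; equality at type `0` is interpreted by equality. -/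
def Fm.sat {M : Str} {Γ : Ctx} (φ : Fm Γ) (e : Env M Γ) : Prop :=
  match φ with
  | eq0 s t => s.eval e = t.eval e
  | bot => False
  | imp φ ψ => φ.sat e → ψ.sat e
  | and φ ψ => φ.sat e ∧ ψ.sat e
  | or φ ψ => φ.sat e ∨ ψ.sat e
  | all τ φ => ∀ a : M.C τ, φ.sat (a ∷ e)
  | ex τ φ => ∃ a : M.C τ, φ.sat (a ∷ e)

/-- Models: the equations for the combinators and the recursors (of single types) hold as
equations between objects, and all formulas with derivable substitution instances hold. -/
structure IsModel (T : Schema) (M : Str) : Prop where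
  combK : ∀ {ρ τ : Ty} (x : M.C ρ) (y : M.C τ), M.app (M.app (M.cst (.combK ρ τ)) x) y = x
  combS : ∀ {δ ρ τ : Ty} (x : M.C (δ ⇒ₜ ρ ⇒ₜ τ)) (y : M.C (δ ⇒ₜ ρ)) (z : M.C δ),
    M.app (M.app (M.app (M.cst (.combS δ ρ τ)) x) y) z = M.app (M.app x z) (M.app y z)
  recur_zero : ∀ {ρ : Ty} (y : M.C ρ) (z : M.C (ρ ⇒ₜ nat ⇒ₜ ρ)),
    M.app (M.app (M.app (M.cst (.recur [ρ] ρ .zero)) (M.cst .zero)) y) z = y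
  recur_succ : ∀ {ρ : Ty} (n : M.C nat) (y : M.C ρ) (z : M.C (ρ ⇒ₜ nat ⇒ₜ ρ)),
    M.app (M.app (M.app (M.cst (.recur [ρ] ρ .zero)) (M.app (M.cst .succ) n)) y) z =
      M.app (M.app z (M.app (M.app (M.app (M.cst (.recur [ρ] ρ .zero)) n) y) z)) n
  sat_of_prf : ∀ {Γ : Ctx} (φ : Fm Γ), (∀ Δ (s : Sub Γ Δ), Prf T [] (φ.subst s)) →
    ∀ e : Env M Γ, φ.sat e

/-! ### The term model of a Henkin theory -/

/-- A closed term of each type. -/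
def Tm.default : (τ : Ty) → Tm [] τ
  | .nat => .const .zero
  | .sample => .const .point
  | .event => .const .empty
  | .arr σ τ => .const (.combK τ σ) ⊙ Tm.default τ

/-- Provable equality under quantifier-free sentences of the theory. -/
def NTEq (T : Schema) (Th : Set Sen) {τ : Ty} (s t : NT τ) : Prop :=
  ∃ L : List Sen, (∀ S ∈ L, S ∈ Th ∧ S.φ.QF) ∧
    ∀ Δ (g : Naming Δ), Prf T (L.map (Sen.inst g)) (eqF τ (s.inst g) (t.inst g))

section TermModel

variable {T : Schema} {Th : Set Sen}

theorem NTEq.of_prf {τ : Ty} {s t : NT τ}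
    (h : ∀ Δ (g : Naming Δ), Prf T [] (eqF τ (s.inst g) (t.inst g))) : NTEq T Th s t :=
  ⟨[], by simp, h⟩

theorem NTEq.equivalence (τ : Ty) : Equivalence (NTEq T Th (τ := τ)) where
  refl s := .of_prf fun Δ g => Prf.eqF_refl _
  symm := fun ⟨L, hL, h⟩ => ⟨L, hL, fun Δ g => Prf.eqF_symm _ _ (h Δ g)⟩
  trans := fun ⟨L, hL, h⟩ ⟨K, hK, k⟩ => ⟨L ++ K, fun S hS =>
    (List.mem_append.1 hS).elim (hL S) (hK S), fun Δ g => by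
      rw [List.map_append]
      exact Prf.eqF_trans _ _ _ ((h Δ g).weaken (List.subset_append_left _ _))
        ((k Δ g).weaken (List.subset_append_right _ _))⟩

/-- This is why `NTEq` admits only quantifier-free sentences as hypotheses: membership of `eqF τ s
t` in the theory need not be preserved by application in a weakly extensional system. -/
theorem NTEq.app {σ τ : Ty} {f f' : NT (σ ⇒ₜ τ)} {a a' : NT σ} (hf : NTEq T Th f f')
    (ha : NTEq T Th a a') : NTEq T Th (.app f a) (.app f' a') := by
  obtain ⟨L, hL, h⟩ := hf
  obtain ⟨K, hK, k⟩ := ha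
  have hLK : ∀ S ∈ L ++ K, S ∈ Th ∧ S.φ.QF := fun S hS =>
    (List.mem_append.1 hS).elim (hL S) (hK S)
  refine ⟨L ++ K, hLK, fun Δ g => ?_⟩
  refine Prf.congr_app ?_ ((h Δ g).weaken ?_) ((k Δ g).weaken ?_)
  · intro φ hφ
    obtain ⟨S, hS, rfl⟩ := List.mem_map.1 hφ
    exact (hLK S hS).2.subst _
  · exact List.map_subset _ (List.subset_append_left _ _)
  · exact List.map_subset _ (List.subset_append_right _ _)

/-- The setoid of provable equality. -/
def NTSetoid (T : Schema) (Th : Set Sen) (τ : Ty) : Setoid (NT τ) :=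
  ⟨_, NTEq.equivalence (T := T) (Th := Th) τ⟩

/-- The term model. -/
def termStr (T : Schema) (Th : Set Sen) : Str where
  C τ := Quotient (NTSetoid T Th τ)
  app := Quotient.map₂ NT.app fun _ _ h _ _ h' => NTEq.app h h'
  cst c := Quotient.mk _ (.const c)

/-- The object denoted by a closed term. -/
def denote (T : Schema) (Th : Set Sen) {τ : Ty} (t : NT τ) : (termStr T Th).C τ :=
  Quotient.mk (NTSetoid T Th τ) t

theorem denote_surjective {τ : Ty} (a : (termStr T Th).C τ) : ∃ t, denote T Th t = a :=
  Quotient.exists_rep a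

theorem denote_eq_iff {τ : Ty} {s t : NT τ} :
    denote T Th s = denote T Th t ↔ NTEq T Th s t := Quotient.eq

theorem denote_cons {Γ : Ctx} {σ : Ty} (a : NT σ) (e : NEnv Γ) :
    (fun τ v => denote T Th (NEnv.cons a e τ v)) =
      denote T Th a ∷ fun τ v => denote T Th (e τ v) := by
  funext τ v; cases v <;> rfl

theorem eval_denote {Γ : Ctx} {τ : Ty} (t : Tm Γ τ) (e : NEnv Γ) :
    t.eval (fun τ v => denote T Th (e τ v)) = denote T Th (t.toNT e) := by
  induction t with
  | var v => rfl
  | const c => rfl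
  | app f a ihf iha => rw [Tm.eval, ihf, iha]; rfl

/-- The truth lemma. The connectives and quantifiers follow the closure properties of the theory,
and quantifiers range over closed terms because every object is denoted by one. -/
theorem Henkin.sat_iff (hT : Henkin T Th) {Γ : Ctx} (φ : Fm Γ) (e : NEnv Γ) :
    φ.sat (fun τ v => denote T Th (e τ v)) ↔ (⟨φ, e⟩ : Sen) ∈ Th := by
  induction φ with
  | eq0 s t =>
    rw [Fm.sat, eval_denote, eval_denote, denote_eq_iff]
    have key : ∀ Δ (g : Naming Δ), Sen.inst g ⟨s ≐ t, e⟩ =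
        eqF nat ((s.toNT e).inst g) ((t.toNT e).inst g) := fun Δ g => by
      rw [Tm.inst_toNT, Tm.inst_toNT]; rfl
    constructor
    · rintro ⟨L, hL, h⟩
      refine hT.mem_of_entails (fun S hS => (hL S hS).1) fun Δ g => ?_
      rw [key]; exact h Δ g
    · intro h
      -- An equation at type `0` is quantifier-free, so it may be used as the hypothesis that
      -- derives itself.
      refine ⟨[⟨s ≐ t, e⟩], by simpa using ⟨h, trivial⟩, fun Δ g => ?_⟩
      rw [← key]; exact Prf.hyp0
  | bot => exact ⟨False.elim, fun h => hT.mem_bot h⟩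
  | imp φ ψ ih ih' => rw [Fm.sat, ih, ih', hT.mem_imp]
  | and φ ψ ih ih' => rw [Fm.sat, ih, ih', hT.mem_and]
  | or φ ψ ih ih' => rw [Fm.sat, ih, ih', hT.mem_or]
  | all τ φ ih =>
    rw [Fm.sat, hT.mem_all]
    constructor
    · intro h c
      rw [← ih, denote_cons]
      exact h _
    · intro h a
      obtain ⟨c, rfl⟩ := denote_surjective a
      rw [← denote_cons, ih]
      exact h c
  | ex τ φ ih =>
    rw [Fm.sat, hT.mem_ex]
    constructor
    · rintro ⟨a, h⟩
      obtain ⟨c, rfl⟩ := denote_surjective a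
      rw [← denote_cons, ih] at h
      exact ⟨c, h⟩
    · rintro ⟨c, h⟩
      rw [← ih, denote_cons] at h
      exact ⟨_, h⟩

/-- The combinator and recursor axioms are derivable without hypotheses, hence hold as identities
between classes even at higher types. Satisfaction of a formula under an assignment needs its
derivability after substitution of the denoting terms, which explains the quantification over
substitutions in `IsModel`. -/
theorem Henkin.isModel (hT : Henkin T Th) : IsModel T (termStr T Th) where
  combK x y := by
    obtain ⟨x, rfl⟩ := denote_surjective x
    obtain ⟨y, rfl⟩ := denote_surjective y
    exact denote_eq_iff.2 (.of_prf fun Δ g => .ax (.combK _ _))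
  combS x y z := by
    obtain ⟨x, rfl⟩ := denote_surjective x
    obtain ⟨y, rfl⟩ := denote_surjective y
    obtain ⟨z, rfl⟩ := denote_surjective z
    exact denote_eq_iff.2 (.of_prf fun Δ g => .ax (.combS _ _ _))
  recur_zero {ρ} y z := by
    obtain ⟨y, rfl⟩ := denote_surjective y
    obtain ⟨z, rfl⟩ := denote_surjective z
    refine denote_eq_iff.2 (.of_prf fun Δ g => .ax ?_)
    exact Axm.recur_zero (ρs := [ρ]) .zero (fun | _, .zero => y.inst g) (fun | _, .zero => z.inst g)
  recur_succ {ρ} n y z := by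
    obtain ⟨n, rfl⟩ := denote_surjective n
    obtain ⟨y, rfl⟩ := denote_surjective y
    obtain ⟨z, rfl⟩ := denote_surjective z
    refine denote_eq_iff.2 (.of_prf fun Δ g => .ax ?_)
    exact Axm.recur_succ (ρs := [ρ]) .zero (n.inst g) (fun | _, .zero => y.inst g)
      (fun | _, .zero => z.inst g)
  sat_of_prf φ h e := by
    choose e' he' using fun τ v => denote_surjective (T := T) (Th := Th) (e τ v)
    have he : e = fun τ v => denote T Th (e' τ v) := by funext τ v; exact (he' τ v).symm
    rw [he, hT.sat_iff]
    exact hT.mem_of_entails (L := []) (by simp) fun Δ g => h Δ _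

end TermModel

/-- Completeness: sentences that hold in all models are derivable. -/
theorem proves_of_sat {T : Schema} {φ : Fm []} (h : ∀ M, IsModel T M → φ.sat (Env.nil (M := M))) :
    Proves T φ := by
  by_contra hφ
  have hc : Consistent T [⟨Fm.not φ, fun _ v => nomatch v⟩] := by
    intro hc
    -- Every type has a closed term, so all names can be interpreted in the empty context; the
    -- inconsistency becomes a derivation without free variables.
    have := hc [] fun τ _ => Tm.default τ
    refine hφ (.by_contra ?_)
    have hinst : Sen.inst (fun τ _ => Tm.default τ) ⟨Fm.not φ, fun _ v => nomatch v⟩ =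
        Fm.not φ := by
      refine Eq.trans ?_ (Fm.subst_var _)
      rw [Sen.inst]
      congr; funext τ v; cases v
    rw [List.map_singleton, hinst] at this
    exact this
  obtain ⟨Th, hT, hmem⟩ := exists_henkin hc
  have := (hT.sat_iff (Fm.not φ) fun _ v => nomatch v).2 (hmem _ List.mem_cons_self)
  refine this ?_
  convert h _ hT.isModel using 1
  funext τ v; cases v

/-! ### Evaluation in models -/

section Eval

variable {M : Str} {Γ Δ : Ctx} {τ : Ty}

theorem Tm.eval_ren (t : Tm Γ τ) (r : Ren Γ Δ) (e : Env M Δ) :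
    (t.ren r).eval e = t.eval fun τ v => e τ (r τ v) := by
  induction t with
  | var v => rfl
  | const c => rfl
  | app f a ihf iha => simp only [Tm.ren, Tm.eval, ihf, iha]

theorem Tm.eval_subst (t : Tm Γ τ) (s : Sub Γ Δ) (e : Env M Δ) :
    (t.subst s).eval e = t.eval fun τ v => (s τ v).eval e := by
  induction t with
  | var v => rfl
  | const c => rfl
  | app f a ihf iha => simp only [Tm.subst, Tm.eval, ihf, iha]

@[simp] theorem Tm.eval_wk {σ : Ty} (t : Tm Γ τ) (a : M.C σ) (e : Env M Γ) :
    (t.ren Ren.wk).eval (a ∷ e) = t.eval e := t.eval_ren _ _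

@[simp] theorem Tm.eval_cl (t : Tm [] τ) (e : Env M Γ) : t.cl.eval e = t.eval Env.nil := by
  rw [Tm.cl, Tm.eval_ren]; congr; funext τ v; cases v

theorem Fm.sat_subst (φ : Fm Γ) : ∀ {Δ : Ctx} (s : Sub Γ Δ) (e : Env M Δ),
    (φ.subst s).sat e ↔ φ.sat fun τ v => (s τ v).eval e := by
  have key : ∀ {Γ Δ : Ctx} {σ : Ty} (s : Sub Γ Δ) (e : Env M Δ) (a : M.C σ),
      (fun τ v => (s.up τ v).eval (a ∷ e)) = a ∷ fun τ v => (s τ v).eval e := by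
    intro Γ Δ σ s e a
    funext τ v
    cases v with
    | zero => rfl
    | succ v => exact Tm.eval_wk _ _ _
  induction φ with
  | eq0 => intros; simp only [Fm.subst, Fm.sat, Tm.eval_subst]
  | bot => intros; rfl
  | imp _ _ h h' | and _ _ h h' | or _ _ h h' => intros; simp only [Fm.subst, Fm.sat, h, h']
  | all _ _ h | ex _ _ h => intros; simp only [Fm.subst, Fm.sat, h, key]

theorem Fm.sat_ren (φ : Fm Γ) : ∀ {Δ : Ctx} (r : Ren Γ Δ) (e : Env M Δ),
    (φ.ren r).sat e ↔ φ.sat fun τ v => e τ (r τ v) := by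
  have key : ∀ {Γ Δ : Ctx} {σ : Ty} (r : Ren Γ Δ) (e : Env M Δ) (a : M.C σ),
      (fun τ v => (a ∷ e) τ (r.up τ v)) = a ∷ fun τ v => e τ (r τ v) := by
    intro Γ Δ σ s e a
    funext τ v; cases v <;> rfl
  induction φ with
  | eq0 => intros; simp only [Fm.ren, Fm.sat, Tm.eval_ren]
  | bot => intros; rfl
  | imp _ _ h h' | and _ _ h h' | or _ _ h h' => intros; simp only [Fm.ren, Fm.sat, h, h']
  | all _ _ h | ex _ _ h => intros; simp only [Fm.ren, Fm.sat, h, key]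

/-- Since the combinator equations hold between objects, β-reduction becomes a rewrite rule. It
concerns only applied abstractions: abstractions with equal values need not be equal objects. -/
theorem IsModel.eval_lam {T : Schema} (hM : IsModel T M) {σ : Ty} (t : Tm (σ :: Γ) τ) (e : Env M Γ)
    (a : M.C σ) : M.app ((lam t).eval e) a = t.eval (a ∷ e) := by
  induction t with
  | var v =>
    cases v with
    | zero => simp only [lam, Tm.eval, hM.combS, hM.combK]; rfl
    | succ v => simp only [lam, Tm.eval, hM.combK]; rfl
  | const c => simp only [lam, Tm.eval, hM.combK]
  | app f b ihf ihb =>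
    simp only [lam, Tm.eval, hM.combS]
    rw [ihf, ihb]

end Eval

end ProbContent

/-! ### Arithmetic of the possibly nonstandard numbers of a model -/

namespace ProbContent

open Ty Tm Fm

/-! ### Natural numbers of a model -/

/-- Models of the system with uniform boundedness. -/
class Model (M : Str) : Prop where
  isModel : IsModel UBΩ₀ M

attribute [simp] Fm.sat

@[simp] theorem Tm.eval_var {M : Str} {Γ : Ctx} {τ : Ty} (v : Var Γ τ) (e : Env M Γ) :
    (var v).eval e = e τ v := rfl

@[simp] theorem Tm.eval_const {M : Str} {Γ : Ctx} {τ : Ty} (c : Const τ) (e : Env M Γ) :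
    (const c : Tm Γ τ).eval e = M.cst c := rfl

@[simp] theorem Tm.eval_app {M : Str} {Γ : Ctx} {σ τ : Ty} (f : Tm Γ (σ ⇒ₜ τ)) (a : Tm Γ σ)
    (e : Env M Γ) : (f ⊙ a).eval e = M.app (f.eval e) (a.eval e) := rfl

@[simp] theorem Env.cons_zero {M : Str} {Γ : Ctx} {σ : Ty} (a : M.C σ) (e : Env M Γ) :
    (a ∷ e) σ .zero = a := rfl

@[simp] theorem Env.cons_succ {M : Str} {Γ : Ctx} {σ τ : Ty} (a : M.C σ) (e : Env M Γ)
    (v : Var Γ τ) : (a ∷ e) τ (.succ v) = e τ v := rfl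

variable {M : Str}

/-- The operations are the values of the terms of the system, so that an induction formula written
with these terms unfolds to a statement in the usual notation. -/
instance : Zero (M.C nat) := ⟨M.cst .zero⟩
instance : One (M.C nat) := ⟨M.app (M.cst .succ) (M.cst .zero)⟩
instance : Add (M.C nat) := ⟨fun x y => M.app (M.app (addC.eval .nil) x) y⟩
instance : Mul (M.C nat) := ⟨fun x y => M.app (M.app (mulC.eval .nil) x) y⟩
instance : _root_.Sub (M.C nat) := ⟨fun x y => M.app (M.app (subC.eval .nil) x) y⟩

@[simp] theorem cst_zero : M.cst .zero = 0 := rfl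
@[simp] theorem app_addC (x y : M.C nat) : M.app (M.app (addC.eval .nil) x) y = x + y := rfl
@[simp] theorem app_mulC (x y : M.C nat) : M.app (M.app (mulC.eval .nil) x) y = x * y := rfl
@[simp] theorem app_subC (x y : M.C nat) : M.app (M.app (subC.eval .nil) x) y = x - y := rfl

/-- Successor in a structure. -/
def S (x : M.C nat) : M.C nat := M.app (M.cst .succ) x

@[simp] theorem app_succ (x : M.C nat) : M.app (M.cst .succ) x = S x := rfl

/-- The recursor in a structure. -/
def recM {ρ : Ty} (n : M.C nat) (b : M.C ρ) (f : M.C (ρ ⇒ₜ nat ⇒ₜ ρ)) : M.C ρ :=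
  M.app (M.app (M.app (M.cst (.recur [ρ] ρ .zero)) n) b) f

@[simp] theorem eval_recT {Γ : Ctx} {ρ : Ty} (n : Tm Γ nat) (b : Tm Γ ρ)
    (f : Tm Γ (ρ ⇒ₜ nat ⇒ₜ ρ)) (e : Env M Γ) :
    (recT n b f).eval e = recM (n.eval e) (b.eval e) (f.eval e) := rfl

section

variable [hM : Model M]

@[simp] theorem app_lam {Γ : Ctx} {σ τ : Ty} (t : Tm (σ :: Γ) τ) (e : Env M Γ) (a : M.C σ) :
    M.app ((lam t).eval e) a = t.eval (a ∷ e) := hM.isModel.eval_lam t e a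

@[simp] theorem recM_zero {ρ : Ty} (b : M.C ρ) (f : M.C (ρ ⇒ₜ nat ⇒ₜ ρ)) : recM 0 b f = b :=
  hM.isModel.recur_zero b f

@[simp] theorem recM_succ {ρ : Ty} (n : M.C nat) (b : M.C ρ) (f : M.C (ρ ⇒ₜ nat ⇒ₜ ρ)) :
    recM (S n) b f = M.app (M.app f (recM n b f)) n := hM.isModel.recur_succ n b f

theorem sat_of_axm {Γ : Ctx} (φ : Fm Γ) (h : ∀ Δ (s : Sub Γ Δ), Axm (φ.subst s)) (e : Env M Γ) :
    φ.sat e := hM.isModel.sat_of_prf φ (fun Δ s => .ax (h Δ s)) e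

/-- Induction for formulas with parameters. -/
theorem induct {Γ : Ctx} (φ : Fm (nat :: Γ)) (e : Env M Γ) (h0 : φ.sat (0 ∷ e))
    (hs : ∀ n, φ.sat (n ∷ e) → φ.sat (S n ∷ e)) (n : M.C nat) : φ.sat (n ∷ e) := by
  have key := sat_of_axm (M := M) (φ.subst (Sub.one zero) ⋏'
    all nat (φ ⟹' φ.subst (Sub.cons (suc v0) (fun _ v => var (.succ v)))) ⟹' all nat φ)
    (fun Δ s => ?_) e
  · refine key ⟨?_, fun n hn => ?_⟩ n
    · rw [Fm.sat_subst]
      convert h0 using 1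
      funext τ v; cases v <;> rfl
    · rw [Fm.sat_subst]
      convert hs n hn using 1
      funext τ v; cases v <;> rfl
  -- A substitution instance of an induction axiom is the induction axiom for the substituted
  -- formula.
  · convert Axm.induction (φ.subst s.up) using 1
    simp only [Fm.subst, Fm.subst_one_subst, Tm.subst]
    congr 4
    simp only [Fm.subst_subst]
    congr; funext τ v
    cases v with
    | zero => rfl
    | succ v =>
      simp only [Sub.up, Tm.subst_ren]
      exact Tm.ren_eq_subst _ _

theorem S_ne_zero (n : M.C nat) : S n ≠ 0 :=
  sat_of_axm (M := M) (Γ := [nat]) (not (suc v0 ≐ zero)) (fun _ _ => .succ_ne _) (n ∷ .nil)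

theorem S_inj {n m : M.C nat} (h : S n = S m) : n = m :=
  sat_of_axm (M := M) (Γ := [nat, nat]) (suc v0 ≐ suc v1 ⟹' v0 ≐ v1) (fun _ _ => .succ_inj _ _)
    (n ∷ m ∷ .nil) h

theorem add_zero' (x : M.C nat) : x + 0 = x := by
  rw [← app_addC]; simp [addC]

theorem add_S (x y : M.C nat) : x + S y = S (x + y) := by
  rw [← app_addC, ← app_addC]; simp [addC]; rfl

theorem mul_zero' (x : M.C nat) : x * 0 = 0 := by
  rw [← app_mulC]; simp [mulC]

theorem mul_S (x y : M.C nat) : x * S y = x * y + x := by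
  rw [← app_mulC, ← app_mulC]; simp [mulC]; rfl

theorem zero_add' (x : M.C nat) : 0 + x = x := by
  have := induct (Γ := []) (add zero v0 ≐ v0) .nil ?_ (fun n h => ?_) x
  · simpa using this
  · simp [add_zero']
  · simp at h
    simp [add_S, h]

theorem S_add (x y : M.C nat) : S x + y = S (x + y) := by
  have := induct (Γ := [nat]) (add (suc v1) v0 ≐ suc (add v1 v0)) (x ∷ .nil) ?_ (fun n h => ?_) y
  · simpa using this
  · simp [add_zero']
  · simp at h
    simp [add_S, h]

theorem add_comm' (x y : M.C nat) : x + y = y + x := by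
  have := induct (Γ := [nat]) (add v1 v0 ≐ add v0 v1) (x ∷ .nil) ?_ (fun n h => ?_) y
  · simpa using this
  · simp [add_zero', zero_add']
  · simp at h
    simp [add_S, S_add, h]

theorem add_assoc' (x y z : M.C nat) : x + y + z = x + (y + z) := by
  have := induct (Γ := [nat, nat]) (add (add v1 v2) v0 ≐ add v1 (add v2 v0)) (x ∷ y ∷ .nil) ?_
    (fun n h => ?_) z
  · simpa using this
  · simp [add_zero']
  · simp at h
    simp [add_S, h]

theorem S_eq (x : M.C nat) : S x = x + 1 := by
  rw [show (1 : M.C nat) = S 0 from rfl, add_S, add_zero']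

theorem zero_mul' (x : M.C nat) : 0 * x = 0 := by
  have := induct (Γ := []) (mul zero v0 ≐ zero) .nil ?_ (fun n h => ?_) x
  · simpa using this
  · simp [mul_zero']
  · simp at h
    simp [mul_S, h, add_zero']

theorem S_mul (x y : M.C nat) : S x * y = x * y + y := by
  have := induct (Γ := [nat]) (mul (suc v1) v0 ≐ add (mul v1 v0) v0) (x ∷ .nil) ?_ (fun n h => ?_) y
  · simpa using this
  · simp [mul_zero', add_zero']
  · simp at h
    simp only [Fm.sat, eval_app, eval_const, eval_var, app_succ, eval_cl, app_mulC, app_addC,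
      Env.cons_zero, Env.cons_succ]
    rw [mul_S, mul_S, h, add_S, add_S, add_assoc', add_assoc', add_comm' n x]

theorem mul_comm' (x y : M.C nat) : x * y = y * x := by
  have := induct (Γ := [nat]) (mul v1 v0 ≐ mul v0 v1) (x ∷ .nil) ?_ (fun n h => ?_) y
  · simpa using this
  · simp [mul_zero', zero_mul']
  · simp at h
    simp [mul_S, S_mul, h]

theorem mul_add' (x y z : M.C nat) : x * (y + z) = x * y + x * z := by
  have := induct (Γ := [nat, nat]) (mul v1 (add v2 v0) ≐ add (mul v1 v2) (mul v1 v0))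
    (x ∷ y ∷ .nil) ?_
    (fun n h => ?_) z
  · simpa using this
  · simp [mul_zero', add_zero']
  · simp at h
    simp [add_S, mul_S, h, add_assoc']

theorem mul_assoc' (x y z : M.C nat) : x * y * z = x * (y * z) := by
  have := induct (Γ := [nat, nat]) (mul (mul v1 v2) v0 ≐ mul v1 (mul v2 v0)) (x ∷ y ∷ .nil) ?_
    (fun n h => ?_) z
  · simpa using this
  · simp [mul_zero']
  · simp at h
    simp [mul_S, h, mul_add']

instance : CommSemiring (M.C nat) where
  add_assoc := add_assoc'
  zero_add := zero_add'
  add_zero := add_zero'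
  add_comm := add_comm'
  nsmul := nsmulRec
  left_distrib := mul_add'
  right_distrib x y z := by rw [mul_comm', mul_add', mul_comm', mul_comm' z]
  zero_mul := zero_mul'
  mul_zero := mul_zero'
  mul_assoc := mul_assoc'
  one_mul x := by rw [show (1 : M.C nat) = S 0 from rfl, S_mul, zero_mul', zero_add']
  mul_one x := by rw [show (1 : M.C nat) = S 0 from rfl, mul_S, mul_zero', zero_add']
  mul_comm := mul_comm'

attribute [simp] S_eq

/-- Induction for formulas with parameters, in terms of `n + 1`. -/
theorem induct' {Γ : Ctx} (φ : Fm (nat :: Γ)) (e : Env M Γ) (h0 : φ.sat (0 ∷ e))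
    (hs : ∀ n, φ.sat (n ∷ e) → φ.sat ((n + 1) ∷ e)) (n : M.C nat) : φ.sat (n ∷ e) :=
  induct φ e h0 (fun n hn => S_eq n ▸ hs n hn) n

@[simp] theorem recM_add_one {ρ : Ty} (n : M.C nat) (b : M.C ρ) (f : M.C (ρ ⇒ₜ nat ⇒ₜ ρ)) :
    recM (n + 1) b f = M.app (M.app f (recM n b f)) n := by rw [← S_eq, recM_succ]

theorem add_one_ne_zero' (n : M.C nat) : n + 1 ≠ 0 := S_eq n ▸ S_ne_zero n

theorem add_one_inj' {n m : M.C nat} (h : n + 1 = m + 1) : n = m :=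
  S_inj (by rw [S_eq, S_eq, h])

theorem exists_pred (n : M.C nat) (h : n ≠ 0) : ∃ m, n = m + 1 := by
  have := induct' (Γ := []) (v0 ≐ zero ⋎' ex nat (v1 ≐ suc v0)) .nil (.inl rfl)
    (fun n _ => .inr ⟨n, by simp⟩) n
  simpa [h] using this

theorem add_right_cancel' {x y z : M.C nat} (h : x + z = y + z) : x = y := by
  have := induct' (Γ := [nat, nat]) (add v1 v0 ≐ add v2 v0 ⟹' v1 ≐ v2) (x ∷ y ∷ .nil) ?_ ?_ z
  · simp only [Fm.sat, eval_app, eval_var, eval_cl, app_addC, Env.cons_zero, Env.cons_succ] at this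
    exact this h
  · simp
  · intro n hn h
    simp only [Fm.sat, eval_app, eval_var, eval_cl, app_addC, Env.cons_zero,
      Env.cons_succ, ← add_assoc] at h hn ⊢
    exact hn (add_one_inj' h)

theorem eq_zero_of_add {x y : M.C nat} (h : x + y = 0) : x = 0 := by
  by_contra hx
  obtain ⟨m, rfl⟩ := exists_pred x hx
  exact add_one_ne_zero' (m + y) (by rw [← h]; ring)

/-- This yields totality of the order, which is defined below by existence of a difference. -/
theorem exists_add_or (x y : M.C nat) : ∃ z, x + z = y ∨ y + z = x := by
  have := induct' (Γ := [nat]) (ex nat (add v2 v0 ≐ v1 ⋎' add v1 v0 ≐ v2)) (x ∷ .nil) ?_ ?_ y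
  · simpa using this
  · exact ⟨x, by simp⟩
  · rintro n ⟨z, hz⟩
    simp only [Fm.sat, eval_app, eval_var, eval_cl, app_addC, Env.cons_zero,
      Env.cons_succ] at hz ⊢
    rcases hz with rfl | rfl
    · exact ⟨z + 1, .inl (by ring)⟩
    · by_cases hz : z = 0
      · exact ⟨1, .inl (by rw [hz, add_zero])⟩
      · obtain ⟨m, rfl⟩ := exists_pred z hz
        exact ⟨m, .inr (by ring)⟩

open Classical in
noncomputable instance : LinearOrder (M.C nat) where
  le x y := ∃ z, y = x + z
  le_refl x := ⟨0, by simp⟩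
  le_trans := by
    rintro x y z ⟨u, rfl⟩ ⟨v, rfl⟩
    exact ⟨u + v, by ring⟩
  le_antisymm := by
    rintro x y ⟨u, rfl⟩ ⟨v, hv⟩
    have : u + v = 0 := add_right_cancel' (z := x) (by rw [zero_add]; nth_rw 2 [hv]; ring)
    rw [eq_zero_of_add this, add_zero]
  le_total x y := by
    obtain ⟨z, h | h⟩ := exists_add_or x y
    · exact .inl ⟨z, h.symm⟩
    · exact .inr ⟨z, h.symm⟩
  toDecidableLE := Classical.decRel _

instance : IsOrderedCancelAddMonoid (M.C nat) where
  add_le_add_left x y h z := by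
    obtain ⟨u, rfl⟩ := h
    exact ⟨u, by ring⟩
  le_of_add_le_add_left x y z h := by
    obtain ⟨u, hu⟩ := h
    exact ⟨u, add_right_cancel' (z := x) (by rw [add_comm, hu]; ring)⟩

instance : CanonicallyOrderedAdd (M.C nat) where
  exists_add_of_le h := h
  le_self_add _ y := ⟨y, rfl⟩
  le_add_self _ y := ⟨y, add_comm _ _⟩

instance : Nontrivial (M.C nat) := ⟨1, 0, by simpa using add_one_ne_zero' (0 : M.C nat)⟩

theorem lt_add_one_iff' {x y : M.C nat} : x < y + 1 ↔ x ≤ y := by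
  constructor
  · intro h
    by_contra! hxy
    obtain ⟨z, rfl⟩ := hxy.le
    have hz : z ≠ 0 := by rintro rfl; simp at hxy
    obtain ⟨m, rfl⟩ := exists_pred z hz
    exact absurd h (not_lt.2 ⟨m, by ring⟩)
  · intro h
    refine lt_of_le_of_ne (h.trans ⟨1, rfl⟩) ?_
    rintro rfl
    obtain ⟨z, hz⟩ := h
    refine add_one_ne_zero' z (add_right_cancel' (z := y) ?_)
    rw [zero_add]; nth_rw 2 [hz]; ring

theorem exists_add_one_of_lt {x y : M.C nat} (h : x < y) : ∃ z, y = x + z + 1 := by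
  obtain ⟨z, rfl⟩ := h.le
  have hz : z ≠ 0 := by rintro rfl; simp at h
  obtain ⟨m, rfl⟩ := exists_pred z hz
  exact ⟨m, by ring⟩

theorem mul_lt_mul_left'' {x y z : M.C nat} (hz : 0 < z) (h : x < y) : z * x < z * y := by
  obtain ⟨w, rfl⟩ := exists_add_one_of_lt h
  obtain ⟨v, rfl⟩ := exists_add_one_of_lt hz
  rw [show (0 + v + 1) * (x + w + 1) = (0 + v + 1) * x + (v * w + v + w) + 1 by ring]
  exact lt_add_one_iff'.2 ⟨_, rfl⟩

instance : IsStrictOrderedRing (M.C nat) where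
  zero_le_one := zero_le
  mul_lt_mul_of_pos_left _ hz _ _ h := mul_lt_mul_left'' hz h
  mul_lt_mul_of_pos_right z hz x y h := by
    show x * z < y * z
    rw [mul_comm x, mul_comm y]; exact mul_lt_mul_left'' hz h

end

end ProbContent

namespace ProbContent

open Ty Tm Fm

/-! ### Arithmetic terms in a model -/

variable {M : Str}

section

variable [hM : Model M]

open Classical in
@[simp] theorem recM_cond {Γ : Ctx} (c a : M.C nat) (b : Tm Γ nat) (e : Env M Γ) :
    recM c a ((lam (lam b.wk.wk)).eval e) = if c = 0 then a else b.eval e := by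
  split_ifs with h
  · rw [h]; exact recM_zero _ _
  · obtain ⟨m, hm⟩ := exists_pred _ h
    rw [hm, recM_add_one]
    simp

end

/-- The variable with index `n` does not occur in the term. -/
def Tm.Avoids {Γ : Ctx} (n : ℕ) {τ : Ty} : Tm Γ τ → Prop
  | .var v => v.idx ≠ n
  | .const _ => True
  | .app f a => f.Avoids n ∧ a.Avoids n

theorem Tm.avoids_cl {Γ : Ctx} (n : ℕ) {τ : Ty} (t : Tm [] τ) :
    (t.cl : Tm Γ τ).Avoids n := by
  rw [Tm.cl]
  induction t with
  | var v => cases v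
  | const c => trivial
  | app f a ihf iha => exact ⟨ihf, iha⟩

theorem Tm.avoids_lam {Γ : Ctx} (n : ℕ) {σ τ : Ty} (t : Tm (σ :: Γ) τ) :
    (lam t).Avoids n ↔ t.Avoids (n + 1) := by
  induction t with
  | var v => cases v <;> simp [lam, Tm.Avoids, Var.idx]
  | const c => simp [lam, Tm.Avoids]
  | app f a ihf iha => simp [lam, Tm.Avoids, ihf, iha]

theorem Tm.Avoids.eval_congr {Γ : Ctx} {τ σ : Ty} {t : Tm (σ :: Γ) τ}
    (h : t.Avoids 0) (e : Env M Γ) (x y : M.C σ) : t.eval (x ∷ e) = t.eval (y ∷ e) := by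
  induction t with
  | var v => cases v with
    | zero => exact absurd rfl h
    | succ v => rfl
  | const c => rfl
  | app f a ihf iha => rw [eval_app, eval_app, ihf h.1, iha h.2]

@[simp] theorem avoids_var {Γ : Ctx} (n : ℕ) {τ : Ty} (v : Var Γ τ) :
    (var v).Avoids n ↔ v.idx ≠ n := Iff.rfl

@[simp] theorem avoids_const {Γ : Ctx} (n : ℕ) {τ : Ty} (c : Const τ) :
    (const c : Tm Γ τ).Avoids n := trivial

@[simp] theorem avoids_app {Γ : Ctx} (n : ℕ) {σ τ : Ty} (f : Tm Γ (σ ⇒ₜ τ)) (a : Tm Γ σ) :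
    (f ⊙ a).Avoids n ↔ f.Avoids n ∧ a.Avoids n := Iff.rfl

@[simp] theorem avoids_recT {Γ : Ctx} {ρ : Ty} (k : ℕ) (n : Tm Γ nat) (b : Tm Γ ρ)
    (f : Tm Γ (ρ ⇒ₜ nat ⇒ₜ ρ)) :
    (recT n b f).Avoids k ↔ n.Avoids k ∧ b.Avoids k ∧ f.Avoids k :=
  ⟨fun h => ⟨h.1.1.2, h.1.2, h.2⟩, fun h => ⟨⟨⟨trivial, h.1⟩, h.2.1⟩, h.2.2⟩⟩

@[simp] theorem avoids_wk {Γ : Ctx} (n : ℕ) {σ τ : Ty} (t : Tm Γ τ) :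
    (t.ren (Ren.wk (σ := σ))).Avoids (n + 1) ↔ t.Avoids n := by
  induction t with
  | var v => simp [Tm.ren, Ren.wk, Var.idx]
  | const c => exact Iff.rfl
  | app f a ihf iha => simp [Tm.ren, ihf, iha]

attribute [simp] Tm.avoids_cl Tm.avoids_lam Var.idx

/-- Predecessor. -/
def predM (x : M.C nat) : M.C nat := M.app (predC.eval .nil) x

/-- Remainder modulo `2`. -/
def parM (x : M.C nat) : M.C nat := M.app (parC.eval .nil) x

/-- Half. -/
def halfM (x : M.C nat) : M.C nat := M.app (halfC.eval .nil) x

/-- Power of two. -/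
def powM (x : M.C nat) : M.C nat := M.app (powC.eval .nil) x

/-- Triangular numbers. -/
def triM (x : M.C nat) : M.C nat := M.app (triC.eval .nil) x

/-- Triangular root. -/
def rootM (x : M.C nat) : M.C nat := M.app (rootC.eval .nil) x

/-- Pairing. -/
def pairM (x y : M.C nat) : M.C nat := M.app (M.app (pairC.eval .nil) x) y

/-- First projection. -/
def fstM (x : M.C nat) : M.C nat := M.app (fstC.eval .nil) x

/-- Second projection. -/
def sndM (x : M.C nat) : M.C nat := M.app (sndC.eval .nil) x

@[simp] theorem app_predC (x : M.C nat) : M.app (predC.eval .nil) x = predM x := rfl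
@[simp] theorem app_parC (x : M.C nat) : M.app (parC.eval .nil) x = parM x := rfl
@[simp] theorem app_halfC (x : M.C nat) : M.app (halfC.eval .nil) x = halfM x := rfl
@[simp] theorem app_powC (x : M.C nat) : M.app (powC.eval .nil) x = powM x := rfl
@[simp] theorem app_triC (x : M.C nat) : M.app (triC.eval .nil) x = triM x := rfl
@[simp] theorem app_rootC (x : M.C nat) : M.app (rootC.eval .nil) x = rootM x := rfl
@[simp] theorem app_pairC (x y : M.C nat) :
    M.app (M.app (pairC.eval .nil) x) y = pairM x y := rfl
@[simp] theorem app_fstC (x : M.C nat) : M.app (fstC.eval .nil) x = fstM x := rfl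
@[simp] theorem app_sndC (x : M.C nat) : M.app (sndC.eval .nil) x = sndM x := rfl

section

variable [hM : Model M]

/-- The bound variable is the recursion index, so base and step are evaluated at `n + 1` on the left
and at `n` in the recursive value. The two agree because neither term mentions that variable. -/
theorem app_lam_recT_succ {Γ : Ctx} {ρ : Ty} (b : Tm (nat :: Γ) ρ)
    (f : Tm (nat :: Γ) (ρ ⇒ₜ nat ⇒ₜ ρ)) (e : Env M Γ) (n : M.C nat) (hb : b.Avoids 0)
    (hf : f.Avoids 0) : M.app ((lam (recT v0 b f)).eval e) (n + 1) =
      M.app (M.app (f.eval (n ∷ e)) (M.app ((lam (recT v0 b f)).eval e) n)) n := by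
  rw [app_lam, app_lam, eval_recT, eval_recT, hf.eval_congr e (n + 1) n, hb.eval_congr e (n + 1) n]
  exact recM_add_one _ _ _

@[simp] theorem predM_zero : predM (0 : M.C nat) = 0 := by
  rw [← app_predC]; simp [predC]

@[simp] theorem predM_add_one (x : M.C nat) : predM (x + 1) = x := by
  rw [← app_predC]; simp [predC]

theorem sub_zero' (x : M.C nat) : x - 0 = x := by
  rw [← app_subC]; simp [subC]

theorem sub_add_one (x y : M.C nat) : x - (y + 1) = predM (x - y) := by
  rw [← S_eq y, ← app_subC, ← app_subC]; simp [subC, -S_eq]; rfl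

theorem add_one_sub_add_one (x y : M.C nat) : x + 1 - (y + 1) = x - y := by
  have := induct' (Γ := [nat]) (sub (suc v1) (suc v0) ≐ sub v1 v0) (x ∷ .nil) ?_ (fun n h => ?_) y
  · simpa using this
  · have := sub_add_one (x + 1) 0
    rw [zero_add, sub_zero', predM_add_one] at this
    simp [sub_zero', this]
  · simp at h
    simp [sub_add_one _ (n + 1), h]
    rw [sub_add_one]

theorem add_sub_cancel'' (x y : M.C nat) : x + y - y = x := by
  have := induct' (Γ := [nat]) (sub (add v1 v0) v0 ≐ v1) (x ∷ .nil) ?_ (fun n h => ?_) y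
  · simpa using this
  · simp [sub_zero']
  · simp at h
    simp [← add_assoc, add_one_sub_add_one, h]

theorem sub_add_cancel'' (x y : M.C nat) : x - (x + y) = 0 := by
  have h0 : ∀ y : M.C nat, 0 - y = 0 := fun y => by
    have := induct' (Γ := []) (sub zero v0 ≐ zero) .nil ?_ (fun n h => ?_) y
    · simpa using this
    · simp [sub_zero']
    · simp at h
      simp [sub_add_one, h]
  have := induct' (Γ := [nat]) (sub v0 (add v0 v1) ≐ zero) (y ∷ .nil) ?_ (fun n h => ?_) x
  · simpa using this
  · simp [h0]
  · simp at h
    simp [add_right_comm n 1 y, add_one_sub_add_one, h]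

/-- Matches the formula `le0` of the system, which says that a cut-off difference vanishes, with the
algebraic order. -/
instance : OrderedSub (M.C nat) where
  tsub_le_iff_right a b c := by
    rcases le_total a b with h | h
    · obtain ⟨z, rfl⟩ := h
      rw [sub_add_cancel'']
      exact iff_of_true zero_le ⟨c + z, by ring⟩
    · obtain ⟨z, rfl⟩ := h
      rw [add_comm b z, add_sub_cancel'']
      exact (add_le_add_iff_right b).symm

attribute [simp] tsub_eq_zero_iff_le

theorem natPos_iff {x : M.C nat} : 0 < x ↔ 1 ≤ x := by
  rw [← lt_add_one_iff', lt_add_iff_pos_left]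

theorem lt_iff_add_one_le {x y : M.C nat} : x < y ↔ x + 1 ≤ y := by
  constructor
  · intro h
    obtain ⟨z, rfl⟩ := exists_add_one_of_lt h
    exact ⟨z, by ring⟩
  · exact fun h => lt_of_lt_of_le (lt_add_one_iff'.2 le_rfl) h

theorem one_sub_eq_zero_iff {x : M.C nat} : 1 - x = 0 ↔ x ≠ 0 := by
  rw [tsub_eq_zero_iff_le, ← natPos_iff, pos_iff_ne_zero]

/-! ### Parity -/

theorem parM_zero : parM (0 : M.C nat) = 0 := by rw [← app_parC]; simp [parC]

theorem parM_add_one (x : M.C nat) : parM (x + 1) = 1 - parM x := by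
  
  refine (app_lam_recT_succ _ _ _ x (by simp) (by simp)).trans ?_
  change M.app (M.app _ (parM x)) x = _
  simp

theorem halfM_zero : halfM (0 : M.C nat) = 0 := by rw [← app_halfC]; simp [halfC]

theorem halfM_add_one (x : M.C nat) : halfM (x + 1) = halfM x + parM x := by
  
  refine (app_lam_recT_succ _ _ _ x (by simp) (by simp)).trans ?_
  change M.app (M.app _ (halfM x)) x = _
  simp

theorem parM_halfM_double (x : M.C nat) : parM (2 * x) = 0 ∧ halfM (2 * x) = x := by
  have := induct' (Γ := []) (cl parC ⊙ mul (suc (suc zero)) v0 ≐ zero ⋏'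
    cl halfC ⊙ mul (suc (suc zero)) v0 ≐ v0) .nil ?_ (fun n h => ?_) x
  · simpa [one_add_one_eq_two] using this
  · simp [parM_zero, halfM_zero]
  · simp [one_add_one_eq_two] at h
    simp [one_add_one_eq_two]
    rw [show (2 : M.C nat) * (n + 1) = 2 * n + 1 + 1 by ring]
    simp [parM_add_one, halfM_add_one, h]

theorem parM_double (x : M.C nat) : parM (2 * x) = 0 := (parM_halfM_double x).1
theorem halfM_double (x : M.C nat) : halfM (2 * x) = x := (parM_halfM_double x).2
theorem parM_double_add_one (x : M.C nat) : parM (2 * x + 1) = 1 := by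
  simp [parM_add_one, parM_double]

/-! ### Powers of two -/

theorem powM_zero : powM (0 : M.C nat) = 1 := by rw [← app_powC]; simp [powC]

theorem powM_add_one (x : M.C nat) : powM (x + 1) = 2 * powM x := by
  
  refine (app_lam_recT_succ _ _ _ x (by simp) (by simp)).trans ?_
  change M.app (M.app _ (powM x)) x = _
  simp [two_mul]

theorem powM_ne_zero (x : M.C nat) : powM x ≠ 0 := by
  have := induct' (Γ := []) (not (cl powC ⊙ v0 ≐ zero)) .nil ?_ (fun n h => ?_) x
  · simpa using this
  · simp [powM_zero]
  · simp at h
    simp [powM_add_one, h, two_mul]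

/-! ### Pairing -/

theorem triM_zero : triM (0 : M.C nat) = 0 := by rw [← app_triC]; simp [triC]

theorem triM_add_one (x : M.C nat) : triM (x + 1) = triM x + (x + 1) := by
  
  refine (app_lam_recT_succ _ _ _ x (by simp) (by simp)).trans ?_
  change M.app (M.app _ (triM x)) x = _
  simp

theorem rootM_zero : rootM (0 : M.C nat) = 0 := by rw [← app_rootC]; simp [rootC]

open Classical in
theorem rootM_add_one (x : M.C nat) : rootM (x + 1) =
    if triM (rootM x + 1) - (x + 1) = 0 then rootM x + 1 else rootM x := by
  refine (app_lam_recT_succ _ _ _ x (by simp) (by simp)).trans ?_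
  change M.app (M.app _ (rootM x)) x = _
  simp

theorem pairM_eq (x y : M.C nat) : pairM x y = triM (x + y) + x := by
  rw [← app_pairC]; simp [pairC]

theorem fstM_eq (x : M.C nat) : fstM x = x - triM (rootM x) := by
  rw [← app_fstC]; simp [fstC]

theorem sndM_eq (x : M.C nat) : sndM x = rootM x - fstM x := by
  rw [← app_sndC]; simp [sndC]

theorem triM_mono {x y : M.C nat} (h : x ≤ y) : triM x ≤ triM y := by
  obtain ⟨z, rfl⟩ := h
  have := induct' (Γ := [nat]) (le0 (cl triC ⊙ v1) (cl triC ⊙ add v1 v0)) (x ∷ .nil) ?_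
    (fun n h => ?_) z
  · simpa using this
  · simp
  · simp at h
    simp [← add_assoc, triM_add_one]
    exact h.trans ⟨x + (n + 1), by ring⟩

/-- From `n` to `n + 1` the root grows by at most one, because consecutive triangular numbers are at
least one apart; so the single test in the recursion suffices. -/
theorem rootM_spec (x : M.C nat) : triM (rootM x) ≤ x ∧ x < triM (rootM x + 1) := by
  have := induct' (Γ := []) (le0 (cl triC ⊙ (cl rootC ⊙ v0)) v0 ⋏'
    le0 (suc v0) (cl triC ⊙ suc (cl rootC ⊙ v0))) .nil ?_ (fun n h => ?_) x
  · rw [lt_iff_add_one_le]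
    simpa using this
  · simp [rootM_zero, triM_zero]
    rw [← zero_add (1 : M.C nat), triM_add_one, triM_zero, zero_add, zero_add]
  · simp at h
    simp [rootM_add_one]
    split_ifs with hc
    · refine ⟨hc, ?_⟩
      rw [triM_add_one]
      exact add_le_add h.2 ⟨rootM n + 1, by ring⟩
    · rw [not_le, lt_iff_add_one_le] at hc
      exact ⟨h.1.trans ⟨1, rfl⟩, hc⟩

theorem rootM_eq {x r : M.C nat} (h : triM r ≤ x) (h' : x < triM (r + 1)) : rootM x = r := by
  obtain ⟨k, k'⟩ := rootM_spec x
  refine le_antisymm ?_ ?_ <;> rw [← lt_add_one_iff'] <;> by_contra! hc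
  · exact absurd (h'.trans_le ((triM_mono hc).trans k)) (lt_irrefl _)
  · exact absurd (k'.trans_le ((triM_mono hc).trans h)) (lt_irrefl _)

/-- The code lies on the diagonal `x + y`, between consecutive triangular numbers, so the root
recovers the sum and then both components. -/
theorem rootM_pairM (x y : M.C nat) : rootM (pairM x y) = x + y := by
  rw [pairM_eq]
  refine rootM_eq ⟨_, rfl⟩ ?_
  rw [triM_add_one, lt_iff_add_one_le]
  exact ⟨y, by ring⟩

@[simp] theorem fstM_pairM (x y : M.C nat) : fstM (pairM x y) = x := by
  rw [fstM_eq, rootM_pairM, pairM_eq, add_comm, add_sub_cancel'']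

@[simp] theorem sndM_pairM (x y : M.C nat) : sndM (pairM x y) = y := by
  rw [sndM_eq, fstM_pairM, rootM_pairM, add_comm, add_sub_cancel'']

end

end ProbContent

/-! ### Differences and fractions of a canonically ordered semiring -/

namespace ProbContent

/-! ### The ordered field of fractions of an ordered semiring -/

section OrderedField

variable (R : Type) [CommSemiring R] [LinearOrder R] [IsStrictOrderedRing R]

/-- Two pairs are equivalent if they have the same formal difference. -/
def diffSetoid : Setoid (R × R) where
  r a b := a.1 + b.2 = b.1 + a.2
  iseqv := ⟨fun _ => rfl, fun h => h.symm, fun {a b c} h k => by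
    refine add_right_cancel (b := b.2) ?_
    calc a.1 + c.2 + b.2 = (a.1 + b.2) + c.2 := by ring
      _ = (b.1 + c.2) + a.2 := by rw [h]; ring
      _ = c.1 + a.2 + b.2 := by rw [k]; ring⟩

/-- The ring of formal differences. -/
def DiffRing : Type := Quotient (diffSetoid R)

namespace DiffRing

variable {R}

/-- The formal difference of two elements. -/
def mk (a b : R) : DiffRing R := Quotient.mk (diffSetoid R) (a, b)

theorem mk_eq {a b c d : R} : mk a b = mk c d ↔ a + d = c + b := Quotient.eq

theorem ind {p : DiffRing R → Prop} (h : ∀ a b, p (mk a b)) (x : DiffRing R) : p x :=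
  Quotient.inductionOn x fun a => h a.1 a.2

instance : Zero (DiffRing R) := ⟨mk 0 0⟩
instance : One (DiffRing R) := ⟨mk 1 0⟩
instance : Add (DiffRing R) := ⟨Quotient.map₂ (fun a b => (a.1 + b.1, a.2 + b.2))
  fun a a' h b b' k => by
    show a.1 + b.1 + (a'.2 + b'.2) = a'.1 + b'.1 + (a.2 + b.2)
    calc _ = (a.1 + a'.2) + (b.1 + b'.2) := by ring
      _ = (a'.1 + a.2) + (b'.1 + b.2) := congrArg₂ _ h k
      _ = _ := by ring⟩
instance : Neg (DiffRing R) := ⟨Quotient.map (fun a => (a.2, a.1)) fun a a' h => by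
    show a.2 + a'.1 = a'.2 + a.1
    rw [add_comm, add_comm a'.2]; exact Eq.symm h⟩
instance : Mul (DiffRing R) :=
  ⟨Quotient.map₂ (fun a b => (a.1 * b.1 + a.2 * b.2, a.1 * b.2 + a.2 * b.1))
  fun a a' h b b' k => by
    have h : a.1 + a'.2 = a'.1 + a.2 := h
    have k : b.1 + b'.2 = b'.1 + b.2 := k
    show a.1 * b.1 + a.2 * b.2 + (a'.1 * b'.2 + a'.2 * b'.1) =
      a'.1 * b'.1 + a'.2 * b'.2 + (a.1 * b.2 + a.2 * b.1)
    refine add_right_cancel (b := a'.2 * b.1 + a'.1 * b.2) ?_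
    calc _ = (a.1 + a'.2) * b.1 + (a'.1 + a.2) * b.2 + a'.1 * b'.2 + a'.2 * b'.1 := by ring
      _ = (a'.1 + a.2) * b.1 + (a.1 + a'.2) * b.2 + a'.1 * b'.2 + a'.2 * b'.1 := by rw [h]
      _ = a'.1 * (b.1 + b'.2) + a'.2 * (b'.1 + b.2) + a.2 * b.1 + a.1 * b.2 := by ring
      _ = a'.1 * (b'.1 + b.2) + a'.2 * (b.1 + b'.2) + a.2 * b.1 + a.1 * b.2 := by rw [k]
      _ = _ := by ring⟩

theorem mk_add (a b c d : R) : mk a b + mk c d = mk (a + c) (b + d) := rfl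
theorem mk_mul (a b c d : R) : mk a b * mk c d = mk (a * c + b * d) (a * d + b * c) := rfl
theorem neg_mk (a b : R) : -mk a b = mk b a := rfl
theorem zero_def : (0 : DiffRing R) = mk 0 0 := rfl
theorem one_def : (1 : DiffRing R) = mk 1 0 := rfl

instance : CommRing (DiffRing R) where
  add_assoc x y z := by
    induction x using ind; induction y using ind; induction z using ind
    simp only [mk_add, add_assoc]
  zero_add x := by induction x using ind; simp only [zero_def, mk_add, zero_add]
  add_zero x := by induction x using ind; simp only [zero_def, mk_add, add_zero]
  add_comm x y := by
    induction x using ind; induction y using ind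
    rw [mk_add, mk_add, mk_eq]; ring
  nsmul := nsmulRec
  zsmul := zsmulRec
  neg_add_cancel x := by
    induction x using ind
    rw [neg_mk, mk_add, zero_def, mk_eq]; ring
  left_distrib x y z := by
    induction x using ind; induction y using ind; induction z using ind
    simp only [mk_add, mk_mul]; rw [mk_eq]; ring
  right_distrib x y z := by
    induction x using ind; induction y using ind; induction z using ind
    simp only [mk_add, mk_mul]; rw [mk_eq]; ring
  zero_mul x := by induction x using ind; rw [zero_def, mk_mul, mk_eq]; ring
  mul_zero x := by induction x using ind; rw [zero_def, mk_mul, mk_eq]; ring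
  mul_assoc x y z := by
    induction x using ind; induction y using ind; induction z using ind
    simp only [mk_mul]; rw [mk_eq]; ring
  one_mul x := by induction x using ind; rw [one_def, mk_mul, mk_eq]; ring
  mul_one x := by induction x using ind; rw [one_def, mk_mul, mk_eq]; ring
  mul_comm x y := by
    induction x using ind; induction y using ind
    rw [mk_mul, mk_mul, mk_eq]; ring

/-- The embedding of the semiring. -/
def of : R →+* DiffRing R where
  toFun a := mk a 0
  map_one' := rfl
  map_zero' := rfl
  map_add' a b := by rw [mk_add, add_zero]
  map_mul' a b := by rw [mk_mul, mk_eq]; ring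

theorem of_injective : Function.Injective (of (R := R)) := fun a b h => by
  simpa using mk_eq.1 h

variable [CanonicallyOrderedAdd R]

/-- By totality one of two elements is the other plus a remainder, so a formal difference is a
semiring element up to sign. Questions about zero divisors and signs thereby descend to `R`. -/
theorem eq_of_or (x : DiffRing R) : ∃ a, x = of a ∨ x = -of a := by
  induction x using ind with
  | h a b =>
    rcases le_total a b with h | h
    · obtain ⟨c, rfl⟩ := exists_add_of_le h
      refine ⟨c, .inr ?_⟩
      show _ = -mk c 0
      rw [neg_mk, mk_eq]; ring
    · obtain ⟨c, rfl⟩ := exists_add_of_le h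
      refine ⟨c, .inl ?_⟩
      show _ = mk c 0
      rw [mk_eq]; ring

instance : Nontrivial (DiffRing R) := of_injective.nontrivial

instance : NoZeroDivisors (DiffRing R) where
  eq_zero_or_eq_zero_of_mul_eq_zero {x y} h := by
    have key : ∀ a b : R, of a * of b = 0 → of a = 0 ∨ of b = 0 := fun a b h => by
      have h : a * b = 0 := of_injective (by rw [map_mul, h, map_zero])
      by_contra! hc
      have ha : 0 < a := pos_iff_ne_zero.2 fun h => hc.1 (by rw [h, map_zero])
      have hb : 0 < b := pos_iff_ne_zero.2 fun h => hc.2 (by rw [h, map_zero])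
      exact (mul_pos ha hb).ne' h
    obtain ⟨a, ha⟩ := eq_of_or x
    obtain ⟨b, hb⟩ := eq_of_or y
    have := key a b (by rcases ha with rfl | rfl <;> rcases hb with rfl | rfl <;> simpa using h)
    rcases ha with rfl | rfl <;> rcases hb with rfl | rfl <;> simpa using this

instance : IsDomain (DiffRing R) := NoZeroDivisors.to_isDomain _

end DiffRing

variable [CanonicallyOrderedAdd R]

/-- The field of fractions of an ordered semiring. -/
def FracField : Type := FractionRing (DiffRing R)

noncomputable instance : Field (FracField R) := inferInstanceAs (Field (FractionRing (DiffRing R)))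

namespace FracField

variable {R}

/-- The embedding of the semiring. -/
noncomputable def of : R →+* FracField R :=
  (algebraMap (DiffRing R) (FractionRing (DiffRing R))).comp DiffRing.of

theorem of_injective : Function.Injective (of (R := R)) :=
  (IsFractionRing.injective (DiffRing R) (FractionRing (DiffRing R))).comp DiffRing.of_injective

theorem of_eq_zero {a : R} : of a = 0 ↔ a = 0 := by
  rw [← map_zero of, of_injective.eq_iff]

theorem exists_mul_of (x : FracField R) :
    ∃ a b : R, b ≠ 0 ∧ (x * of b = of a ∨ -x * of b = of a) := by
  obtain ⟨p, q, hq, rfl⟩ := IsFractionRing.div_surjective (A := DiffRing R)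
    (K := FractionRing (DiffRing R)) x
  have hq := nonZeroDivisors.ne_zero hq
  obtain ⟨a, ha⟩ := p.eq_of_or
  obtain ⟨b, hb⟩ := q.eq_of_or
  have hb0 : b ≠ 0 := by rintro rfl; simp at hb; exact hq hb
  have hb' : of b ≠ 0 := fun h => hb0 (of_eq_zero.1 h)
  refine ⟨a, b, hb0, ?_⟩
  rcases ha with rfl | rfl <;> rcases hb with rfl | rfl
  · left
    show of a / of b * of b = of a
    field_simp
  · right
    rw [map_neg]
    show -(of a / -of b) * of b = of a
    field_simp
  · right
    rw [map_neg]
    show -(-of a / of b) * of b = of a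
    field_simp
  · left
    rw [map_neg, map_neg]
    show -of a / -of b * of b = of a
    field_simp

variable (R) in
/-- The nonnegative elements. -/
def cone : RingCone (FracField R) where
  carrier := {x | ∃ a b : R, b ≠ 0 ∧ x * of b = of a}
  zero_mem' := ⟨0, 1, one_ne_zero, by simp⟩
  one_mem' := ⟨1, 1, one_ne_zero, by simp⟩
  add_mem' := by
    rintro x y ⟨a, b, hb, h⟩ ⟨c, d, hd, k⟩
    refine ⟨a * d + c * b, b * d, (mul_pos (pos_iff_ne_zero.2 hb) (pos_iff_ne_zero.2 hd)).ne', ?_⟩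
    simp only [map_add, map_mul, ← h, ← k]; ring
  mul_mem' := by
    rintro x y ⟨a, b, hb, h⟩ ⟨c, d, hd, k⟩
    refine ⟨a * c, b * d, (mul_pos (pos_iff_ne_zero.2 hb) (pos_iff_ne_zero.2 hd)).ne', ?_⟩
    simp only [map_mul, ← h, ← k]; ring
  eq_zero_of_mem_of_neg_mem' := by
    rintro x ⟨a, b, hb, h⟩ ⟨c, d, hd, k⟩
    -- If `x = a / b` and `-x = c / d`, then `a d + c b = 0`; in a canonically ordered semiring both
    -- summands vanish, so `a = 0`.
    have e : of (a * d + c * b) = 0 := by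
      simp only [map_add, map_mul, ← h, ← k]; ring
    rw [of_eq_zero, add_eq_zero] at e
    have ha : a = 0 := by
      by_contra ha
      exact (mul_pos (pos_iff_ne_zero.2 ha) (pos_iff_ne_zero.2 hd)).ne' e.1
    rw [ha, map_zero, mul_eq_zero, of_eq_zero] at h
    exact h.resolve_right hb

instance : HasMemOrNegMem (cone R) where
  mem_or_neg_mem x := by
    obtain ⟨a, b, hb, h | h⟩ := exists_mul_of x
    · exact .inl ⟨a, b, hb, h⟩
    · exact .inr ⟨a, b, hb, h⟩

variable (R) in
-- The cone of nonnegative fractions is total by `exists_mul_of`, so it defines a field order. The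
-- order and its properties are stated in one existential so that the instances below refer to the
-- same choice.
theorem exists_linearOrder : ∃ _ : LinearOrder (FracField R),
    IsStrictOrderedRing (FracField R) ∧ StrictMono (of (R := R)) := by
  classical
  let _ : LinearOrder (FracField R) := .mkOfAddGroupCone (cone R)
  have _ : IsOrderedRing (FracField R) := .mkOfCone (cone R)
  refine ⟨inferInstance, IsOrderedRing.toIsStrictOrderedRing _,
    Monotone.strictMono_of_injective ?_ of_injective⟩
  intro a b h
  obtain ⟨c, rfl⟩ := exists_add_of_le h
  rw [map_add, le_add_iff_nonneg_right]
  show of c - 0 ∈ cone R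
  exact ⟨c, 1, one_ne_zero, by simp⟩

noncomputable instance : LinearOrder (FracField R) := (exists_linearOrder R).choose

instance : IsStrictOrderedRing (FracField R) := (exists_linearOrder R).choose_spec.1

theorem of_strictMono : StrictMono (of (R := R)) := (exists_linearOrder R).choose_spec.2

end FracField

end OrderedField

end ProbContent

/-! ### Rational and real numbers of a model -/

namespace ProbContent

open Ty Tm Fm

/-! ### Coded rationals in a model -/

variable {M : Str}

/-- Numerator, positive part. -/
def posM (x : M.C nat) : M.C nat := M.app (posC.eval .nil) x
/-- Numerator, negative part. -/
def negM (x : M.C nat) : M.C nat := M.app (negC.eval .nil) x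
/-- Denominator. -/
def denM (x : M.C nat) : M.C nat := M.app (denC.eval .nil) x
/-- The code of a rational. -/
def mkQM (p m d : M.C nat) : M.C nat := M.app (M.app (M.app (mkQC.eval .nil) p) m) d
/-- Addition of codes. -/
def qaddM (x y : M.C nat) : M.C nat := M.app (M.app (qaddC.eval .nil) x) y
/-- Subtraction of codes. -/
def qsubM (x y : M.C nat) : M.C nat := M.app (M.app (qsubC.eval .nil) x) y
/-- Absolute value of codes. -/
def qabsM (x : M.C nat) : M.C nat := M.app (qabsC.eval .nil) x
/-- Comparison of codes. -/
def qleM (x y : M.C nat) : M.C nat := M.app (M.app (qleC.eval .nil) x) y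
/-- Strict comparison of codes. -/
def qltM (x y : M.C nat) : M.C nat := M.app (M.app (qltC.eval .nil) x) y
/-- The code of a power of two. -/
def qpowM (x : M.C nat) : M.C nat := M.app (qpowC.eval .nil) x

@[simp] theorem app_posC (x : M.C nat) : M.app (posC.eval .nil) x = posM x := rfl
@[simp] theorem app_negC (x : M.C nat) : M.app (negC.eval .nil) x = negM x := rfl
@[simp] theorem app_denC (x : M.C nat) : M.app (denC.eval .nil) x = denM x := rfl
@[simp] theorem app_mkQC (p m d : M.C nat) :
    M.app (M.app (M.app (mkQC.eval .nil) p) m) d = mkQM p m d := rfl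
@[simp] theorem app_qaddC (x y : M.C nat) :
    M.app (M.app (qaddC.eval .nil) x) y = qaddM x y := rfl
@[simp] theorem app_qsubC (x y : M.C nat) :
    M.app (M.app (qsubC.eval .nil) x) y = qsubM x y := rfl
@[simp] theorem app_qabsC (x : M.C nat) : M.app (qabsC.eval .nil) x = qabsM x := rfl
@[simp] theorem app_qleC (x y : M.C nat) : M.app (M.app (qleC.eval .nil) x) y = qleM x y := rfl
@[simp] theorem app_qltC (x y : M.C nat) : M.app (M.app (qltC.eval .nil) x) y = qltM x y := rfl
@[simp] theorem app_qpowC (x : M.C nat) : M.app (qpowC.eval .nil) x = qpowM x := rfl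

section

variable [hM : Model M]

theorem posM_eq (x : M.C nat) : posM x = halfM (fstM x) * (1 - parM (fstM x)) := by
  rw [← app_posC]; simp [posC]

theorem negM_eq (x : M.C nat) : negM x = halfM (fstM x + 1) * parM (fstM x) := by
  rw [← app_negC]; simp [negC]

theorem denM_eq (x : M.C nat) : denM x = sndM x + 1 := by
  rw [← app_denC]; simp [denC]

theorem denM_ne_zero (x : M.C nat) : denM x ≠ 0 := by
  rw [denM_eq]; exact add_one_ne_zero' _

theorem mkQM_eq (p m d : M.C nat) :
    mkQM p m d = pairM (2 * (p - m) + predM (2 * (m - p))) (predM d) := by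
  rw [← app_mkQC]; simp [mkQC, one_add_one_eq_two]

theorem denM_mkQM (p m : M.C nat) {d : M.C nat} (hd : d ≠ 0) : denM (mkQM p m d) = d := by
  obtain ⟨d, rfl⟩ := exists_pred d hd
  rw [denM_eq, mkQM_eq, sndM_pairM, predM_add_one]

/-- At most one of the cut-off differences is nonzero. A nonnegative numerator gets the even code `2
(p - m)`, a negative one the odd code `2 (m - p) - 1`, and the parity tells them apart. -/
theorem posM_negM_mkQM (p m d : M.C nat) :
    posM (mkQM p m d) = p - m ∧ negM (mkQM p m d) = m - p := by
  rw [posM_eq, negM_eq, mkQM_eq, fstM_pairM]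
  rcases le_or_gt m p with h | h
  · rw [tsub_eq_zero_of_le h, mul_zero, predM_zero, add_zero, parM_double, halfM_double]
    simp
  · obtain ⟨z, rfl⟩ := exists_add_one_of_lt h
    rw [tsub_eq_zero_of_le h.le, add_assoc, add_tsub_cancel_left,
      show (2 : M.C nat) * (z + 1) = 2 * z + 1 + 1 by ring, predM_add_one, mul_zero, zero_add,
      parM_double_add_one, show (2 : M.C nat) * z + 1 + 1 = 2 * (z + 1) by ring, halfM_double]
    simp

/-- The ordered field of the model. -/
abbrev Fld (M : Str) [Model M] : Type := FracField (M.C nat)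

/-- The embedding of the natural numbers of the model. -/
noncomputable def ι (x : M.C nat) : Fld M := FracField.of x

theorem ι_zero : ι (0 : M.C nat) = 0 := map_zero _
theorem ι_one : ι (1 : M.C nat) = 1 := map_one _
theorem ι_two : ι (2 : M.C nat) = 2 := map_ofNat FracField.of 2
theorem ι_add (x y : M.C nat) : ι (x + y) = ι x + ι y := map_add _ _ _
theorem ι_mul (x y : M.C nat) : ι (x * y) = ι x * ι y := map_mul _ _ _
theorem ι_le {x y : M.C nat} : ι x ≤ ι y ↔ x ≤ y := FracField.of_strictMono.le_iff_le
theorem ι_pos {x : M.C nat} (hx : x ≠ 0) : 0 < ι x := by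
  rw [← ι_zero]; exact FracField.of_strictMono (pos_iff_ne_zero.2 hx)
theorem ι_nonneg (x : M.C nat) : 0 ≤ ι x := by rw [← ι_zero, ι_le]; exact zero_le
theorem ι_sub_sub (x y : M.C nat) : ι (x - y) - ι (y - x) = ι x - ι y := by
  rcases le_total x y with h | h
  · rw [tsub_eq_zero_of_le h, ι_zero]
    nth_rw 2 [← tsub_add_cancel_of_le h]
    rw [ι_add]; ring
  · rw [tsub_eq_zero_of_le h, ι_zero]
    nth_rw 2 [← tsub_add_cancel_of_le h]
    rw [ι_add]; ring

/-- The value of a coded rational. -/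
noncomputable def val (x : M.C nat) : Fld M := (ι (posM x) - ι (negM x)) / ι (denM x)

theorem val_mkQM (p m : M.C nat) {d : M.C nat} (hd : d ≠ 0) :
    val (mkQM p m d) = (ι p - ι m) / ι d := by
  rw [val, denM_mkQM p m hd, (posM_negM_mkQM p m d).1, (posM_negM_mkQM p m d).2, ι_sub_sub]

theorem posM_mul_negM (x : M.C nat) : posM x = 0 ∨ negM x = 0 := by
  rw [posM_eq, negM_eq]
  have : parM (fstM x) = 0 ∨ 1 - parM (fstM x) = 0 := by
    by_cases h : parM (fstM x) = 0
    · exact .inl h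
    · exact .inr (one_sub_eq_zero_iff.2 h)
  rcases this with h | h <;> simp [h]

theorem val_qaddM (x y : M.C nat) : val (qaddM x y) = val x + val y := by
  have hx := (ι_pos (denM_ne_zero x)).ne'
  have hy := (ι_pos (denM_ne_zero y)).ne'
  rw [← app_qaddC]
  simp only [qaddC, app_lam, eval_app, eval_cl, eval_var, Env.cons_zero, Env.cons_succ, app_mkQC,
    app_addC, app_mulC, app_posC, app_negC, app_denC]
  rw [val_mkQM _ _ (mul_ne_zero (denM_ne_zero x) (denM_ne_zero y)), val, val]
  simp only [ι_add, ι_mul]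
  field_simp
  ring

theorem val_qsubM (x y : M.C nat) : val (qsubM x y) = val x - val y := by
  rw [← app_qsubC]
  simp only [qsubC, app_lam, eval_app, eval_cl, eval_var, Env.cons_zero, Env.cons_succ, app_mkQC,
    app_qaddC, app_posC, app_negC, app_denC]
  rw [val_qaddM, val_mkQM _ _ (denM_ne_zero y), val, val]
  ring

theorem val_qabsM (x : M.C nat) : val (qabsM x) = |val x| := by
  have hx := ι_pos (denM_ne_zero x)
  rw [← app_qabsC]
  simp only [qabsC, app_lam, eval_app, eval_cl, eval_var, Env.cons_zero, app_mkQC,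
    app_addC, app_posC, app_negC, app_denC, eval_const, cst_zero]
  rw [val_mkQM _ _ (denM_ne_zero x), val, ι_add, ι_zero, abs_div, abs_of_pos hx]
  congr 1
  rcases posM_mul_negM x with h | h <;> rw [h, ι_zero]
  · rw [zero_sub, abs_neg, abs_of_nonneg (ι_nonneg _)]; ring
  · rw [sub_zero, sub_zero, abs_of_nonneg (ι_nonneg (posM x)), add_zero]

theorem qleM_eq_zero {x y : M.C nat} : qleM x y = 0 ↔ val x ≤ val y := by
  have hx := ι_pos (denM_ne_zero x)
  have hy := ι_pos (denM_ne_zero y)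
  rw [← app_qleC]
  simp only [qleC, app_lam, eval_app, eval_cl, eval_var, Env.cons_zero, Env.cons_succ,
    app_subC, app_addC, app_mulC, app_posC, app_negC, app_denC]
  rw [tsub_eq_zero_iff_le, ← ι_le, val, val, div_le_div_iff₀ hx hy]
  simp only [ι_add, ι_mul]
  constructor <;> intro h <;> linarith

theorem qltM_eq_zero {x y : M.C nat} : qltM x y = 0 ↔ val x < val y := by
  rw [← app_qltC]
  simp only [qltC, app_lam, eval_app, eval_cl, eval_var, Env.cons_zero, Env.cons_succ,
    app_subC, app_qleC, eval_const, cst_zero, app_succ, S_eq, zero_add]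
  rw [one_sub_eq_zero_iff, Ne, qleM_eq_zero, not_le]

/-- The field element `2 ^ (-n)`. -/
noncomputable def eps (n : M.C nat) : Fld M := 1 / ι (powM n)

theorem eps_pos (n : M.C nat) : 0 < eps n := one_div_pos.2 (ι_pos (powM_ne_zero n))

theorem eps_add_one (n : M.C nat) : eps (n + 1) = eps n / 2 := by
  rw [eps, eps, powM_add_one, ι_mul, ι_two, one_div, one_div, mul_inv]; ring

theorem val_qpowM (n : M.C nat) : val (qpowM n) = eps n := by
  rw [← app_qpowC]
  simp only [qpowC, app_lam, eval_app, eval_cl, eval_var, Env.cons_zero, app_mkQC, app_powC,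
    eval_const, cst_zero, app_succ, S_eq, zero_add]
  rw [val_mkQM _ _ (powM_ne_zero n), ι_one, ι_zero, sub_zero, eps]

attribute [simp] qleM_eq_zero qltM_eq_zero val_qpowM val_qaddM val_qsubM val_qabsM

theorem eps_anti {m n : M.C nat} (h : m ≤ n) : eps n ≤ eps m := by
  obtain ⟨z, rfl⟩ := h
  have := induct' (Γ := [nat]) (leQ (qpow (add v1 v0)) (qpow v1)) (m ∷ .nil) ?_ (fun n h => ?_) z
  · simpa using this
  · simp
  · simp [← add_assoc, eps_add_one] at h ⊢
    linarith [eps_pos (m + n)]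

end

end ProbContent

namespace ProbContent

open Ty Tm Fm Filter

/-! ### Real numbers in a model -/

variable {M : Str}

/-- The index at which the regularization is frozen. -/
def hatIdxM (f : M.C real) (n : M.C nat) : M.C nat := M.app (M.app (hatIdxC.eval .nil) f) n
/-- Regularization. -/
def hatM (f : M.C real) (n : M.C nat) : M.C nat := M.app (M.app (hatC.eval .nil) f) n
/-- Addition of reals. -/
def raddM (f g : M.C real) : M.C real := M.app (M.app (raddC.eval .nil) f) g
/-- Subtraction of reals. -/
def rsubM (f g : M.C real) : M.C real := M.app (M.app (rsubC.eval .nil) f) g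
/-- The reals `2 ^ (-k)`. -/
def rpowM (k : M.C nat) : M.C real := M.app (rpowC.eval .nil) k
/-- Finite sums of reals. -/
def rsumM (F : M.C (nat ⇒ₜ real)) (l : M.C nat) : M.C real :=
  M.app (M.app (rsumC.eval .nil) F) l

@[simp] theorem app_hatIdxC (f : M.C real) (n : M.C nat) :
    M.app (M.app (hatIdxC.eval .nil) f) n = hatIdxM f n := rfl
@[simp] theorem app_hatC (f : M.C real) (n : M.C nat) :
    M.app (M.app (hatC.eval .nil) f) n = hatM f n := rfl
@[simp] theorem app_raddC (f g : M.C real) :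
    M.app (M.app (raddC.eval .nil) f) g = raddM f g := rfl
@[simp] theorem app_rsubC (f g : M.C real) :
    M.app (M.app (rsubC.eval .nil) f) g = rsubM f g := rfl
@[simp] theorem app_rpowC (k : M.C nat) : M.app (rpowC.eval .nil) k = rpowM k := rfl
@[simp] theorem app_rsumC (F : M.C (nat ⇒ₜ real)) (l : M.C nat) :
    M.app (M.app (rsumC.eval .nil) F) l = rsumM F l := rfl

section

variable [hM : Model M]

theorem hatM_eq (f : M.C real) (n : M.C nat) : hatM f n = M.app f (hatIdxM f n) := by
  rw [← app_hatC]; simp [hatC]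

theorem hatIdxM_zero (f : M.C real) : hatIdxM f 0 = 0 := by
  rw [← app_hatIdxC]; simp [hatIdxC]

open Classical in
theorem hatIdxM_add_one (f : M.C real) (n : M.C nat) : hatIdxM f (n + 1) =
    if n ≤ hatIdxM f n ∧ |val (M.app f n) - val (M.app f (n + 1))| < eps (n + 1)
      then n + 1 else hatIdxM f n := by
  have key := app_lam_recT_succ (M := M) zero (lam (lam
    (cond (add (sub v0 v1) (cl qltC ⊙ qabs (qsub (v3 ⊙ v0) (v3 ⊙ suc v0)) ⊙ qpow (suc v0)))
      (suc v0) v1))) (f ∷ .nil) n (by simp) (by simp)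
  have e : ∀ n, hatIdxM f n = M.app ((lam (recT v0 zero (lam (lam
    (cond (add (sub v0 v1) (cl qltC ⊙ qabs (qsub (v3 ⊙ v0) (v3 ⊙ suc v0)) ⊙ qpow (suc v0)))
      (suc v0) v1))))).eval (f ∷ .nil)) n := fun n => by
    rw [← app_hatIdxC, hatIdxC, app_lam]
  rw [e, key, ← e]
  simp

theorem hatIdxM_le (f : M.C real) (n : M.C nat) : hatIdxM f n ≤ n := by
  have := induct' (Γ := [real]) (le0 (cl hatIdxC ⊙ v1 ⊙ v0) v0) (f ∷ .nil) ?_ (fun n h => ?_) n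
  · simpa using this
  · simp [hatIdxM_zero]
  · simp at h
    simp [hatIdxM_add_one]
    split_ifs
    · exact le_rfl
    · exact h.trans ⟨1, rfl⟩

/-- The rational approximations of the real number represented by `f`. -/
noncomputable def approx (f : M.C real) (n : M.C nat) : Fld M := val (hatM f n)

/-- Holds for every `f`: the index advances only after the test on consecutive terms has succeeded,
and otherwise the sequence is frozen and the difference is zero. -/
theorem approx_step (f : M.C real) (n : M.C nat) :
    |approx f n - approx f (n + 1)| < eps (n + 1) := by
  rw [approx, approx, hatM_eq, hatM_eq, hatIdxM_add_one]
  split_ifs with h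
  · rw [le_antisymm (hatIdxM_le f n) h.1]
    exact h.2
  · rw [sub_self, abs_zero]; exact eps_pos _

/-- A sequence that passes all tests is never frozen, so regularization does not change it. -/
theorem approx_eq (f : M.C real)
    (hf : ∀ n, |val (M.app f n) - val (M.app f (n + 1))| < eps (n + 1)) (n : M.C nat) :
    approx f n = val (M.app f n) := by
  have := induct' (Γ := [real]) (cl hatIdxC ⊙ v1 ⊙ v0 ≐ v0) (f ∷ .nil) ?_ (fun n h => ?_) n
  · simp at this
    rw [approx, hatM_eq, this]
  · simp [hatIdxM_zero]
  · simp at h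
    simp [hatIdxM_add_one, h, hf n]

/-- The bound is the exact geometric sum of the steps. Subtracting `eps (n + z)` is what lets the
induction on `z` close. -/
theorem approx_cauchy' (f : M.C real) (n z : M.C nat) :
    |approx f n - approx f (n + z)| ≤ eps n - eps (n + z) := by
  have := induct' (Γ := [nat, real]) (leQ (qabs (qsub (hat v2 v1) (hat v2 (add v1 v0))))
    (qsub (qpow v1) (qpow (add v1 v0)))) (n ∷ f ∷ .nil) ?_ (fun z h => ?_) z
  · simpa [approx] using this
  · simp
  · simp [← add_assoc] at h ⊢
    have h₁ := approx_step f (n + z)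
    rw [approx, approx, eps_add_one] at h₁
    rw [eps_add_one]
    calc _ ≤ _ := abs_sub_le _ (val (hatM f (n + z))) _
      _ ≤ _ := by linarith

theorem approx_cauchy (f : M.C real) {n m : M.C nat} (h : n ≤ m) :
    |approx f n - approx f m| ≤ eps n - eps m := by
  obtain ⟨z, rfl⟩ := h
  exact approx_cauchy' f n z

theorem lt_powM (n : M.C nat) : n < powM n := by
  have := induct' (Γ := []) (le0 (suc v0) (cl powC ⊙ v0)) .nil ?_ (fun n h => ?_) n
  · rw [lt_iff_add_one_le]; simpa using this
  · simp [powM_zero]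
  · simp at h
    simp [powM_add_one, two_mul]
    exact add_le_add h (le_trans ⟨n, by rw [add_comm]⟩ h)

/-- The field need not be Archimedean over the standard integers, but it is over those of the model:
a positive fraction with denominator `b` is at least `1 / b`, and `b < 2 ^ b`. -/
theorem exists_eps_lt {x : Fld M} (hx : 0 < x) : ∃ k, eps k < x := by
  obtain ⟨a, b, hb, h⟩ := FracField.exists_mul_of x
  have hb' : 0 < ι b := ι_pos hb
  have hab : x * ι b = ι a := by
    refine h.resolve_right fun h => ?_
    have h : -x * ι b = ι a := h
    have := mul_pos hx hb'
    have := ι_nonneg a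
    linarith
  have ha : a ≠ 0 := by
    rintro rfl
    rw [ι_zero] at hab
    exact (mul_pos hx hb').ne' hab
  have ha' : 1 ≤ ι a := by
    rw [← ι_one, ι_le, ← natPos_iff, pos_iff_ne_zero]; exact ha
  refine ⟨b, ?_⟩
  have hlt : ι b < ι (powM b) := FracField.of_strictMono (lt_powM b)
  rw [eps, div_lt_iff₀ (hb'.trans hlt)]
  calc (1 : Fld M) ≤ x * ι b := by rw [hab]; exact ha'
    _ < x * ι (powM b) := mul_lt_mul_of_pos_left hlt hx

/-- The order of Cauchy sequences: `u ≤ v + 2 ^ (-k)` eventually, for all `k`. -/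
def LeF (u v : M.C nat → Fld M) : Prop := ∀ k, ∀ᶠ n in atTop, u n ≤ v n + eps k

theorem LeF.refl (u : M.C nat → Fld M) : LeF u u := fun k =>
  .of_forall fun n => by linarith [eps_pos k]

theorem LeF.trans {u v w : M.C nat → Fld M} (h : LeF u v) (h' : LeF v w) : LeF u w := fun k => by
  filter_upwards [h (k + 1), h' (k + 1)] with n h₁ h₂
  rw [eps_add_one] at h₁ h₂
  linarith

theorem LeF.add {u v u' v' : M.C nat → Fld M} (h : LeF u v) (h' : LeF u' v') :
    LeF (fun n => u n + u' n) (fun n => v n + v' n) := fun k => by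
  filter_upwards [h (k + 1), h' (k + 1)] with n h₁ h₂
  rw [eps_add_one] at h₁ h₂
  linarith

theorem LeF.sub {u v u' v' : M.C nat → Fld M} (h : LeF u v) (h' : LeF u' v') :
    LeF (fun n => u n - v' n) (fun n => v n - u' n) := fun k => by
  filter_upwards [h (k + 1), h' (k + 1)] with n h₁ h₂
  rw [eps_add_one] at h₁ h₂
  linarith

theorem LeF.const_le {x y : Fld M} (h : LeF (fun _ => x) (fun _ => y)) : x ≤ y := by
  by_contra! hc
  obtain ⟨k, hk⟩ := exists_eps_lt (sub_pos.2 hc)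
  obtain ⟨n, hn⟩ := (h k).exists
  linarith

/-- Equality of Cauchy sequences. -/
def EqF (u v : M.C nat → Fld M) : Prop := LeF u v ∧ LeF v u

theorem EqF.of_abs {u v : M.C nat → Fld M} (h : ∀ k, ∀ᶠ n in atTop, |u n - v n| ≤ eps k) :
    EqF u v := by
  refine ⟨fun k => ?_, fun k => ?_⟩ <;> filter_upwards [h k] with n hn
  · linarith [le_abs_self (u n - v n)]
  · linarith [neg_abs_le (u n - v n)]

theorem EqF.trans {u v w : M.C nat → Fld M} (h : EqF u v) (h' : EqF v w) : EqF u w :=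
  ⟨h.1.trans h'.1, h'.2.trans h.2⟩

theorem EqF.symm {u v : M.C nat → Fld M} (h : EqF u v) : EqF v u := ⟨h.2, h.1⟩

theorem EqF.add {u v u' v' : M.C nat → Fld M} (h : EqF u v) (h' : EqF u' v') :
    EqF (fun n => u n + u' n) (fun n => v n + v' n) := ⟨h.1.add h'.1, h.2.add h'.2⟩

theorem EqF.sub {u v u' v' : M.C nat → Fld M} (h : EqF u v) (h' : EqF u' v') :
    EqF (fun n => u n - u' n) (fun n => v n - v' n) := ⟨h.1.sub h'.2, h.2.sub h'.1⟩

/-- Translates the syntactic order, given by one gap `2 ^ (-n)` at index `n + 1`, into the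
comparison `LeF`, for which algebra is easy. Such a gap cannot be closed again by the later terms.
-/
theorem not_ltR_iff {f g : M.C real} :
    (¬ ∃ n, eps n ≤ approx f (n + 1) - approx g (n + 1)) ↔ LeF (approx f) (approx g) := by
  constructor
  · intro h k
    filter_upwards [eventually_ge_atTop (k + 1)] with n hn
    obtain ⟨z, rfl⟩ := hn
    have : ¬ _ := fun h' => h ⟨k + z, h'⟩
    rw [not_le, add_right_comm k z 1] at this
    linarith [eps_anti (show k ≤ k + z from ⟨z, rfl⟩)]
  · rintro h ⟨n, hn⟩
    -- The Cauchy bounds from `n + 1` on would leave only the gap `2 * eps m`, which tends to zero.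
    -- The strict inequality for one step of `f` provides a slack independent of `m`.
    have h₁ := approx_step f (n + 1)
    obtain ⟨k, hk⟩ := exists_eps_lt (sub_pos.2 h₁)
    obtain ⟨m, hm, hnm⟩ := ((h k).and (eventually_ge_atTop (n + 1 + 1))).exists
    have h₂ := approx_cauchy f hnm
    have h₃ := approx_cauchy g (le_trans ⟨1, rfl⟩ hnm)
    have h₄ := eps_pos m
    have h₅ := le_abs_self (approx f (n + 1) - approx f (n + 1 + 1))
    have h₆ := le_abs_self (approx f (n + 1 + 1) - approx f m)
    have h₇ := neg_abs_le (approx g (n + 1) - approx g m)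
    simp only [eps_add_one] at *
    linarith

/-- Totality of the order, available for regularized sequences though not for arbitrary ones: a gap
at one index fixes the order of all later terms. -/
theorem LeF.of_not {f g : M.C real} (h : ¬ LeF (approx f) (approx g)) :
    LeF (approx g) (approx f) := by
  rw [← not_ltR_iff, not_not] at h
  obtain ⟨n, hn⟩ := h
  intro k
  filter_upwards [eventually_ge_atTop (n + 1)] with m hm
  have h₂ := approx_cauchy f hm
  have h₃ := approx_cauchy g hm
  have h₄ := eps_pos m
  have h₅ := eps_pos k
  have h₆ := le_abs_self (approx f (n + 1) - approx f m)
  have h₇ := neg_abs_le (approx g (n + 1) - approx g m)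
  rw [eps_add_one] at *
  linarith

theorem sat_ltR {Γ : Ctx} (s t : Tm Γ real) (e : Env M Γ) :
    (ltR s t).sat e ↔ ¬ LeF (approx (t.eval e)) (approx (s.eval e)) := by
  rw [← not_ltR_iff, not_not]
  simp [ltR, approx]

theorem sat_leR {Γ : Ctx} (s t : Tm Γ real) (e : Env M Γ) :
    (leR s t).sat e ↔ LeF (approx (s.eval e)) (approx (t.eval e)) := by
  rw [← not_not (a := LeF _ _), ← sat_ltR]; rfl

theorem EqF.of_sat {Γ : Ctx} {s t : Tm Γ real} {e : Env M Γ} (h : (eqR s t).sat e) :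
    EqF (approx (s.eval e)) (approx (t.eval e)) := by
  have h : ∀ n, |approx (s.eval e) (n + 1) - approx (t.eval e) (n + 1)| < eps n := by
    simpa [eqR, approx] using h
  constructor <;> rw [← not_ltR_iff] <;> rintro ⟨n, hn⟩
  · linarith [h n, le_abs_self (approx (s.eval e) (n + 1) - approx (t.eval e) (n + 1))]
  · linarith [h n, neg_abs_le (approx (s.eval e) (n + 1) - approx (t.eval e) (n + 1))]

theorem approx_shift (f : M.C real) : EqF (fun n => approx f (n + 1)) (approx f) := by
  refine .of_abs fun k => ?_
  filter_upwards [eventually_ge_atTop k] with n hn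
  rw [abs_sub_comm]
  have := eps_anti (show k ≤ n + 1 from le_trans hn ⟨1, rfl⟩)
  linarith [approx_step f n]

/-- The index shift in `raddC` makes the two step errors, each below `eps (n + 2)`, add up to less
than `eps (n + 1)`; hence the sum is already regular and survives `hat` unchanged. -/
theorem approx_raddM (f g : M.C real) :
    EqF (approx (raddM f g)) (fun n => approx f n + approx g n) := by
  have e : ∀ n, val (M.app (raddM f g) n) = approx f (n + 1) + approx g (n + 1) := fun n => by
    rw [← app_raddC]; simp [raddC, approx]
  have : approx (raddM f g) = fun n => approx f (n + 1) + approx g (n + 1) := by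
    funext n
    rw [approx_eq, e]
    intro n
    rw [e, e]
    have h₁ := abs_lt.1 (approx_step f (n + 1))
    have h₂ := abs_lt.1 (approx_step g (n + 1))
    rw [eps_add_one (n + 1)] at h₁ h₂
    rw [abs_lt]
    constructor <;> linarith
  rw [this]
  exact (approx_shift f).add (approx_shift g)

theorem approx_rsubM (f g : M.C real) :
    EqF (approx (rsubM f g)) (fun n => approx f n - approx g n) := by
  have e : ∀ n, val (M.app (rsubM f g) n) = approx f (n + 1) - approx g (n + 1) := fun n => by
    rw [← app_rsubC]; simp [rsubC, approx]
  have : approx (rsubM f g) = fun n => approx f (n + 1) - approx g (n + 1) := by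
    funext n
    rw [approx_eq, e]
    intro n
    rw [e, e]
    have h₁ := abs_lt.1 (approx_step f (n + 1))
    have h₂ := abs_lt.1 (approx_step g (n + 1))
    rw [eps_add_one (n + 1)] at h₁ h₂
    rw [abs_lt]
    constructor <;> linarith
  rw [this]
  exact (approx_shift f).sub (approx_shift g)

theorem approx_const (f : M.C real) (x : Fld M) (h : ∀ n, val (M.app f n) = x) :
    approx f = fun _ => x := by
  funext n
  rw [approx_eq, h]
  intro n
  rw [h, h, sub_self, abs_zero]
  exact eps_pos _

theorem approx_rzeroC : approx (rzeroC.eval (.nil : Env M [])) = fun _ => 0 := by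
  refine approx_const _ _ fun n => ?_
  simp [rzeroC, val_mkQM, ι_zero]

theorem approx_roneC : approx (roneC.eval (.nil : Env M [])) = fun _ => 1 := by
  refine approx_const _ _ fun n => ?_
  simp [roneC, val_mkQM, ι_zero, ι_one]

theorem approx_rpowM (k : M.C nat) : approx (rpowM k) = fun _ => eps k := by
  refine approx_const _ _ fun n => ?_
  rw [← app_rpowC]; simp [rpowC]

theorem rsumM_zero (F : M.C (nat ⇒ₜ real)) : rsumM F 0 = M.app F 0 := by
  rw [← app_rsumC]; simp [rsumC]

theorem rsumM_add_one (F : M.C (nat ⇒ₜ real)) (l : M.C nat) :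
    rsumM F (l + 1) = raddM (rsumM F l) (M.app F (l + 1)) := by
  have key := app_lam_recT_succ (M := M) (v1 ⊙ zero) (lam (lam (radd v1 (v3 ⊙ suc v0))))
    (F ∷ .nil) l (by simp) (by simp)
  have e : ∀ l, rsumM F l = M.app ((lam (recT v0 (v1 ⊙ zero)
      (lam (lam (radd v1 (v3 ⊙ suc v0)))))).eval (F ∷ .nil)) l := fun l => by
    rw [← app_rsumC, rsumC, app_lam]
  rw [e, key, ← e]
  simp

end

end ProbContent

/-! ### Events, the content, and σ-additivity in a model -/

namespace ProbContent

open Ty Tm Fm Filter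

/-! ### Events in a model -/

variable {M : Str}

/-- The element relation. -/
def memM (x : M.C sample) (A : M.C event) : Prop := M.app (M.app (M.cst .mem) x) A = 0
/-- Complement. -/
def cplM (A : M.C event) : M.C event := M.app (M.cst .compl) A
/-- Union. -/
def cupM (A B : M.C event) : M.C event := M.app (M.app (M.cst .union) A) B
/-- Intersection. -/
def capM (A B : M.C event) : M.C event := cplM (cupM (cplM A) (cplM B))
/-- Probability content. -/
def prM (A : M.C event) : M.C real := M.app (M.cst .prob) A
/-- Finite unions. -/
def cupLM (A : M.C (nat ⇒ₜ event)) (n : M.C nat) : M.C event :=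
  M.app (M.app (cupLC.eval .nil) A) n
/-- Disjointification. -/
def disjM (A : M.C (nat ⇒ₜ event)) (n : M.C nat) : M.C event :=
  M.app (M.app (disjC.eval .nil) A) n

@[simp] theorem app_mem (x : M.C sample) (A : M.C event) :
    M.app (M.app (M.cst .mem) x) A = 0 ↔ memM x A := Iff.rfl
@[simp] theorem app_compl (A : M.C event) : M.app (M.cst .compl) A = cplM A := rfl
@[simp] theorem app_union (A B : M.C event) :
    M.app (M.app (M.cst .union) A) B = cupM A B := rfl
@[simp] theorem app_prob (A : M.C event) : M.app (M.cst .prob) A = prM A := rfl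
@[simp] theorem app_cupLC (A : M.C (nat ⇒ₜ event)) (n : M.C nat) :
    M.app (M.app (cupLC.eval .nil) A) n = cupLM A n := rfl
@[simp] theorem app_disjC (A : M.C (nat ⇒ₜ event)) (n : M.C nat) :
    M.app (M.app (disjC.eval .nil) A) n = disjM A n := rfl

/-- This and the next three lemmas show that substitution instances of the axioms on the content are
again such axioms, as `sat_of_axm` requires. -/
theorem ltR_subst {Γ Δ : Ctx} (s t : Tm Γ real) (σ : Sub Γ Δ) :
    (ltR s t).subst σ = ltR (s.subst σ) (t.subst σ) := by
  simp [ltR, Fm.subst, Tm.subst, Tm.wk_subst_up, Sub.up]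

theorem leR_subst {Γ Δ : Ctx} (s t : Tm Γ real) (σ : Sub Γ Δ) :
    (leR s t).subst σ = leR (s.subst σ) (t.subst σ) := by
  simp [leR, Fm.subst, ltR_subst]

theorem eqR_subst {Γ Δ : Ctx} (s t : Tm Γ real) (σ : Sub Γ Δ) :
    (eqR s t).subst σ = eqR (s.subst σ) (t.subst σ) := by
  simp [eqR, Fm.subst, Tm.subst, Tm.wk_subst_up, Sub.up]

theorem subS_subst {Γ Δ : Ctx} (s t : Tm Γ event) (σ : Sub Γ Δ) :
    (subS s t).subst σ = subS (s.subst σ) (t.subst σ) := by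
  simp [subS, Fm.subst, Tm.subst, Tm.wk_subst_up, Sub.up]

theorem sat_wk_up {Γ : Ctx} {σ τ : Ty} (φ : Fm (σ :: Γ)) (a : M.C σ) (b : M.C τ)
    (e : Env M Γ) : (φ.ren Ren.wk.up).sat (a ∷ b ∷ e) ↔ φ.sat (a ∷ e) := by
  rw [Fm.sat_ren]
  convert Iff.rfl using 2
  funext ρ v; cases v <;> rfl

section

variable [hM : Model M]

theorem not_mem_empty (x : M.C sample) : ¬ memM x (M.cst .empty) :=
  sat_of_axm (M := M) (Γ := [sample]) (not (memF v0 (const .empty))) (fun _ _ => .mem_empty _)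
    (x ∷ .nil)

@[simp] theorem mem_cplM (x : M.C sample) (A : M.C event) : memM x (cplM A) ↔ ¬ memM x A := by
  have := sat_of_axm (M := M) (Γ := [sample, event]) (iff (memF v0 (cpl v1)) (not (memF v0 v1)))
    (fun _ _ => .mem_compl _ _) (x ∷ A ∷ .nil)
  exact ⟨this.1, this.2⟩

@[simp] theorem mem_cupM (x : M.C sample) (A B : M.C event) :
    memM x (cupM A B) ↔ memM x A ∨ memM x B := by
  have := sat_of_axm (M := M) (Γ := [sample, event, event])
    (iff (memF v0 (cup v1 v2)) (memF v0 v1 ⋎' memF v0 v2))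
    (fun _ _ => .mem_union _ _ _) (x ∷ A ∷ B ∷ .nil)
  exact ⟨this.1, this.2⟩

@[simp] theorem mem_capM (x : M.C sample) (A B : M.C event) :
    memM x (capM A B) ↔ memM x A ∧ memM x B := by
  simp [capM, not_or]

theorem prM_range (A : M.C event) :
    LeF (fun _ => 0) (approx (prM A)) ∧ LeF (approx (prM A)) (fun _ => 1) := by
  have := sat_of_axm (M := M) (Γ := [event]) (leR (cl rzeroC) (pr v0) ⋏' leR (pr v0) (cl roneC))
    (fun _ s => by simpa [Fm.subst, leR_subst, Tm.subst] using Axm.prob_range (s _ .zero))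
    (A ∷ .nil)
  simpa [sat_leR, approx_rzeroC, approx_roneC] using this

theorem prM_empty : EqF (approx (prM (M.cst .empty))) (fun _ => 0) := by
  have := sat_of_axm (M := M) (Γ := []) (eqR (pr (const .empty)) (cl rzeroC))
    (fun _ s => by simpa [eqR_subst, Tm.subst] using Axm.prob_empty) .nil
  simpa [approx_rzeroC] using EqF.of_sat this

theorem prM_sure : EqF (approx (prM (cplM (M.cst .empty)))) (fun _ => 1) := by
  have := sat_of_axm (M := M) (Γ := []) (eqR (pr sure) (cl roneC))
    (fun _ s => by simpa [eqR_subst, Tm.subst] using Axm.prob_sure) .nil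
  simpa [approx_roneC] using EqF.of_sat this

theorem prM_mono {A B : M.C event} (h : ∀ x, memM x A → memM x B) :
    LeF (approx (prM A)) (approx (prM B)) := by
  have := sat_of_axm (M := M) (Γ := [event, event]) (subS v0 v1 ⟹' leR (pr v0) (pr v1))
    (fun _ s => by
      simpa [Fm.subst, leR_subst, subS_subst, Tm.subst] using
        Axm.prob_mono (s _ .zero) (s _ (.succ .zero))) (A ∷ B ∷ .nil)
  simp only [Fm.sat, sat_leR] at this
  exact this fun x hx => h x hx

theorem prM_congr {A B : M.C event} (h : ∀ x, memM x A ↔ memM x B) :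
    EqF (approx (prM A)) (approx (prM B)) :=
  ⟨prM_mono fun x => (h x).1, prM_mono fun x => (h x).2⟩

theorem prM_union (A B : M.C event) : EqF (approx (prM (cupM A B)))
    (fun n => approx (prM A) n + approx (prM B) n - approx (prM (capM A B)) n) := by
  have := sat_of_axm (M := M) (Γ := [event, event])
    (eqR (pr (cup v0 v1)) (rsub (radd (pr v0) (pr v1)) (pr (cap v0 v1))))
    (fun _ s => by
      simpa [eqR_subst, Tm.subst] using Axm.prob_union (s _ .zero) (s _ (.succ .zero)))
    (A ∷ B ∷ .nil)
  have := EqF.of_sat this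
  simp at this
  exact (this.trans (approx_rsubM _ _)).trans ((approx_raddM _ _).sub ⟨.refl _, .refl _⟩)

theorem prM_union_le (A B : M.C event) : LeF (approx (prM (cupM A B)))
    (fun n => approx (prM A) n + approx (prM B) n) := by
  refine (prM_union A B).1.trans ?_
  have := (LeF.refl fun n => approx (prM A) n + approx (prM B) n).sub (prM_range (capM A B)).1
  simpa using this

theorem prM_union_disjoint (A B : M.C event) (h : ∀ x, memM x A → ¬ memM x B) :
    EqF (approx (prM (cupM A B))) (fun n => approx (prM A) n + approx (prM B) n) := by
  have h₁ : EqF (approx (prM (capM A B))) (fun _ => 0) :=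
    (prM_congr fun x => by simpa [not_mem_empty] using h x).trans prM_empty
  have h₂ : EqF (fun n => approx (prM A) n + approx (prM B) n)
    (fun n => approx (prM A) n + approx (prM B) n) := ⟨.refl _, .refl _⟩
  have := (prM_union A B).trans (h₂.sub h₁)
  simpa using this

theorem cupLM_zero (A : M.C (nat ⇒ₜ event)) : cupLM A 0 = M.app A 0 := by
  rw [← app_cupLC]; simp [cupLC]

theorem cupLM_add_one (A : M.C (nat ⇒ₜ event)) (n : M.C nat) :
    cupLM A (n + 1) = cupM (cupLM A n) (M.app A (n + 1)) := by
  have key := app_lam_recT_succ (M := M) (v1 ⊙ zero) (lam (lam (cup v1 (v3 ⊙ suc v0))))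
    (A ∷ .nil) n (by simp) (by simp)
  have e : ∀ n, cupLM A n = M.app ((lam (recT v0 (v1 ⊙ zero)
      (lam (lam (cup v1 (v3 ⊙ suc v0)))))).eval (A ∷ .nil)) n := fun n => by
    rw [← app_cupLC, cupLC, app_lam]
  rw [e, key, ← e]
  simp

theorem disjM_zero (A : M.C (nat ⇒ₜ event)) : disjM A 0 = M.app A 0 := by
  rw [← app_disjC]; simp [disjC]

theorem disjM_add_one (A : M.C (nat ⇒ₜ event)) (n : M.C nat) :
    disjM A (n + 1) = capM (M.app A (n + 1)) (cplM (cupLM A n)) := by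
  rw [← app_disjC]; simp [disjC]; rfl

theorem mem_cupLM (A : M.C (nat ⇒ₜ event)) (x : M.C sample) (l : M.C nat) :
    memM x (cupLM A l) ↔ ∃ n ≤ l, memM x (M.app A n) := by
  have := induct' (Γ := [sample, nat ⇒ₜ event]) (iff (memF v1 (cupLC.cl ⊙ v2 ⊙ v0))
    (ex nat (le0 v0 v1 ⋏' memF v2 (v3 ⊙ v0)))) (x ∷ A ∷ .nil) ?_ (fun n h => ?_) l
  · simp only [Fm.sat, ← iff_iff_implies_and_implies] at this
    simpa using this
  · simp [cupLM_zero]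
  · simp only [Fm.sat, ← iff_iff_implies_and_implies] at h ⊢
    simp at h ⊢
    rw [cupLM_add_one, mem_cupM, h]
    constructor
    · rintro (⟨m, hm, hx⟩ | hx)
      · exact ⟨m, hm.trans ⟨1, rfl⟩, hx⟩
      · exact ⟨_, le_rfl, hx⟩
    · rintro ⟨m, hm, hx⟩
      rcases hm.lt_or_eq with h | rfl
      · exact .inl ⟨m, lt_add_one_iff'.1 h, hx⟩
      · exact .inr hx

/-- Finite additivity of the content. -/
theorem approx_rsumM (A : M.C (nat ⇒ₜ event)) (F : M.C (nat ⇒ₜ real))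
    (hF : ∀ n, M.app F n = prM (disjM A n)) (l : M.C nat) :
    EqF (approx (rsumM F l)) (approx (prM (cupLM A l))) := by
  -- Induction needs a formula of the system; two inequalities are used because `sat_leR` is an
  -- equivalence, whereas `EqF.of_sat` is only an implication.
  have := induct' (Γ := [nat ⇒ₜ real, nat ⇒ₜ event])
    (leR (cl rsumC ⊙ v1 ⊙ v0) (pr (cupLC.cl ⊙ v2 ⊙ v0)) ⋏'
      leR (pr (cupLC.cl ⊙ v2 ⊙ v0)) (cl rsumC ⊙ v1 ⊙ v0)) (F ∷ A ∷ .nil) ?_ (fun n h => ?_) l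
  · simp only [Fm.sat, sat_leR] at this
    simp at this
    exact this
  · simp [sat_leR, rsumM_zero, cupLM_zero, hF, disjM_zero, LeF.refl]
  · simp [sat_leR] at h ⊢
    change EqF _ _ at h
    change EqF _ _
    rw [rsumM_add_one, hF]
    refine (approx_raddM _ _).trans ?_
    refine (h.add ⟨.refl _, .refl _⟩).trans ?_
    -- The union up to `n` and the new disjointified event are disjoint, and together they make up
    -- the union up to `n + 1`.
    refine (prM_union_disjoint _ _ fun x hx => ?_).symm.trans (prM_congr fun x => ?_)
    · simp [disjM_add_one, hx]
    · rw [disjM_add_one, cupLM_add_one]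
      simp only [mem_cupM, mem_capM, mem_cplM]
      tauto

/-- The contents of the finite unions are a Cauchy sequence. -/
theorem exists_prM_cupLM_bound (A : M.C (nat ⇒ₜ event)) (k : M.C nat) : ∃ l, ∀ m, l ≤ m →
    LeF (approx (prM (cupLM A m))) (approx (raddM (prM (cupLM A l)) (rpowM k))) := by
  by_contra! hc
  -- If from every `l` the content could still grow by `2 ^ (-k)`, then induction on `j` would give
  -- finite unions of content at least `j * 2 ^ (-k)`, which is absurd for `j = 2 ^ k + 1`. The real
  -- `j * 2 ^ (-k)` is written as a constant sequence so that the induction formula belongs to the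
  -- language.
  have key := induct' (Γ := [nat, nat ⇒ₜ event]) (ex nat
    (leR (lam (mkQ v2 zero (cl powC ⊙ v3))) (pr (cupLC.cl ⊙ v3 ⊙ v0)))) (k ∷ A ∷ .nil) ?_
    (fun j h => ?_) (powM k + 1)
  all_goals
    have ec : ∀ l j : M.C nat, approx ((lam (mkQ v2 zero (cl powC ⊙ v3))).eval
        (l ∷ j ∷ k ∷ A ∷ .nil)) = fun _ => ι j * eps k := fun l j => by
      refine approx_const _ _ fun n => ?_
      simp [val_mkQM _ _ (powM_ne_zero k), ι_zero, eps, div_eq_mul_inv]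
    simp only [Fm.sat, sat_leR, ec] at *
  · obtain ⟨l, hl⟩ := key
    simp at hl
    have := (hl.trans (prM_range _).2).const_le
    rw [ι_add, add_mul, ι_one, one_mul, eps,
      mul_one_div_cancel (ι_pos (powM_ne_zero k)).ne'] at this
    linarith [one_div_pos.2 (ι_pos (powM_ne_zero k))]
  · refine ⟨0, ?_⟩
    simp [ι_zero]
    exact (prM_range _).1
  · obtain ⟨l, hl⟩ := h
    obtain ⟨m, hm, h⟩ := hc l
    refine ⟨m, ?_⟩
    simp at hl ⊢
    -- By totality, the failing upper bound for the content at `m` becomes a lower bound, which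
    -- supplies the next increment `2 ^ (-k)`.
    refine LeF.trans ?_ ((approx_raddM _ _).2.trans (.of_not h))
    rw [approx_rpowM]
    have := hl.add (.refl fun _ => eps k)
    simpa [ι_add, ι_one, add_mul] using this

/-- Uniform boundedness for membership in a sequence of events. -/
theorem exists_uniform_bound (A : M.C (nat ⇒ₜ event)) (B : M.C event)
    (h : ∀ x, ∃ n, memM x B ∨ memM x (M.app A n)) :
    ∃ N, ∀ x, ∃ n ≤ N, memM x B ∨ memM x (M.app A n) := by
  -- The formula is given over every parameter context because all substitution instances have to be
  -- derivable. It is quantifier-free and mentions only `n`, `ϖ`, `B` and `A`, so the minimum in the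
  -- principle has no effect.
  let φ : (Γ : Ctx) → Fm (nat :: ([sample] ++ arrows [] nat :: nat :: (nat ⇒ₜ arrows [] nat) ::
      event :: (nat ⇒ₜ event) :: Γ)) := fun Γ =>
    memF v1 (var (.succ (.succ (.succ (.succ (.succ .zero)))))) ⋎'
      memF v1 (var (.succ (.succ (.succ (.succ (.succ (.succ .zero)))))) ⊙ v0)
  -- The instance has `α = 0` and one variable of type `Ω`. The arguments `y`, `k` and `x` are
  -- dummies: `y` is instantiated by the successor, `k` and `x` by `0`.
  have key := hM.isModel.sat_of_prf (Γ := [])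
    (all (nat ⇒ₜ event) (all event (ubFormula _ [] [sample] (φ [])))) (fun Δ s => ?_) .nil A B
    (M.cst .succ) ?_
  · obtain ⟨χ, hχ⟩ := key
    refine ⟨M.app χ 0, fun x => ?_⟩
    obtain ⟨n, hn, hx⟩ := hχ 0 (0 : M.C nat) x
    simp [Var.inr] at hn
    exact ⟨n, hn, hx⟩
  · refine Prf.all_intro (Prf.all_intro (.extra ?_))
    have := UBOmegaZero.inst (Γ := event :: (nat ⇒ₜ event) :: Δ) [] [sample]
      (by simp [EndsInSample]) (φ Δ) (.qf ⟨trivial, trivial⟩)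
    exact this
  · intro k y x
    exact h x

/-- The first half of σ-additivity: if `B` contained every `A n`, it would contain the finite union,
and monotonicity would contradict `hB`. Uniform boundedness plays no role. -/
theorem exists_not_mem_and_mem (A : M.C (nat ⇒ₜ event)) (l : M.C nat) (B : M.C event)
    (hB : ¬ LeF (approx (prM (cupLM A l))) (approx (prM B))) :
    ∃ x, ¬ memM x B ∧ ∃ n, memM x (M.app A n) := by
  by_contra! hc
  refine hB (prM_mono fun x hx => ?_)
  by_contra hxB
  obtain ⟨n, -, hn⟩ := (mem_cupLM A x l).1 hx
  exact hc x hxB n hn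

/-- The second half: were `B` and the `A n` to cover the sample space, finitely many `A n` would
suffice, and subadditivity with the Cauchy bound would give `1 ≤ ℙ(B) + ℙ(A 0 ∪ … ∪ A l) + 2 ^
(-k)`. The index `l` depends only on `A` and `k`, as the order of quantifiers demands. -/
theorem exists_not_mem_and_not_mem (A : M.C (nat ⇒ₜ event)) (k : M.C nat) :
    ∃ l, ∀ B : M.C event,
      ¬ LeF (fun n => 1 - (approx (prM (cupLM A l)) n + eps k)) (approx (prM B)) →
      ∃ x, ¬ memM x B ∧ ∀ n, ¬ memM x (M.app A n) := by
  obtain ⟨l, hl⟩ := exists_prM_cupLM_bound A k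
  refine ⟨l, fun B hB => ?_⟩
  by_contra! hc
  obtain ⟨N, hN⟩ := exists_uniform_bound A B fun x => by
    by_cases hx : memM x B
    · exact ⟨0, .inl hx⟩
    · exact (hc x hx).imp fun n => .inr
  -- The maximum serves two ends: the finite union must reach `N` to complete the cover, and the
  -- Cauchy bound applies only from `l` on.
  have h₁ : LeF (fun _ => 1)
      (fun n => approx (prM B) n + approx (prM (cupLM A (max N l))) n) :=
    prM_sure.2.trans ((prM_mono fun x _ => by
      obtain ⟨n, hn, hx⟩ := hN x
      rw [mem_cupM, mem_cupLM]
      exact hx.imp_right fun hx => ⟨n, hn.trans (le_max_left _ _), hx⟩).trans (prM_union_le _ _))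
  have h₂ := (hl _ (le_max_right N l)).trans (approx_raddM _ _).1
  rw [approx_rpowM] at h₂
  have h₃ := (h₁.trans ((LeF.refl _).add h₂)).sub
    (.refl fun n => approx (prM (cupLM A l)) n + eps k)
  refine hB ?_
  simpa using h₃

theorem approx_partialSum {Γ : Ctx} (A : Tm Γ (nat ⇒ₜ event)) (l : Tm Γ nat) (e : Env M Γ) :
    EqF (approx ((partialSum A l).eval e)) (approx (prM (cupLM (A.eval e) (l.eval e)))) := by
  have := approx_rsumM (A.eval e) ((lam (pr (cl disjC ⊙ A.wk ⊙ v0))).eval e) (fun n => by simp)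
    (l.eval e)
  simpa [partialSum] using this

theorem sat_sigmaAdditivity : sigmaAdditivity.sat (Env.nil (M := M)) := by
  refine ⟨fun A l B hB => ?_, fun A k => ?_⟩
  · rw [sat_ltR] at hB
    obtain ⟨x, hx, n, hn⟩ := exists_not_mem_and_mem A l B fun h => hB <| by
      simpa using (approx_partialSum v1 v0 (l ∷ A ∷ .nil)).1.trans h
    refine ⟨x, by simpa using hx, ?_⟩
    rw [sat_wk_up]
    exact ⟨n, by simpa using hn⟩
  · obtain ⟨l, hl⟩ := exists_not_mem_and_not_mem A k
    refine ⟨l, fun B hB => ?_⟩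
    rw [sat_ltR] at hB
    obtain ⟨x, hx, hn⟩ := hl B fun h => hB <| by
      have h₁ := (approx_partialSum v2 v0 (l ∷ k ∷ A ∷ .nil)).add
        ⟨.refl (approx (rpowM k)), .refl _⟩
      have h₂ := (LeF.refl (approx (roneC.eval .nil))).sub ((approx_raddM _ _).trans h₁).2
      have h₃ := (approx_rsubM _ _).1.trans h₂
      rw [approx_roneC, approx_rpowM] at h₃
      simpa using h₃.trans h
    refine ⟨x, by simpa using hx, ?_⟩
    rw [sat_wk_up]
    -- The dual of an existential formula is universal, so avoidance of every single `A n` is what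
    -- remains.
    intro n
    simpa [Fm.dual] using hn n

end

end ProbContent

theorem mainTheorem10 : ProbContent.Proves ProbContent.UBΩ₀ ProbContent.sigmaAdditivity :=
  ProbContent.proves_of_sat fun M h =>
    have : ProbContent.Model M := ⟨h⟩
    ProbContent.sat_sigmaAdditivity
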